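/- **Setting.** Let $0<\beta<\sqrt\mu$ and let $f:\mathbb R\to[0,1]$ be measurable with $f(x)+f(-x)\le 1$ for all $x$. Let $A,B$ be qubits, with $\ket\pm=(\ket0\pm\ket1)/\sqrt2$, and let $C$ be an optical mode with Hilbert space $L^2(\mathbb R)$ (wave functions $\psi(x)=\braket{x|\psi}$). For $\omega=\omega_r+i\omega_i\in\mathbb C$ the coherent state $\ket\omega$ has wave function $$\braket{x|\omega}=(2/\pi)^{1/4}\exp[-(x-\omega_r)^2+2i\omega_i x-i\omega_r\omega_i].$$ The $n$-photon state has wave function $(2/\pi)^{1/4}(n!)^{-1/2}\mathrm{He}_n(2x)e^{-x^2}$, where $\mathrm{He}_n$ is the probabilists' Hermite polynomial, and $\Pi_{\rm ev}$, $\Pi_{\rm od}$ are the projections onto the closed spans of the even and odd photon-number states. All operator integrals below are weak, i.e. defined through matrix elements. **Phase-error operator.** Put $q=(1-e^{-2(\mu-\beta^2)})/2$, let $g_{m,V}$ be the normal density with mean $m$ and variance $V$, let $v_\pm(w)=\sqrt{g_{\beta,1/2}(w)}\ket0\pm\sqrt{g_{-\beta,1/2}(w)}\ket1$, and $$T(w)=\bra0_B\bigl[(1-q)\,v_+(w)v_+(w)^\dagger\otimes\ket+\!\bra+_B+q\,v_-(w)v_-(w)^\dagger\otimes\ket-\!\bra-_B\bigr]\ket1_B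 .$$ Let $u_+(w),u_-(w)$ be unit eigenvectors of $T(w)$ with positive and negative eigenvalue respectively, and $W(w)=u_+(w)u_+(w)^\dagger-u_-(w)u_-(w)^\dagger$. With $R=e^{-i\omega_i\beta Z_A}$ and $\text{C-}X_{BA}=\ket0\!\bra0_B\otimes I_A+\ket1\!\bra1_B\otimes X_A$, put $$K(\omega)=\sqrt{f(\omega_r)/\pi}\,(\ket0_B\bra\omega_C+\ket1_B\bra{-\omega}_C),\qquad V(\omega)=\bigl[\ket0\!\bra0_B\otimes R^\dagger+\ket1\!\bra1_B\otimes W(\omega_r)R^\dagger\bigr]\text{C-}X_{BA},$$ $$M^{\rm het}_{\rm ph}=\iint d\omega_r\,d\omega_i\,(I_A\otimes K(\omega))^\dagger V(\omega)^\dagger(I_A\otimes\ket-\!\bra-_B)V(\omega)(I_A\otimes K(\omega)).$$ For real $\kappa,\gamma$ let $$M^{\rm het}[\kappa,\gamma]=M^{\rm het}_{\rm ph}+\kappa\bigl(\ket0\!\bra0_A\otimes\ket\beta\!\bra\beta_C+\ket1\!\bra1_A\otimes\ket{-\beta}\!\bra{-\beta}_C\bigr)-\gamma\,\ket-\!\bra-_A\otimes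 I_C .$$ **Blocks.** Let $\theta(w)\in(-\pi/2,\pi/2)$ with $\tan\theta(w)=e^{-2(\mu-\beta^2)}\sinh(2\beta w)$. Write $w$ for $\omega_r$, let $\ket w$ be the coherent state with real amplitude $w$, and let $E_{x,y}(w)=\ket x\!\braket{x|w}\!\braket{w|y}\!\bra y$. Define $$M_{\rm oo}=\iint f(w)\,\Pi_{\rm od}\Bigl[E_{x,x}+\tfrac{\cos\theta(w)}2(E_{x,x-\beta}+E_{x-\beta,x})\Bigr]\Pi_{\rm od}\,dw\,dx,$$ $$M_{\rm ee}=\iint f(w)\,\Pi_{\rm ev}\Bigl[E_{x,x}-\tfrac{\cos\theta(w)}2(E_{x,x-\beta}+E_{x-\beta,x})\Bigr]\Pi_{\rm ev}\,dw\,dx,$$ and, for $s=\pm1$ ($s=1$ is $M_{(+,{\rm o})(-,{\rm e})}$ and $s=-1$ is $M_{(-,{\rm o})(+,{\rm e})}$), $$M^s_{\rm oe}=\iint f(w)\,\Pi_{\rm od}\Bigl[s\sin\theta(w)\,E_{x,x}-\tfrac{\cos\theta(w)}2(E_{x,x-\beta}-E_{x-\beta,x})\Bigr]\Pi_{\rm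 ev}\,dw\,dx,\qquad M^s_{\rm eo}=(M^s_{\rm oe})^\dagger .$$ **Parameters.** With the convention $0^{-1}=0$, put $C_{\rm o}=\bra\beta\Pi_{\rm od}\ket\beta$, $C_{\rm e}=\bra\beta\Pi_{\rm ev}\ket\beta$, and - $\lambda_{\rm oo}=C_{\rm o}^{-1}\bra\beta M_{\rm oo}\ket\beta$, $\lambda_{\rm ee}=C_{\rm e}^{-1}\bra\beta M_{\rm ee}\ket\beta$, $\lambda^s_{\rm oe}=(C_{\rm o}C_{\rm e})^{-1/2}\bra\beta M^s_{\rm oe}\ket\beta$; - $\sigma_{\rm oo}=(C_{\rm o}^{-1}\|M_{\rm oo}\ket\beta\|^2-\lambda_{\rm oo}^2)^{1/2}$, $\sigma^s_{\rm eo}=(C_{\rm o}^{-1}\|M^s_{\rm eo}\ket\beta\|^2-|\lambda^s_{\rm oe}|^2)^{1/2}$; - $\sigma^s_{\rm oe}=\sigma_{\rm oo}^{-1}\bigl((C_{\rm o}C_{\rm e})^{-1/2}\bra\beta M_{\rm oo}M^s_{\rm oe}\ket\beta-\lambda_{\rm oo}\lambda^s_{\rm oe}\bigr)$, $\sigma^s_{\rm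 ee}=(\sigma^s_{\rm eo})^{-1}\bigl((C_{\rm o}C_{\rm e})^{-1/2}\bra\beta M^s_{\rm oe}M_{\rm ee}\ket\beta-\lambda^s_{\rm oe}\lambda_{\rm ee}\bigr)$; - $\Delta^s_{\rm oe}=(C_{\rm e}^{-1}\|M^s_{\rm oe}\ket\beta\|^2-|\lambda^s_{\rm oe}|^2-|\sigma^s_{\rm oe}|^2)^{1/2}$, $\Delta^s_{\rm ee}=(C_{\rm e}^{-1}\|M_{\rm ee}\ket\beta\|^2-\lambda_{\rm ee}^2-|\sigma^s_{\rm ee}|^2)^{1/2}$. For real $a,b$ let $c^s=\kappa\sqrt{C_{\rm o}C_{\rm e}}+\lambda^s_{\rm oe}$ and $$N^s(\kappa;a,b)=\begin{pmatrix}1-a&0&0&\Delta^s_{\rm oe}&0&0\\0&1-a&\sigma_{\rm oo}&\sigma^s_{\rm oe}&0&0\\0&\sigma_{\rm oo}&\kappa C_{\rm o}+\lambda_{\rm oo}-a&c^s&\sigma^s_{\rm eo}&0\\\Delta^s_{\rm oe}&\sigma^s_{\rm oe}&c^s&\kappa C_{\rm e}+\lambda_{\rm ee}-b&\sigma^s_{\rm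 ee}&\Delta^s_{\rm ee}\\0&0&\sigma^s_{\rm eo}&\sigma^s_{\rm ee}&1-b&0\\0&0&0&\Delta^s_{\rm ee}&0&1-b\end{pmatrix},$$ and put $M'^{(0)}_{\rm 6d}=N^{+1}(\kappa;0,\gamma)$ and $M'^{(1)}_{\rm 6d}=N^{-1}(\kappa;\gamma,0)$. Let $B^{\rm het}(\kappa,\gamma)=\max\{\sigma_{\sup}(M'^{(0)}_{\rm 6d}),\sigma_{\sup}(M'^{(1)}_{\rm 6d})\}$, where $\sigma_{\sup}$ is the supremum of the spectrum, i.e. the largest eigenvalue. **Claim.** All the operator integrals above define bounded operators; $C_{\rm o}=e^{-\beta^2}\sinh\beta^2$ and $C_{\rm e}=e^{-\beta^2}\cosh\beta^2$; the parameters $\lambda_{\rm oo},\lambda_{\rm ee},\lambda^s_{\rm oe},\sigma^s_{\rm oe},\sigma^s_{\rm ee}$ are real; $B^{\rm het}$ is a convex function of $(\kappa,\gamma)\in\mathbb R^2$; and for all $\kappa,\gamma\ge0$ $$M^{\rm het}[\kappa,\gamma]\le B^{\rm het}(\kappa,\gamma)\,I_{AC}.$$ -/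

import Mathlib

open MeasureTheory ProbabilityTheory Complex
open scoped InnerProductSpace Kronecker

noncomputable section

namespace HetQKD

/-! ### Weak operator integrals -/

section Weak

variable {α H : Type*} [MeasurableSpace α] [NormedAddCommGroup H] [InnerProductSpace ℂ H]

/-- The bounded operator `M` is the weak integral of the family of forms `s a`, read as
`s a φ ψ = ⟨φ| k(a) |ψ⟩`: every matrix element is absolutely integrable and
`⟨φ| M |ψ⟩ = ∫ ⟨φ| k(a) |ψ⟩ dm(a)`. -/
def HasWeakIntegral (m : Measure α) (s : α → H → H → ℂ) (M : H →L[ℂ] H) : Prop :=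
  ∀ φ ψ : H, Integrable (fun a => s a φ ψ) m ∧ ⟪φ, M ψ⟫_ℂ = ∫ a, s a φ ψ ∂m

/-- The weak integral exists as a bounded operator. -/
def WeaklyIntegrable (m : Measure α) (s : α → H → H → ℂ) : Prop :=
  ∃ M : H →L[ℂ] H, HasWeakIntegral m s M

open Classical in
/-- The weak integral (unique when it exists; `0` otherwise). -/
def weakIntegral (m : Measure α) (s : α → H → H → ℂ) : H →L[ℂ] H :=
  if h : WeaklyIntegrable m s then h.choose else 0

end Weak

/-- Supremum of the (real) spectrum. -/
def sigmaSup {A : Type*} [Ring A] [Algebra ℝ A] (a : A) : ℝ := sSup (spectrum ℝ a)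

/-! ### The optical mode `C` in the position representation -/

/-- The Hilbert space of the optical pulse `C`: a vector is its wave function `x ↦ ⟨x|ψ⟩`. -/
abbrev Mode := Lp ℂ 2 (volume : Measure ℝ)

/-- Wave function `⟨x|n⟩` of the `n`-photon state, for the quadrature normalised to vacuum
variance `1/4`. (`Polynomial.hermite` is the probabilists' Hermite polynomial.) -/
def numberWave (n : ℕ) (x : ℝ) : ℂ :=
  (((2 / Real.pi) ^ (1 / 4 : ℝ) / Real.sqrt (n.factorial : ℝ)
    * (Polynomial.aeval (2 * x) (Polynomial.hermite n)) * Real.exp (-x ^ 2) : ℝ) : ℂ)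

/-- Wave function `⟨x|ω⟩` of the coherent state with amplitude `ω`. -/
def coherentWave (ω : ℂ) (x : ℝ) : ℂ :=
  (((2 / Real.pi) ^ (1 / 4 : ℝ) : ℝ) : ℂ)
    * exp (-((x : ℂ) - ω.re) ^ 2 + 2 * I * ω.im * x - I * ω.re * ω.im)

theorem memLp_pow_mul_gauss (k : ℕ) :
    MemLp (fun x : ℝ => x ^ k * Real.exp (-x ^ 2)) 2 (volume : Measure ℝ) := by
  rw [memLp_two_iff_integrable_sq (by fun_prop)]
  have h := integrable_rpow_mul_exp_neg_mul_sq (b := 2) (by norm_num) (s := ((2 * k : ℕ) : ℝ))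
    (lt_of_lt_of_le (by norm_num) (Nat.cast_nonneg _))
  refine h.congr (Filter.Eventually.of_forall fun x => ?_)
  simp only [Real.rpow_natCast]
  rw [mul_pow, ← pow_mul, ← Real.exp_nat_mul, mul_comm k 2]
  congr 2
  push_cast
  ring

theorem memLp_poly_mul_gauss (p : Polynomial ℝ) :
    MemLp (fun x : ℝ => p.eval x * Real.exp (-x ^ 2)) 2 (volume : Measure ℝ) := by
  induction p using Polynomial.induction_on' with
  | add p q hp hq =>
    refine (hp.add hq).congr_norm (by fun_prop) (Filter.Eventually.of_forall fun x => ?_)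
    simp [add_mul]
  | monomial k c =>
    refine ((memLp_pow_mul_gauss k).const_mul c).congr_norm (by fun_prop)
      (Filter.Eventually.of_forall fun x => ?_)
    simp [mul_assoc]

theorem memLp_numberWave (n : ℕ) : MemLp (numberWave n) 2 (volume : Measure ℝ) := by
  have h := ((memLp_poly_mul_gauss
    (((Polynomial.hermite n).map (Int.castRingHom ℝ)).comp (Polynomial.C 2 * Polynomial.X))).const_mul
      ((2 / Real.pi) ^ (1 / 4 : ℝ) / Real.sqrt (n.factorial : ℝ))).ofReal (K := ℂ)
  refine h.congr_norm ?_ (Filter.Eventually.of_forall fun x => ?_)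
  · unfold numberWave
    fun_prop
  · simp [numberWave, Polynomial.aeval_def, Polynomial.eval_map, mul_assoc]

theorem memLp_coherentWave (ω : ℂ) : MemLp (coherentWave ω) 2 (volume : Measure ℝ) := by
  have h0 := memLp_pow_mul_gauss 0
  have h1 := (h0.comp_measurePreserving (measurePreserving_sub_right volume ω.re)).const_mul
    ((2 / Real.pi) ^ (1 / 4 : ℝ))
  refine h1.congr_norm ?_ (Filter.Eventually.of_forall fun x => ?_)
  · unfold coherentWave
    fun_prop
  · have hre : (-((x : ℂ) - ω.re) ^ 2 + 2 * I * ω.im * x - I * ω.re * ω.im).re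
        = -(x - ω.re) ^ 2 := by
      simp [pow_two]
    rw [coherentWave, norm_mul, norm_mul, norm_exp, hre, norm_real]
    simp

/-- The number state `|n⟩`. -/
def numberState (n : ℕ) : Mode := (memLp_numberWave n).toLp (numberWave n)

/-- The coherent state `|ω⟩`. -/
def coherent (ω : ℂ) : Mode := (memLp_coherentWave ω).toLp (coherentWave ω)

/-- Projection onto the subspace of even photon numbers. -/
def evProj : Mode →L[ℂ] Mode :=
  (Submodule.span ℂ (Set.range fun k : ℕ => numberState (2 * k))).topologicalClosure.starProjection

/-- Projection onto the subspace of odd photon numbers. -/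
def odProj : Mode →L[ℂ] Mode :=
  (Submodule.span ℂ
    (Set.range fun k : ℕ => numberState (2 * k + 1))).topologicalClosure.starProjection

/-! ### Qubits and composite systems -/

abbrev Qubit := EuclideanSpace ℂ (Fin 2)

/-- `ℂ² ⊗ H`, the first factor being Alice's qubit `A`: the vector `|0⟩⊗ψ₀ + |1⟩⊗ψ₁` is the
pair `(ψ₀, ψ₁)` with the Hilbert-sum norm. -/
abbrev WithA (H : Type*) [NormedAddCommGroup H] [InnerProductSpace ℂ H] :=
  PiLp 2 (fun _ : Fin 2 => H)

section Tensor

variable {H K : Type*} [NormedAddCommGroup H] [InnerProductSpace ℂ H]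
  [NormedAddCommGroup K] [InnerProductSpace ℂ K]

/-- The operator `a ⊗ T : ℂ² ⊗ H → ℂ² ⊗ K`. -/
def tens (a : Matrix (Fin 2) (Fin 2) ℂ) (T : H →L[ℂ] K) : WithA H →L[ℂ] WithA K :=
  ((PiLp.continuousLinearEquiv 2 ℂ (fun _ : Fin 2 => K)).symm :
      (Fin 2 → K) →L[ℂ] WithA K) ∘L
    ContinuousLinearMap.pi fun i => ∑ j, a i j • (T ∘L PiLp.proj 2 (fun _ : Fin 2 => H) j)

theorem tens_apply (a : Matrix (Fin 2) (Fin 2) ℂ) (T : H →L[ℂ] K) (Ψ : WithA H) (i : Fin 2) :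
    tens a T Ψ i = ∑ j, a i j • T (Ψ j) := by
  simp [tens]

end Tensor

/-- Components of `|0⟩`, `|1⟩`, `|+⟩`, `|-⟩`. -/
def ket0 : Fin 2 → ℂ := ![1, 0]
def ket1 : Fin 2 → ℂ := ![0, 1]
def ketP : Fin 2 → ℂ := ![1 / (Real.sqrt 2 : ℂ), 1 / (Real.sqrt 2 : ℂ)]
def ketM : Fin 2 → ℂ := ![1 / (Real.sqrt 2 : ℂ), -(1 / (Real.sqrt 2 : ℂ))]

/-- The matrix `|u⟩⟨u|`. -/
def proj (u : Fin 2 → ℂ) : Matrix (Fin 2) (Fin 2) ℂ := Matrix.vecMulVec u (star u)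

/-- The operator `|u⟩⟨u|` on Bob's qubit `B`. -/
def projB (u : Fin 2 → ℂ) : Qubit →L[ℂ] Qubit :=
  InnerProductSpace.rankOne ℂ (WithLp.toLp 2 u : Qubit) (WithLp.toLp 2 u : Qubit)

def pauliX : Matrix (Fin 2) (Fin 2) ℂ := !![0, 1; 1, 0]

/-- The rotation `exp(-iθZ/2)`. -/
def rotZ (θ : ℝ) : Matrix (Fin 2) (Fin 2) ℂ :=
  Matrix.diagonal ![exp (-I * θ / 2), exp (I * θ / 2)]

/-- Controlled-NOT with control `B` and target `A`. -/
def cX : WithA Qubit →L[ℂ] WithA Qubit := tens 1 (projB ket0) + tens pauliX (projB ket1)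

/-! ### The twisting unitary -/

def qErr (μ β : ℝ) : ℝ := (1 - Real.exp (-2 * (μ - β ^ 2))) / 2

/-- `√g_{β,1/2}(w) |0⟩ ± √g_{-β,1/2}(w) |1⟩` with sign `s = ±1`, where `g_{m,V}` is the normal
density with mean `m` and variance `V`. -/
def gaussKet (β s w : ℝ) : Fin 2 → ℂ :=
  ![(Real.sqrt (gaussianPDFReal β (1 / 2) w) : ℂ),
    (s * Real.sqrt (gaussianPDFReal (-β) (1 / 2) w) : ℂ)]

/-- The operator `τ_{AB}(w)`; indices are pairs (index of `A`, index of `B`). -/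
def tauAB (μ β w : ℝ) : Matrix (Fin 2 × Fin 2) (Fin 2 × Fin 2) ℂ :=
  ((1 - qErr μ β : ℝ) : ℂ) • (proj (gaussKet β 1 w) ⊗ₖ proj ketP)
    + (qErr μ β : ℂ) • (proj (gaussKet β (-1) w) ⊗ₖ proj ketM)

/-- `⟨0|_B τ_{AB}(w) |1⟩_B`. -/
def tau01 (μ β w : ℝ) : Matrix (Fin 2) (Fin 2) ℂ :=
  Matrix.of fun i j => tauAB μ β w (i, 0) (j, 1)

/-- `v` is a unit eigenvector of `T` with positive eigenvalue. -/
def IsPosEigenvector (T : Matrix (Fin 2) (Fin 2) ℂ) (v : Fin 2 → ℂ) : Prop :=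
  star v ⬝ᵥ v = 1 ∧ ∃ l : ℝ, 0 < l ∧ T.mulVec v = (l : ℂ) • v

/-- `v` is a unit eigenvector of `T` with negative eigenvalue. -/
def IsNegEigenvector (T : Matrix (Fin 2) (Fin 2) ℂ) (v : Fin 2 → ℂ) : Prop :=
  star v ⬝ᵥ v = 1 ∧ ∃ l : ℝ, l < 0 ∧ T.mulVec v = (l : ℂ) • v

/-- `W_A(w) = |u₊(w)⟩⟨u₊(w)| - |u₋(w)⟩⟨u₋(w)|`. -/
def twistW (up um : ℝ → Fin 2 → ℂ) (w : ℝ) : Matrix (Fin 2) (Fin 2) ℂ :=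
  proj (up w) - proj (um w)

/-- The controlled isometry
`[|0⟩⟨0|_B ⊗ R† + |1⟩⟨1|_B ⊗ W_A(ω_r) R†] C-X_{BA}` with `R = R^Z(2 ω_i β)`. -/
def ctrlV (β : ℝ) (up um : ℝ → Fin 2 → ℂ) (ω : ℂ) : WithA Qubit →L[ℂ] WithA Qubit :=
  (tens (rotZ (2 * ω.im * β)).conjTranspose (projB ket0)
    + tens (twistW up um ω.re * (rotZ (2 * ω.im * β)).conjTranspose) (projB ket1)) ∘L cX

/-! ### The phase-error operator -/

/-- `K_suc(ω) = √(f(ω_r)/π) (|0⟩_B⟨ω|_C + |1⟩_B⟨-ω|_C)`. -/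
def Ksuc (f : ℝ → ℝ) (ω : ℂ) : Mode →L[ℂ] Qubit :=
  (Real.sqrt (f ω.re / Real.pi) : ℂ) •
    (InnerProductSpace.rankOne ℂ (WithLp.toLp 2 ket0 : Qubit) (coherent ω)
      + InnerProductSpace.rankOne ℂ (WithLp.toLp 2 ket1 : Qubit) (coherent (-ω)))

/-- The adjoint of `ρ ↦ Tr_A[V(ω) (I⊗K_suc(ω)) ρ (I⊗K_suc(ω))† V(ω)†]`, applied to
`|-⟩⟨-|_B`. -/
def phaseErrorDensity (β : ℝ) (f : ℝ → ℝ) (up um : ℝ → Fin 2 → ℂ) (ω : ℂ) :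
    WithA Mode →L[ℂ] WithA Mode :=
  ContinuousLinearMap.adjoint (ctrlV β up um ω ∘L tens 1 (Ksuc f ω)) ∘L
    tens 1 (projB ketM) ∘L (ctrlV β up um ω ∘L tens 1 (Ksuc f ω))

/-- Matrix elements of the density, as a function of `(ω_r, ω_i)`. -/
def phForm (β : ℝ) (f : ℝ → ℝ) (up um : ℝ → Fin 2 → ℂ) (p : ℝ × ℝ) (φ ψ : WithA Mode) : ℂ :=
  ⟪φ, phaseErrorDensity β f up um ⟨p.1, p.2⟩ ψ⟫_ℂ

/-- `M_ph^het`. -/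
def Mph (β : ℝ) (f : ℝ → ℝ) (up um : ℝ → Fin 2 → ℂ) : WithA Mode →L[ℂ] WithA Mode :=
  weakIntegral volume (phForm β f up um)

/-- `Π^fid = |0⟩⟨0|⊗|β⟩⟨β| + |1⟩⟨1|⊗|-β⟩⟨-β|`. -/
def fidProj (β : ℝ) : WithA Mode →L[ℂ] WithA Mode :=
  tens (proj ket0) (InnerProductSpace.rankOne ℂ (coherent β) (coherent β))
    + tens (proj ket1) (InnerProductSpace.rankOne ℂ (coherent (-β)) (coherent (-β)))

/-- `Π^trash_- = |-⟩⟨-|⊗I`. -/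
def trashProj : WithA Mode →L[ℂ] WithA Mode := tens (proj ketM) (ContinuousLinearMap.id ℂ Mode)

/-- `M^het[κ,γ] = M_ph^het + κ Π^fid - γ Π^trash_-`. -/
def Mhet (β : ℝ) (f : ℝ → ℝ) (up um : ℝ → Fin 2 → ℂ) (κ γ : ℝ) :
    WithA Mode →L[ℂ] WithA Mode :=
  Mph β f up um + (κ : ℂ) • fidProj β - (γ : ℂ) • trashProj

/-! ### The operators on `C` entering the bound -/

/-- The angle in `(-π/2, π/2)` with `tan θ = e^{-2(μ-β²)} sinh(2βw)`. -/
def theta (μ β w : ℝ) : ℝ := Real.arctan (Real.exp (-2 * (μ - β ^ 2)) * Real.sinh (2 * β * w))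

/-- `⟨φ|x⟩⟨x|w⟩⟨w|y⟩⟨y|ψ⟩`, where `|w⟩` is the coherent state with real amplitude `w`. -/
def posTerm (w x y : ℝ) (φ ψ : Mode) : ℂ :=
  star (φ x) * coherentWave w x * star (coherentWave w y) * ψ y

/-- Integrand of `M_oo`, with `p = (ω_r, x)`. -/
def ooForm (μ β : ℝ) (f : ℝ → ℝ) (p : ℝ × ℝ) (φ ψ : Mode) : ℂ :=
  (f p.1 : ℂ) * (posTerm p.1 p.2 p.2 (odProj φ) (odProj ψ)
    + (Real.cos (theta μ β p.1) / 2 : ℂ) *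
      (posTerm p.1 p.2 (p.2 - β) (odProj φ) (odProj ψ)
        + posTerm p.1 (p.2 - β) p.2 (odProj φ) (odProj ψ)))

/-- Integrand of `M_ee`. -/
def eeForm (μ β : ℝ) (f : ℝ → ℝ) (p : ℝ × ℝ) (φ ψ : Mode) : ℂ :=
  (f p.1 : ℂ) * (posTerm p.1 p.2 p.2 (evProj φ) (evProj ψ)
    - (Real.cos (theta μ β p.1) / 2 : ℂ) *
      (posTerm p.1 p.2 (p.2 - β) (evProj φ) (evProj ψ)
        + posTerm p.1 (p.2 - β) p.2 (evProj φ) (evProj ψ)))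

/-- Integrand of `M_{(+,o)(-,e)}` for `s = 1`, and of `M_{(-,o)(+,e)}` for `s = -1`. -/
def oeForm (μ β : ℝ) (f : ℝ → ℝ) (s : ℝ) (p : ℝ × ℝ) (φ ψ : Mode) : ℂ :=
  (f p.1 : ℂ) * ((s * Real.sin (theta μ β p.1) : ℂ) *
      posTerm p.1 p.2 p.2 (odProj φ) (evProj ψ)
    - (Real.cos (theta μ β p.1) / 2 : ℂ) *
      (posTerm p.1 p.2 (p.2 - β) (odProj φ) (evProj ψ)
        - posTerm p.1 (p.2 - β) p.2 (odProj φ) (evProj ψ)))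

def Moo (μ β : ℝ) (f : ℝ → ℝ) : Mode →L[ℂ] Mode := weakIntegral volume (ooForm μ β f)

def Mee (μ β : ℝ) (f : ℝ → ℝ) : Mode →L[ℂ] Mode := weakIntegral volume (eeForm μ β f)

/-- `M_{(+,o)(-,e)}` for `s = 1`, `M_{(-,o)(+,e)}` for `s = -1`. -/
def Moe (μ β : ℝ) (f : ℝ → ℝ) (s : ℝ) : Mode →L[ℂ] Mode := weakIntegral volume (oeForm μ β f s)

/-- `M_{(-,e)(+,o)}` for `s = 1`, `M_{(+,e)(-,o)}` for `s = -1`. -/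
def Meo (μ β : ℝ) (f : ℝ → ℝ) (s : ℝ) : Mode →L[ℂ] Mode :=
  ContinuousLinearMap.adjoint (Moe μ β f s)

/-! ### Scalar parameters. In all of them `s = 1` selects the `(+,o),(-,e)` sector and
`s = -1` the `(-,o),(+,e)` sector. -/

/-- `⟨β|T|β⟩`. -/
def expect (β : ℝ) (T : Mode →L[ℂ] Mode) : ℂ := ⟪coherent β, T (coherent β)⟫_ℂ

def Co (β : ℝ) : ℝ := (expect β odProj).re
def Ce (β : ℝ) : ℝ := (expect β evProj).re

/-- `(C_o C_e)^{-1/2}`. -/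
def cInv (β : ℝ) : ℝ := (Real.sqrt (Co β * Ce β))⁻¹

def lamOO (μ β : ℝ) (f : ℝ → ℝ) : ℂ := ((Co β)⁻¹ : ℝ) * expect β (Moo μ β f)
def lamEE (μ β : ℝ) (f : ℝ → ℝ) : ℂ := ((Ce β)⁻¹ : ℝ) * expect β (Mee μ β f)

/-- `λ_{(+,o)(-,e)}`, `λ_{(-,o)(+,e)}`. -/
def lamOE (μ β : ℝ) (f : ℝ → ℝ) (s : ℝ) : ℂ := (cInv β : ℂ) * expect β (Moe μ β f s)

def sigOO (μ β : ℝ) (f : ℝ → ℝ) : ℝ :=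
  Real.sqrt ((Co β)⁻¹ * ‖Moo μ β f (coherent β)‖ ^ 2 - ‖lamOO μ β f‖ ^ 2)

/-- `σ_{(-,e)(+,o)}`, `σ_{(+,e)(-,o)}`. -/
def sigEO (μ β : ℝ) (f : ℝ → ℝ) (s : ℝ) : ℝ :=
  Real.sqrt ((Co β)⁻¹ * ‖Meo μ β f s (coherent β)‖ ^ 2 - ‖lamOE μ β f s‖ ^ 2)

/-- `σ_{(+,o)(-,e)}`, `σ_{(-,o)(+,e)}`. If `σ_oo = 0`, this is `0`. -/
def sigOE (μ β : ℝ) (f : ℝ → ℝ) (s : ℝ) : ℂ :=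
  ((sigOO μ β f)⁻¹ : ℝ) * ((cInv β : ℂ) * expect β (Moo μ β f ∘L Moe μ β f s)
    - lamOO μ β f * lamOE μ β f s)

/-- `σ_{(-,e)(-,e)}`, `σ_{(+,e)(+,e)}`. If `σ_{(∓,e)(±,o)} = 0`, this is `0`. -/
def sigEE (μ β : ℝ) (f : ℝ → ℝ) (s : ℝ) : ℂ :=
  ((sigEO μ β f s)⁻¹ : ℝ) * ((cInv β : ℂ) * expect β (Moe μ β f s ∘L Mee μ β f)
    - lamOE μ β f s * lamEE μ β f)

/-- `Δ_{(+,o)(-,e)}`, `Δ_{(-,o)(+,e)}`. -/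
def delOE (μ β : ℝ) (f : ℝ → ℝ) (s : ℝ) : ℝ :=
  Real.sqrt ((Ce β)⁻¹ * ‖Moe μ β f s (coherent β)‖ ^ 2 - ‖lamOE μ β f s‖ ^ 2
    - ‖sigOE μ β f s‖ ^ 2)

/-- `Δ_{(-,e)(-,e)}`, `Δ_{(+,e)(+,e)}`. -/
def delEE (μ β : ℝ) (f : ℝ → ℝ) (s : ℝ) : ℝ :=
  Real.sqrt ((Ce β)⁻¹ * ‖Mee μ β f (coherent β)‖ ^ 2 - ‖lamEE μ β f‖ ^ 2
    - ‖sigEE μ β f s‖ ^ 2)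

/-- The common shape of the two matrices; `go`, `ge` are the multiples of `γ` subtracted on the
odd and on the even part of the sector. -/
def sixMatrix (μ β : ℝ) (f : ℝ → ℝ) (s κ go ge : ℝ) : Matrix (Fin 6) (Fin 6) ℂ :=
  let d : ℂ := delOE μ β f s
  let e : ℂ := delEE μ β f s
  let soo : ℂ := sigOO μ β f
  let seo : ℂ := sigEO μ β f s
  let soe : ℂ := sigOE μ β f s
  let see : ℂ := sigEE μ β f s
  let c : ℂ := κ * Real.sqrt (Co β * Ce β) + lamOE μ β f s
  !![1 - go, 0, 0, d, 0, 0;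
     0, 1 - go, soo, soe, 0, 0;
     0, soo, κ * Co β + lamOO μ β f - go, c, seo, 0;
     d, soe, c, κ * Ce β + lamEE μ β f - ge, see, e;
     0, 0, seo, see, 1 - ge, 0;
     0, 0, 0, e, 0, 1 - ge]

/-- `M'^{(0)}_{6d}`. -/
def M6d0 (μ β : ℝ) (f : ℝ → ℝ) (κ γ : ℝ) : Matrix (Fin 6) (Fin 6) ℂ :=
  sixMatrix μ β f 1 κ 0 γ

/-- `M'^{(1)}_{6d}`. -/
def M6d1 (μ β : ℝ) (f : ℝ → ℝ) (κ γ : ℝ) : Matrix (Fin 6) (Fin 6) ℂ :=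
  sixMatrix μ β f (-1) κ γ 0

/-- `B^het(κ,γ)`. -/
def Bhet (μ β : ℝ) (f : ℝ → ℝ) (κ γ : ℝ) : ℝ :=
  max (sigmaSup (M6d0 μ β f κ γ)) (sigmaSup (M6d1 μ β f κ γ))

end HetQKD

end

/-! Write ω = w + it. The overlap ⟨ω|ψ⟩ is, up to a phase, the Fourier transform of x ↦ ⟨x|w⟩ψ(x) at
t/π. Plancherel in t therefore turns the coherent-state form π⁻¹∬ k(w) e^{2i(a-b)t} ⟨φ|ω⟩⟨ω|ψ⟩ into
the position kernel with arguments x-a and x-b (`integral_cohForm_eq`). The same computation yields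
the resolution of the identity (`integral_norm_sq_inner_coherent`), which supplies all bounds, and
the completeness of the number states, so that the even and odd projections are (1 ± P)/2 with P the
parity.

The traceless part of T(w) is proportional to e^{-2(μ-β²)} sinh(2βw) Z + X, hence W(w) = sin θ Z +
cos θ X (`twistW_eq`). With this W, the density at every ω is block diagonal for the two eigenspaces
of X_A ⊗ P, namely (+,o)⊕(-,e) and (-,o)⊕(+,e), and its blocks are the coherent-state integrands of
M_oo, M_ee and M_oe (`phForm_eq_sectorForm`).

Within a sector the density is f(w)/π times a Hermitian form in the two numbers ⟨ω|φ⟩ (φ odd) and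
⟨ω|ψ⟩ (ψ even), with trace 2 and determinant 0, so with eigenvalues 0 and 2. The form is invariant
under ω ↦ -ω, so f(w) may be replaced by (f(w)+f(-w))/2 ≤ 1/2, and each sector is bounded by the
identity (`sectorQuad_le`).

The γ term is a scalar on the odd and on the even part of a sector; the κ term sees only the
normalised odd and even parts u, v of |β⟩. After splitting off u and v, the cross terms involve two
residual vectors on each side. Gram-Schmidt on these gives four further coordinates, and off u and v
the unperturbed form is at most the identity, so the largest eigenvalue of a 6 × 6 matrix bounds
everything (`block_quad_le_sigmaSup`). Its entries are the stated parameters, real because all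
blocks commute with complex conjugation of wave functions. The matrix is affine in (κ, γ) and its
largest eigenvalue is a maximum of Rayleigh quotients, hence convex. -/

open MeasureTheory ProbabilityTheory Complex
open scoped InnerProductSpace Kronecker

noncomputable section

namespace HetQKD

/-! ### Plancherel's theorem on `L¹ ∩ L²` -/

section Plancherel

open FourierTransform SchwartzMap
open scoped ContDiff

/-- Both sides have the same integral against every smooth compactly supported function: the L²
transform is compatible with the distributional one, and for integrable `h` the transform can be
moved from the test function to `h`. -/
theorem fourier_toLp_ae_eq {h : ℝ → ℂ} (h1 : Integrable h) (h2 : MemLp h 2) :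
    (𝓕 (h2.toLp h) : Lp ℂ 2 (volume : Measure ℝ)) =ᵐ[volume] 𝓕 h := by
  have hcont : Continuous (𝓕 h) := VectorFourier.fourierIntegral_continuous
    Real.continuous_fourierChar (by fun_prop) h1
  refine ae_eq_of_integral_contDiff_smul_eq
    ((Lp.memLp _).locallyIntegrable (by norm_num)) hcont.locallyIntegrable fun g hg hgs => ?_
  have hg1 : HasCompactSupport (Complex.ofRealCLM ∘ g) := hgs.comp_left rfl
  have hg2 : ContDiff ℝ ∞ (Complex.ofRealCLM ∘ g) := by fun_prop
  set η : 𝓢(ℝ, ℂ) := hg1.toSchwartzMap hg2 with hη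
  have e1 := congrArg (fun T => T η) (Lp.fourier_toTemperedDistribution_eq (h2.toLp h))
  simp only [TemperedDistribution.fourier_apply, Lp.toTemperedDistribution_apply] at e1
  have e2 : ∫ x, g x • (𝓕 (h2.toLp h) : Lp ℂ 2 (volume : Measure ℝ)) x
      = ∫ x, η x • (𝓕 (h2.toLp h) : Lp ℂ 2 (volume : Measure ℝ)) x := by
    congr 1
  have e3 : ∫ x, (𝓕 η) x • (h2.toLp h) x = ∫ x, (𝓕 η) x • h x := by
    refine integral_congr_ae ?_
    filter_upwards [h2.coeFn_toLp] with x hx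
    rw [hx]
  have e4 : ∫ x, (𝓕 η) x • h x = ∫ x, η x • 𝓕 h x := by
    have := VectorFourier.integral_fourierIntegral_smul_eq_flip (L := innerₗ ℝ) (μ := volume)
      (ν := volume) (f := (η : ℝ → ℂ)) (g := h) Real.continuous_fourierChar continuous_inner
      η.integrable h1
    rwa [flip_innerₗ] at this
  rw [e2, ← e1, e3, e4]
  congr 1

theorem memLp_fourier {h : ℝ → ℂ} (h1 : Integrable h) (h2 : MemLp h 2) : MemLp (𝓕 h) 2 :=
  (Lp.memLp _).ae_eq (fourier_toLp_ae_eq h1 h2)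

theorem integral_star_fourier_mul_fourier {h k : ℝ → ℂ} (h1 : Integrable h) (h2 : MemLp h 2)
    (k1 : Integrable k) (k2 : MemLp k 2) :
    ∫ t, star (𝓕 h t) * 𝓕 k t = ∫ x, star (h x) * k x := by
  have e := Lp.inner_fourier_eq (h2.toLp h) (k2.toLp k)
  rw [L2.inner_def, L2.inner_def] at e
  calc _ = ∫ t, ⟪(𝓕 (h2.toLp h) : Lp ℂ 2 (volume : Measure ℝ)) t,
        (𝓕 (k2.toLp k) : Lp ℂ 2 (volume : Measure ℝ)) t⟫_ℂ := by
        refine integral_congr_ae ?_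
        filter_upwards [fourier_toLp_ae_eq h1 h2, fourier_toLp_ae_eq k1 k2] with x hx hy
        rw [hx, hy, RCLike.inner_apply, mul_comm]; rfl
    _ = _ := e
    _ = _ := by
        refine integral_congr_ae ?_
        filter_upwards [h2.coeFn_toLp, k2.coeFn_toLp] with x hx hy
        rw [hx, hy, RCLike.inner_apply, mul_comm]; rfl

end Plancherel

/-! ### Overlaps with coherent states -/

/-- The wave function of the coherent state with real amplitude `w`. -/
def realWave (w x : ℝ) : ℝ := (2 / Real.pi) ^ (1 / 4 : ℝ) * Real.exp (-(x - w) ^ 2)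

theorem coherentWave_ofReal (w x : ℝ) : coherentWave w x = (realWave w x : ℂ) := by
  simp [coherentWave, realWave]

theorem coherentWave_mk (w t x : ℝ) :
    coherentWave ⟨w, t⟩ x = realWave w x * exp (2 * I * t * x - I * w * t) := by
  simp only [coherentWave, realWave]
  rw [Complex.ofReal_mul, Complex.ofReal_exp, mul_assoc (((_ : ℝ) : ℂ)) (exp _) (exp _),
    ← Complex.exp_add]
  congr 2
  push_cast
  ring

@[fun_prop]
theorem measurable_realWave : Measurable (fun p : ℝ × ℝ => realWave p.1 p.2) := by
  unfold realWave; fun_prop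

@[fun_prop]
theorem continuous_realWave (w : ℝ) : Continuous (realWave w) := by
  unfold realWave; fun_prop

theorem realWave_nonneg (w x : ℝ) : 0 ≤ realWave w x := by unfold realWave; positivity

/-- The square is the normal density of variance 1/4, symmetric in amplitude and position; this
makes its integral over the amplitude equal to 1. -/
theorem realWave_sq (w x : ℝ) :
    realWave w x ^ 2 = Real.sqrt (2 / Real.pi) * Real.exp (-2 * (x - w) ^ 2) := by
  rw [realWave, mul_pow, ← Real.exp_nat_mul, ← Real.rpow_natCast, ← Real.rpow_mul (by positivity),
    Real.sqrt_eq_rpow]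
  norm_num

theorem integrable_realWave_sq_left (x : ℝ) : Integrable (fun w => realWave w x ^ 2) := by
  simp_rw [realWave_sq]
  exact ((integrable_exp_neg_mul_sq (b := 2) (by norm_num)).comp_sub_left x).const_mul _

theorem integral_realWave_sq_left (x : ℝ) : ∫ w, realWave w x ^ 2 = 1 := by
  simp_rw [realWave_sq]
  rw [integral_const_mul, integral_sub_left_eq_self (fun y => Real.exp (-2 * y ^ 2)) volume x,
    integral_gaussian, ← Real.sqrt_mul (by positivity)]
  rw [show 2 / Real.pi * (Real.pi / 2) = 1 by field_simp]
  simp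

theorem realWave_le (w x : ℝ) : realWave w x ≤ (2 / Real.pi) ^ (1 / 4 : ℝ) := by
  unfold realWave
  refine mul_le_of_le_one_right (by positivity) ?_
  rw [Real.exp_le_one_iff]
  nlinarith [sq_nonneg (x - w)]

theorem memLp_realWave (w : ℝ) : MemLp (fun x => (realWave w x : ℂ)) 2 := by
  have := memLp_coherentWave (w : ℂ)
  simpa only [funext (coherentWave_ofReal w)] using this

theorem memLp_realWave_mul (w : ℝ) (ψ : Mode) : MemLp (fun x => (realWave w x : ℂ) * ψ x) 2 := by
  refine ((Lp.memLp ψ).const_mul (((2 / Real.pi) ^ (1 / 4 : ℝ) : ℝ) : ℂ)).mono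
    (by
      have := (continuous_realWave w).measurable
      exact (Complex.measurable_ofReal.comp this).aestronglyMeasurable.mul
        (Lp.aestronglyMeasurable ψ))
    (Filter.Eventually.of_forall fun x => ?_)
  rw [norm_mul, norm_mul, norm_real, norm_real, Real.norm_of_nonneg (realWave_nonneg w x),
    Real.norm_of_nonneg (by positivity)]
  exact mul_le_mul_of_nonneg_right (realWave_le w x) (norm_nonneg _)

theorem integrable_realWave_mul (w : ℝ) (ψ : Mode) :
    Integrable (fun x => (realWave w x : ℂ) * ψ x) :=
  (memLp_realWave w).integrable_mul (Lp.memLp ψ)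

theorem inner_coherent (ω : ℂ) (ψ : Mode) :
    ⟪coherent ω, ψ⟫_ℂ = ∫ x, star (coherentWave ω x) * ψ x := by
  rw [L2.inner_def]
  refine integral_congr_ae ?_
  filter_upwards [(memLp_coherentWave ω).coeFn_toLp] with x hx
  rw [coherent, hx, RCLike.inner_apply, mul_comm]
  rfl

open FourierTransform in
/-- Up to a phase, the overlap with a coherent state is a value of a Fourier transform. -/
theorem exp_mul_inner_coherent (w t c : ℝ) (ψ : Mode) :
    exp (-(2 * I * c * t)) * ⟪coherent ⟨w, t⟩, ψ⟫_ℂ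
      = exp (I * w * t) * 𝓕 (fun x => (realWave w (x - c) : ℂ) * ψ (x - c)) (t / Real.pi) := by
  rw [inner_coherent, Real.fourier_real_eq_integral_exp_smul]
  -- Translating the integration variable by c is what absorbs the phase e^{-2ict}.
  rw [← integral_sub_right_eq_self (fun x => star (coherentWave ⟨w, t⟩ x) * ψ x) c,
    ← integral_const_mul, ← integral_const_mul]
  congr 1 with x
  rw [coherentWave_mk, star_mul', smul_eq_mul]
  simp only [RCLike.star_def, Complex.conj_ofReal, ← Complex.exp_conj]
  have hpi : (Real.pi : ℂ) ≠ 0 := by exact_mod_cast Real.pi_ne_zero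
  have e : exp (-(2 * I * c * t)) * exp ((starRingEnd ℂ) (2 * I * t * ((x - c : ℝ) : ℂ) - I * w * t))
      = exp (I * w * t) * exp (((-2 * Real.pi * x * (t / Real.pi) : ℝ) : ℂ) * I) := by
    rw [← Complex.exp_add, ← Complex.exp_add]
    congr 1
    simp only [map_sub, map_mul, Complex.conj_I, Complex.conj_ofReal, map_ofNat]
    push_cast
    field_simp
    ring
  linear_combination (realWave w (x - c) * ψ (x - c)) * e

open FourierTransform in
theorem integrable_norm_sq_inner_coherent_slice (w : ℝ) (ψ : Mode) :
    Integrable (fun t : ℝ => ‖⟪coherent ⟨w, t⟩, ψ⟫_ℂ‖ ^ 2) := by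
  have h := memLp_fourier (integrable_realWave_mul w ψ) (memLp_realWave_mul w ψ)
  have h2 := ((memLp_two_iff_integrable_sq_norm h.1).1 h).comp_div (R := Real.pi) Real.pi_ne_zero
  refine h2.congr (Filter.Eventually.of_forall fun t => ?_)
  have e := congrArg norm (exp_mul_inner_coherent w t 0 ψ)
  have e1 : I * w * t = ((w * t : ℝ) : ℂ) * I := by push_cast; ring
  rw [norm_mul, norm_mul, e1, norm_exp_ofReal_mul_I] at e
  simp only [sub_zero, ofReal_zero, mul_zero, zero_mul, neg_zero, Complex.exp_zero, norm_one,
    one_mul] at e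
  simp only [e]

-- Parseval for the translates by a and b of the two Gaussian-weighted wave functions; the phases
-- e^{iwt} cancel between them, and the factor π comes from the frequency t/π.
open FourierTransform in
theorem integral_inner_coherent_slice (w a b : ℝ) (φ ψ : Mode) :
    ∫ t : ℝ, exp (2 * I * (a - b) * t) * ⟪φ, coherent ⟨w, t⟩⟫_ℂ * ⟪coherent ⟨w, t⟩, ψ⟫_ℂ
      = Real.pi * ∫ x, posTerm w (x - a) (x - b) φ ψ := by
  set F := fun x => (realWave w (x - a) : ℂ) * φ (x - a) with hF
  set G := fun x => (realWave w (x - b) : ℂ) * ψ (x - b) with hG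
  have key : ∀ t : ℝ, exp (2 * I * (a - b) * t) * ⟪φ, coherent ⟨w, t⟩⟫_ℂ * ⟪coherent ⟨w, t⟩, ψ⟫_ℂ
      = star (𝓕 F (t / Real.pi)) * 𝓕 G (t / Real.pi) := by
    intro t
    have ha := congrArg star (exp_mul_inner_coherent w t a φ)
    have hb := exp_mul_inner_coherent w t b ψ
    have hab := congrArg₂ (· * ·) ha hb
    simp only [star_mul', RCLike.star_def, inner_conj_symm] at hab
    have e1 : (starRingEnd ℂ) (exp (-(2 * I * a * t))) * exp (-(2 * I * b * t))
        = exp (2 * I * (a - b) * t) := by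
      rw [← Complex.exp_conj, ← Complex.exp_add]
      congr 1
      simp only [map_neg, map_mul, Complex.conj_I, Complex.conj_ofReal, map_ofNat]
      ring
    have e2 : (starRingEnd ℂ) (exp (I * w * t)) * exp (I * w * t) = 1 := by
      rw [← Complex.exp_conj, ← Complex.exp_add, Complex.exp_eq_one_iff]
      refine ⟨0, ?_⟩
      simp only [map_mul, Complex.conj_I, Complex.conj_ofReal]
      push_cast
      ring
    rw [RCLike.star_def]
    linear_combination hab + ((starRingEnd ℂ) (𝓕 F (t / Real.pi)) * 𝓕 G (t / Real.pi)) * e2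
      - ⟪φ, coherent ⟨w, t⟩⟫_ℂ * ⟪coherent ⟨w, t⟩, ψ⟫_ℂ * e1
  have mpa := measurePreserving_sub_right (volume : Measure ℝ) a
  have mpb := measurePreserving_sub_right (volume : Measure ℝ) b
  simp_rw [key]
  rw [Measure.integral_comp_div (fun t => star (𝓕 F t) * 𝓕 G t),
    integral_star_fourier_mul_fourier ((integrable_realWave_mul w φ).comp_sub_right a)
      ((memLp_realWave_mul w φ).comp_measurePreserving mpa)
      ((integrable_realWave_mul w ψ).comp_sub_right b)
      ((memLp_realWave_mul w ψ).comp_measurePreserving mpb),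
    abs_of_pos Real.pi_pos, Complex.real_smul]
  congr 2 with x
  rw [posTerm, coherentWave_ofReal, coherentWave_ofReal]
  simp only [star_mul', RCLike.star_def, Complex.conj_ofReal]
  ring

/-! ### Integrals over the phase plane and the resolution of the identity -/

theorem measurable_inner_coherent (ψ : Mode) :
    StronglyMeasurable (fun p : ℝ × ℝ => ⟪coherent ⟨p.1, p.2⟩, ψ⟫_ℂ) := by
  simp_rw [inner_coherent]
  refine StronglyMeasurable.integral_prod_right'
    (f := fun q : (ℝ × ℝ) × ℝ => star (coherentWave ⟨q.1.1, q.1.2⟩ q.2) * ψ q.2) ?_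
  have h1 : Measurable fun q : (ℝ × ℝ) × ℝ => coherentWave ⟨q.1.1, q.1.2⟩ q.2 := by
    unfold coherentWave; fun_prop
  exact ((continuous_star.measurable.comp h1).mul ((Lp.stronglyMeasurable ψ).measurable.comp measurable_snd)).stronglyMeasurable

theorem integral_norm_sq (ψ : Mode) : ∫ x, ‖ψ x‖ ^ 2 = ‖ψ‖ ^ 2 := by
  have e : (⟪ψ, ψ⟫_ℂ) = ∫ x, ((‖ψ x‖ ^ 2 : ℝ) : ℂ) := by
    rw [L2.inner_def]
    congr 1 with x
    rw [inner_self_eq_norm_sq_to_K]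
    norm_cast
  rw [integral_complex_ofReal, inner_self_eq_norm_sq_to_K] at e
  exact Complex.ofReal_injective (e.symm.trans (by push_cast; rfl))

theorem integrable_norm_sq (ψ : Mode) : Integrable fun x => ‖ψ x‖ ^ 2 :=
  (memLp_two_iff_integrable_sq_norm (Lp.aestronglyMeasurable ψ)).1 (Lp.memLp ψ)

theorem integrable_realWave_sq_mul (ψ : Mode) :
    Integrable (fun p : ℝ × ℝ => realWave p.1 p.2 ^ 2 * ‖ψ p.2‖ ^ 2) := by
  have hm : Measurable fun p : ℝ × ℝ => ‖ψ p.2‖ :=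
    ((Lp.stronglyMeasurable ψ).measurable.comp measurable_snd).norm
  rw [Measure.volume_eq_prod, integrable_prod_iff' (by fun_prop)]
  refine ⟨Filter.Eventually.of_forall fun x => (integrable_realWave_sq_left x).mul_const (‖ψ x‖ ^ 2), ?_⟩
  refine (integrable_norm_sq ψ).congr (Filter.Eventually.of_forall fun x => ?_)
  have : ∀ w, ‖realWave w x ^ 2 * ‖ψ x‖ ^ 2‖ = realWave w x ^ 2 * ‖ψ x‖ ^ 2 := fun w =>
    Real.norm_of_nonneg (by positivity)
  simp only [this]
  rw [integral_mul_const, integral_realWave_sq_left, one_mul]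

theorem integral_realWave_sq_mul (ψ : Mode) :
    ∫ p : ℝ × ℝ, realWave p.1 p.2 ^ 2 * ‖ψ p.2‖ ^ 2 = ‖ψ‖ ^ 2 := by
  rw [Measure.volume_eq_prod, integral_prod_symm _ (integrable_realWave_sq_mul ψ)]
  simp only [integral_mul_const, integral_realWave_sq_left, one_mul]
  exact integral_norm_sq ψ

theorem integral_norm_sq_inner_coherent_slice (w : ℝ) (ψ : Mode) :
    ∫ t : ℝ, ‖⟪coherent ⟨w, t⟩, ψ⟫_ℂ‖ ^ 2 = Real.pi * ∫ x, realWave w x ^ 2 * ‖ψ x‖ ^ 2 := by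
  have h := integral_inner_coherent_slice w 0 0 ψ ψ
  have e1 : ∀ t : ℝ, exp (2 * I * ((0 : ℝ) - (0 : ℝ)) * t) * ⟪ψ, coherent ⟨w, t⟩⟫_ℂ
      * ⟪coherent ⟨w, t⟩, ψ⟫_ℂ = ((‖⟪coherent ⟨w, t⟩, ψ⟫_ℂ‖ ^ 2 : ℝ) : ℂ) := by
    intro t
    rw [sub_self, mul_zero, zero_mul, Complex.exp_zero, one_mul, ← inner_conj_symm,
      ← Complex.normSq_eq_conj_mul_self, Complex.normSq_eq_norm_sq]
  have e2 : ∀ x : ℝ, posTerm w (x - 0) (x - 0) ψ ψ = ((realWave w x ^ 2 * ‖ψ x‖ ^ 2 : ℝ) : ℂ) := by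
    intro x
    rw [posTerm, sub_zero, coherentWave_ofReal, RCLike.star_def,
      Complex.conj_ofReal, ofReal_mul, ← Complex.normSq_eq_norm_sq,
      Complex.normSq_eq_conj_mul_self]
    push_cast
    ring
  simp_rw [e1, e2, integral_complex_ofReal] at h
  exact_mod_cast h

theorem integrable_norm_sq_inner_coherent (ψ : Mode) :
    Integrable (fun p : ℝ × ℝ => ‖⟪coherent ⟨p.1, p.2⟩, ψ⟫_ℂ‖ ^ 2) := by
  have hm := (measurable_inner_coherent ψ).norm.aestronglyMeasurable (μ := volume.prod volume)
  rw [Measure.volume_eq_prod]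
  refine (integrable_prod_iff (hm.pow 2)).2 ⟨Filter.Eventually.of_forall fun w => integrable_norm_sq_inner_coherent_slice w ψ, ?_⟩
  simp only [Pi.pow_apply, norm_pow, norm_norm, integral_norm_sq_inner_coherent_slice]
  have h := integrable_realWave_sq_mul ψ
  rw [Measure.volume_eq_prod] at h
  exact h.integral_prod_left.const_mul _

/-- Resolution of the identity by coherent states. -/
theorem integral_norm_sq_inner_coherent (ψ : Mode) :
    ∫ p : ℝ × ℝ, ‖⟪coherent ⟨p.1, p.2⟩, ψ⟫_ℂ‖ ^ 2 = Real.pi * ‖ψ‖ ^ 2 := by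
  rw [Measure.volume_eq_prod, integral_prod _ (integrable_norm_sq_inner_coherent ψ)]
  simp only [integral_norm_sq_inner_coherent_slice]
  rw [integral_const_mul, ← integral_realWave_sq_mul ψ, Measure.volume_eq_prod,
    integral_prod _ (integrable_realWave_sq_mul ψ)]

/-! ### Basic forms and the operators they define -/

/-- `k(w) ⟨φ|x-a⟩⟨x-a|w⟩⟨w|x-b⟩⟨x-b|ψ⟩` at `p = (w, x)`. -/
def posForm (k : ℝ → ℝ) (a b : ℝ) (p : ℝ × ℝ) (φ ψ : Mode) : ℂ :=
  (k p.1 : ℂ) * posTerm p.1 (p.2 - a) (p.2 - b) φ ψ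

/-- `π⁻¹ k(w) e^{2i(a-b)t} ⟨φ|ω⟩⟨ω|ψ⟩` at `p = (w, t)`, `ω = w + it`. -/
def cohForm (k : ℝ → ℝ) (a b : ℝ) (p : ℝ × ℝ) (φ ψ : Mode) : ℂ :=
  (k p.1 / Real.pi : ℂ) * (exp (2 * I * (a - b) * p.2) * ⟪φ, coherent ⟨p.1, p.2⟩⟫_ℂ
    * ⟪coherent ⟨p.1, p.2⟩, ψ⟫_ℂ)

/-- By the arithmetic-geometric inequality the integrand is dominated by the sum of two translates
of the integrable density of `integrable_realWave_sq_mul`. -/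
theorem integrable_posForm {k : ℝ → ℝ} (hk : Measurable k) (hk1 : ∀ x, |k x| ≤ 1)
    (a b : ℝ) (φ ψ : Mode) : Integrable (fun p => posForm k a b p φ ψ) := by
  have hφ := (Lp.stronglyMeasurable φ).measurable
  have hψ := (Lp.stronglyMeasurable ψ).measurable
  have hmp : ∀ c : ℝ, MeasurePreserving (fun p : ℝ × ℝ => (p.1, p.2 - c)) volume volume := fun c =>
    (MeasurePreserving.id volume).prod (measurePreserving_sub_right volume c)
  have h1 := (hmp a).integrable_comp_of_integrable (integrable_realWave_sq_mul φ)
  have h2 := (hmp b).integrable_comp_of_integrable (integrable_realWave_sq_mul ψ)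
  refine (h1.add h2).mono' ?_ (Filter.Eventually.of_forall fun p => ?_)
  · have e : (fun p => posForm k a b p φ ψ) = fun p : ℝ × ℝ => (k p.1 : ℂ) *
        (star (φ (p.2 - a)) * (realWave p.1 (p.2 - a) : ℂ) * (realWave p.1 (p.2 - b) : ℂ)
          * ψ (p.2 - b)) := by
      ext p
      simp only [posForm, posTerm, coherentWave_ofReal, RCLike.star_def, Complex.conj_ofReal]
    rw [e]
    have := fun c : ℝ => measurable_realWave.comp (hmp c).measurable
    have ha := this a
    have hb := this b
    simp only [Function.comp_def] at ha hb
    have := continuous_star.measurable (α := ℂ) (γ := ℂ)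
    exact Measurable.aestronglyMeasurable (by fun_prop)
  · simp only [posForm, posTerm, coherentWave_ofReal, RCLike.star_def, Complex.conj_ofReal, norm_mul,
      norm_real, RCLike.norm_conj, Pi.add_apply, Function.comp, Real.norm_eq_abs,
      abs_of_nonneg (realWave_nonneg _ _)]
    set A := realWave p.1 (p.2 - a) * ‖φ (p.2 - a)‖ with hA
    set B := realWave p.1 (p.2 - b) * ‖ψ (p.2 - b)‖ with hB
    have hA0 : 0 ≤ A := mul_nonneg (realWave_nonneg _ _) (norm_nonneg _)
    have hB0 : 0 ≤ B := mul_nonneg (realWave_nonneg _ _) (norm_nonneg _)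
    have e : |k p.1| * (‖φ (p.2 - a)‖ * realWave p.1 (p.2 - a) * realWave p.1 (p.2 - b)
        * ‖ψ (p.2 - b)‖) = |k p.1| * (A * B) := by rw [hA, hB]; ring
    rw [e, ← mul_pow, ← mul_pow]
    nlinarith [hk1 p.1, mul_nonneg hA0 hB0, sq_nonneg (A - B)]

theorem norm_cohForm_le {k : ℝ → ℝ} (hk1 : ∀ x, |k x| ≤ 1) (a b : ℝ) (φ ψ : Mode)
    (p : ℝ × ℝ) : ‖cohForm k a b p φ ψ‖ ≤ Real.pi⁻¹ * 2⁻¹ *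
    (‖⟪coherent ⟨p.1, p.2⟩, φ⟫_ℂ‖ ^ 2 + ‖⟪coherent ⟨p.1, p.2⟩, ψ⟫_ℂ‖ ^ 2) := by
  have e1 : 2 * I * ((a : ℂ) - b) * p.2 = ((2 * (a - b) * p.2 : ℝ) : ℂ) * I := by push_cast; ring
  rw [cohForm, norm_mul, norm_mul, norm_mul, e1, norm_exp_ofReal_mul_I, norm_div, norm_real,
    norm_real, norm_inner_symm φ, Real.norm_of_nonneg Real.pi_pos.le, Real.norm_eq_abs]
  set A := ‖⟪coherent ⟨p.1, p.2⟩, φ⟫_ℂ‖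
  set B := ‖⟪coherent ⟨p.1, p.2⟩, ψ⟫_ℂ‖
  have hA : 0 ≤ A := norm_nonneg _
  have hB : 0 ≤ B := norm_nonneg _
  calc _ ≤ 1 / Real.pi * (1 * A * B) := by gcongr; exact hk1 _
    _ ≤ _ := by
      rw [one_div, mul_assoc Real.pi⁻¹]
      refine mul_le_mul_of_nonneg_left ?_ (by positivity)
      nlinarith [sq_nonneg (A - B)]

theorem integrable_cohForm {k : ℝ → ℝ} (hk : Measurable k) (hk1 : ∀ x, |k x| ≤ 1)
    (a b : ℝ) (φ ψ : Mode) : Integrable (fun p => cohForm k a b p φ ψ) := by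
  refine (((integrable_norm_sq_inner_coherent φ).add
    (integrable_norm_sq_inner_coherent ψ)).const_mul (Real.pi⁻¹ * 2⁻¹)).mono' ?_
    (Filter.Eventually.of_forall fun p => norm_cohForm_le hk1 a b φ ψ p)
  have h1 := (measurable_inner_coherent φ).measurable
  have h2 := (measurable_inner_coherent ψ).measurable
  have h1' : Measurable fun p : ℝ × ℝ => ⟪φ, coherent ⟨p.1, p.2⟩⟫_ℂ := by
    have e : (fun p : ℝ × ℝ => ⟪φ, coherent ⟨p.1, p.2⟩⟫_ℂ)
        = fun p : ℝ × ℝ => (starRingEnd ℂ) ⟪coherent ⟨p.1, p.2⟩, φ⟫_ℂ := by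
      ext p; rw [inner_conj_symm]
    rw [e]
    exact continuous_star.measurable.comp h1
  unfold cohForm
  exact Measurable.aestronglyMeasurable (by fun_prop)

/-- Fubini reduces this to the slice identity at fixed w. It is the bridge between the phase-error
operator, an integral over ω, and the blocks, defined in position space. -/
theorem integral_cohForm_eq {k : ℝ → ℝ} (hk : Measurable k) (hk1 : ∀ x, |k x| ≤ 1)
    (a b : ℝ) (φ ψ : Mode) : ∫ p, cohForm k a b p φ ψ = ∫ p, posForm k a b p φ ψ := by
  rw [Measure.volume_eq_prod, integral_prod _ (integrable_cohForm hk hk1 a b φ ψ),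
    integral_prod _ (integrable_posForm hk hk1 a b φ ψ)]
  congr 1 with w
  simp only [cohForm, posForm]
  rw [integral_const_mul, integral_const_mul, integral_inner_coherent_slice]
  have hpi : (Real.pi : ℂ) ≠ 0 := by exact_mod_cast Real.pi_ne_zero
  field_simp

theorem norm_integral_cohForm_le_half {k : ℝ → ℝ} (hk1 : ∀ x, |k x| ≤ 1) (a b : ℝ)
    (φ ψ : Mode) :
    ‖∫ p, cohForm k a b p φ ψ‖ ≤ 2⁻¹ * (‖φ‖ ^ 2 + ‖ψ‖ ^ 2) := by
  refine (norm_integral_le_of_norm_le (((integrable_norm_sq_inner_coherent φ).add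
    (integrable_norm_sq_inner_coherent ψ)).const_mul (Real.pi⁻¹ * 2⁻¹))
    (Filter.Eventually.of_forall fun p => norm_cohForm_le hk1 a b φ ψ p)).trans (le_of_eq ?_)
  simp only [Pi.add_apply]
  rw [integral_const_mul, integral_add (integrable_norm_sq_inner_coherent φ)
    (integrable_norm_sq_inner_coherent ψ), integral_norm_sq_inner_coherent,
    integral_norm_sq_inner_coherent]
  have hpi := Real.pi_ne_zero
  field_simp

/-! ### Calculus of weak integrals -/

section Weak

variable {α H K : Type*} [MeasurableSpace α] [NormedAddCommGroup H] [InnerProductSpace ℂ H]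
  [NormedAddCommGroup K] [InnerProductSpace ℂ K] {m : Measure α}
  {s s' : α → H → H → ℂ} {M M' : H →L[ℂ] H}

theorem HasWeakIntegral.unique (h : HasWeakIntegral m s M) (h' : HasWeakIntegral m s M') :
    M = M' := by
  ext ψ
  refine ext_inner_left ℂ fun φ => ?_
  rw [(h φ ψ).2, (h' φ ψ).2]

theorem HasWeakIntegral.weakIntegral_eq (h : HasWeakIntegral m s M) : weakIntegral m s = M := by
  have hw : WeaklyIntegrable m s := ⟨M, h⟩
  rw [weakIntegral, dif_pos hw]
  exact hw.choose_spec.unique h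

theorem HasWeakIntegral.add (h : HasWeakIntegral m s M) (h' : HasWeakIntegral m s' M') :
    HasWeakIntegral m (fun a φ ψ => s a φ ψ + s' a φ ψ) (M + M') := fun φ ψ =>
  ⟨(h φ ψ).1.add (h' φ ψ).1, by
    rw [integral_add (h φ ψ).1 (h' φ ψ).1, ← (h φ ψ).2, ← (h' φ ψ).2,
      _root_.add_apply, inner_add_right]⟩

theorem HasWeakIntegral.const_mul (h : HasWeakIntegral m s M) (c : ℂ) :
    HasWeakIntegral m (fun a φ ψ => c * s a φ ψ) (c • M) := fun φ ψ =>
  ⟨(h φ ψ).1.const_mul c, by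
    rw [integral_const_mul, ← (h φ ψ).2, _root_.smul_apply, inner_smul_right]⟩

theorem HasWeakIntegral.sub (h : HasWeakIntegral m s M) (h' : HasWeakIntegral m s' M') :
    HasWeakIntegral m (fun a φ ψ => s a φ ψ - s' a φ ψ) (M - M') := fun φ ψ =>
  ⟨(h φ ψ).1.sub (h' φ ψ).1, by
    rw [integral_sub (h φ ψ).1 (h' φ ψ).1, ← (h φ ψ).2, ← (h' φ ψ).2,
      _root_.sub_apply, inner_sub_right]⟩

theorem HasWeakIntegral.comp [CompleteSpace H] [CompleteSpace K] (h : HasWeakIntegral m s M)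
    (S T : K →L[ℂ] H) :
    HasWeakIntegral m (fun a φ ψ => s a (S φ) (T ψ))
      (ContinuousLinearMap.adjoint S ∘L M ∘L T) := fun φ ψ =>
  ⟨(h _ _).1, by
    rw [← (h _ _).2, ContinuousLinearMap.comp_apply, ContinuousLinearMap.comp_apply,
      ContinuousLinearMap.adjoint_inner_right]⟩

theorem HasWeakIntegral.adjoint [CompleteSpace H] (h : HasWeakIntegral m s M) :
    HasWeakIntegral m (fun a φ ψ => (starRingEnd ℂ) (s a ψ φ))
      (ContinuousLinearMap.adjoint M) := fun φ ψ =>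
  ⟨Complex.conjCLE.toContinuousLinearMap.integrable_comp (h ψ φ).1, by
    rw [integral_conj, ← (h _ _).2, ContinuousLinearMap.adjoint_inner_right, inner_conj_symm]⟩

theorem HasWeakIntegral.congr (h : HasWeakIntegral m s M) (e : ∀ a φ ψ, s' a φ ψ = s a φ ψ) :
    HasWeakIntegral m s' M := by
  have : s' = s := by ext a φ ψ; exact e a φ ψ
  rwa [this]

/-- A form that is pointwise sesquilinear and whose integral is bounded has a weak integral. -/
theorem weaklyIntegrable_of_bound [CompleteSpace H]
    (hadd_left : ∀ a φ φ' ψ, s a (φ + φ') ψ = s a φ ψ + s a φ' ψ)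
    (hsmul_left : ∀ a (c : ℂ) φ ψ, s a (c • φ) ψ = (starRingEnd ℂ) c * s a φ ψ)
    (hadd_right : ∀ a φ ψ ψ', s a φ (ψ + ψ') = s a φ ψ + s a φ ψ')
    (hsmul_right : ∀ a (c : ℂ) φ ψ, s a φ (c • ψ) = c * s a φ ψ)
    (hint : ∀ φ ψ, Integrable (fun a => s a φ ψ) m)
    (hbound : ∀ φ ψ, ‖∫ a, s a φ ψ ∂m‖ ≤ 2⁻¹ * (‖φ‖ ^ 2 + ‖ψ‖ ^ 2)) :
    WeaklyIntegrable m s := by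
  let B : H →ₗ⋆[ℂ] H →ₗ[ℂ] ℂ := LinearMap.mk₂'ₛₗ (starRingEnd ℂ) (RingHom.id ℂ)
    (fun φ ψ => ∫ a, s a φ ψ ∂m)
    (fun φ φ' ψ => by simp only [hadd_left]; exact integral_add (hint _ _) (hint _ _))
    (fun c φ ψ => by simp only [hsmul_left, smul_eq_mul]; exact integral_const_mul _ _)
    (fun φ ψ ψ' => by simp only [hadd_right]; exact integral_add (hint _ _) (hint _ _))
    (fun c φ ψ => by
      simp only [hsmul_right, smul_eq_mul, RingHom.id_apply]; exact integral_const_mul _ _)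
  have hB : ∀ φ ψ, ‖B φ ψ‖ ≤ 1 * ‖φ‖ * ‖ψ‖ := by
    intro φ ψ
    rcases eq_or_ne φ 0 with rfl | hφ
    · simp
    rcases eq_or_ne ψ 0 with rfl | hψ
    · simp
    have h1 : 0 < ‖φ‖ := norm_pos_iff.2 hφ
    have h2 : 0 < ‖ψ‖ := norm_pos_iff.2 hψ
    -- Rescaling both vectors to norm 1 turns the bound by half the sum of squares into a bound by
    -- the product of norms.
    have h := hbound (((‖φ‖⁻¹ : ℝ) : ℂ) • φ) (((‖ψ‖⁻¹ : ℝ) : ℂ) • ψ)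
    change ‖B _ _‖ ≤ _ at h
    rw [LinearMap.map_smul, LinearMap.map_smulₛₗ₂, norm_smul, norm_smul, norm_smul, norm_smul,
      RCLike.norm_conj, norm_real, norm_real, norm_inv, norm_inv, norm_norm, norm_norm,
      inv_mul_cancel₀ h1.ne', inv_mul_cancel₀ h2.ne'] at h
    field_simp at h
    linarith
  let C : H →L⋆[ℂ] H →L[ℂ] ℂ := LinearMap.mkContinuous₂ B 1 hB
  refine ⟨ContinuousLinearMap.adjoint (InnerProductSpace.continuousLinearMapOfBilin C),
    fun φ ψ => ⟨hint φ ψ, ?_⟩⟩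
  rw [ContinuousLinearMap.adjoint_inner_right, InnerProductSpace.continuousLinearMapOfBilin_apply]
  rfl

end Weak

/-- The position-space form and the coherent-state form have the same weak integral. -/
theorem exists_hasWeakIntegral_posForm_cohForm {k : ℝ → ℝ} (hk : Measurable k)
    (hk1 : ∀ x, |k x| ≤ 1) (a b : ℝ) :
    ∃ M : Mode →L[ℂ] Mode, HasWeakIntegral volume (posForm k a b) M ∧
      HasWeakIntegral volume (cohForm k a b) M := by
  have h : WeaklyIntegrable volume (cohForm k a b) := by
    refine weaklyIntegrable_of_bound ?_ ?_ ?_ ?_ (fun φ ψ => integrable_cohForm hk hk1 a b φ ψ)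
      (fun φ ψ => norm_integral_cohForm_le_half hk1 a b φ ψ)
    · intro p φ φ' ψ
      simp only [cohForm, inner_add_left]; ring
    · intro p c φ ψ
      simp only [cohForm, inner_smul_left]; ring
    · intro p φ ψ ψ'
      simp only [cohForm, inner_add_right]; ring
    · intro p c φ ψ
      simp only [cohForm, inner_smul_right]; ring
  obtain ⟨M, hM⟩ := h
  refine ⟨M, fun φ ψ => ⟨integrable_posForm hk hk1 a b φ ψ, ?_⟩, hM⟩
  rw [(hM φ ψ).2, integral_cohForm_eq hk hk1]

/-! ### Parity -/

/-- The parity operator `(Pψ)(x) = ψ(-x)`. -/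
def parity : Mode →L[ℂ] Mode :=
  (Lp.compMeasurePreservingₗᵢ ℂ (Neg.neg : ℝ → ℝ)
    (Measure.measurePreserving_neg volume)).toContinuousLinearMap

theorem coeFn_parity (ψ : Mode) : parity ψ =ᵐ[volume] fun x => ψ (-x) :=
  Lp.coeFn_compMeasurePreserving ψ (Measure.measurePreserving_neg volume)

theorem parity_parity (ψ : Mode) : parity (parity ψ) = ψ := by
  refine Lp.ext ?_
  have h := (Measure.measurePreserving_neg (volume : Measure ℝ)).quasiMeasurePreserving.ae
    (coeFn_parity ψ)
  filter_upwards [coeFn_parity (parity ψ), h] with x hx hx'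
  rw [hx, hx', neg_neg]

theorem inner_parity_parity (φ ψ : Mode) : ⟪parity φ, parity ψ⟫_ℂ = ⟪φ, ψ⟫_ℂ :=
  LinearIsometry.inner_map_map _ φ ψ

theorem inner_parity_left (φ ψ : Mode) : ⟪parity φ, ψ⟫_ℂ = ⟪φ, parity ψ⟫_ℂ := by
  rw [← inner_parity_parity φ (parity ψ), parity_parity]

theorem parity_toLp {g : ℝ → ℂ} (hg : MemLp g 2 volume) (c : ℂ) {k : ℝ → ℂ}
    (hk : MemLp k 2 volume)
    (h : ∀ x, g (-x) = c * k x) : parity (hg.toLp g) = c • hk.toLp k := by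
  refine Lp.ext ?_
  have h1 := (Measure.measurePreserving_neg (volume : Measure ℝ)).quasiMeasurePreserving.ae
    hg.coeFn_toLp
  filter_upwards [coeFn_parity (hg.toLp g), h1, hk.coeFn_toLp, Lp.coeFn_smul c (hk.toLp k)]
    with x h1 h2 h3 h4
  rw [h1, h2, h4, Pi.smul_apply, h3, h, smul_eq_mul]

theorem parity_coherent (ω : ℂ) : parity (coherent ω) = coherent (-ω) := by
  have := parity_toLp (memLp_coherentWave ω) 1 (memLp_coherentWave (-ω)) fun x => by
    simp only [coherentWave]
    rw [one_mul]
    congr 2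
    simp only [Complex.neg_re, Complex.neg_im]
    push_cast
    ring
  rwa [one_smul] at this

/-- Differentiating the induction hypothesis gives the parity of the derivative that occurs in the
recursion He_{n+1} = X He_n - He_n'. -/
theorem hermite_comp_neg (n : ℕ) :
    (Polynomial.hermite n).comp (-Polynomial.X) = (-1) ^ n * Polynomial.hermite n := by
  induction n with
  | zero => simp
  | succ n ih =>
    have hd := congrArg Polynomial.derivative ih
    rw [Polynomial.derivative_comp] at hd
    have e : ((-1) ^ n : Polynomial ℤ) = Polynomial.C ((-1) ^ n) := by simp
    rw [e, Polynomial.derivative_C_mul, ← e] at hd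
    simp only [Polynomial.derivative_neg, Polynomial.derivative_X] at hd
    rw [Polynomial.hermite_succ, Polynomial.sub_comp, Polynomial.mul_comp, Polynomial.X_comp, ih]
    linear_combination hd

theorem parity_numberState (n : ℕ) : parity (numberState n) = ((-1) ^ n : ℂ) • numberState n := by
  refine parity_toLp (memLp_numberWave n) _ (memLp_numberWave n) fun x => ?_
  have h := congrArg (Polynomial.aeval (2 * x)) (hermite_comp_neg n)
  rw [Polynomial.aeval_comp] at h
  simp only [map_neg, Polynomial.aeval_X, map_mul, map_pow, map_one] at h
  have e : (2 : ℝ) * -x = -(2 * x) := by ring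
  simp only [numberWave]
  rw [e, h]
  push_cast
  ring_nf

/-! ### Completeness of the number states -/

theorem integrable_poly_mul_gauss_mul (p : Polynomial ℝ) (h : Mode) :
    Integrable (fun x : ℝ => ((p.eval x * Real.exp (-x ^ 2) : ℝ) : ℂ) * h x) :=
  ((memLp_poly_mul_gauss p).ofReal (K := ℂ)).integrable_mul (Lp.memLp h)

/-- The polynomials `p` with `p(x) e^{-x²}` orthogonal to `h`. -/
def orthPoly (h : Mode) : Submodule ℝ (Polynomial ℝ) where
  carrier := {p | ∫ x : ℝ, ((p.eval x * Real.exp (-x ^ 2) : ℝ) : ℂ) * h x = 0}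
  zero_mem' := by simp
  add_mem' := by
    intro p q hp hq
    simp only [Set.mem_ofPred_eq] at *
    have := integral_add (integrable_poly_mul_gauss_mul p h) (integrable_poly_mul_gauss_mul q h)
    rw [hp, hq, add_zero] at this
    rw [← this]
    congr 1 with x
    rw [Polynomial.eval_add]
    push_cast
    ring
  smul_mem' := by
    intro c p hp
    simp only [Set.mem_ofPred_eq] at *
    have := integral_const_mul (μ := volume) (c : ℂ)
      (fun x : ℝ => ((p.eval x * Real.exp (-x ^ 2) : ℝ) : ℂ) * h x)
    rw [hp, mul_zero] at this
    rw [← this]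
    congr 1 with x
    rw [Polynomial.eval_smul, smul_eq_mul]
    push_cast
    ring

/-- The rescaled Hermite polynomials `He_n(2x)`. -/
def hermiteSeq : Polynomial.Sequence ℝ where
  elems' n := ((Polynomial.hermite n).map (Int.castRingHom ℝ)).comp
    (Polynomial.C 2 * Polynomial.X)
  degree_eq' n := by
    have h1 : ((Polynomial.hermite n).map (Int.castRingHom ℝ)).natDegree = n := by
      rw [(Polynomial.hermite_monic n).natDegree_map, Polynomial.natDegree_hermite]
    have h2 : (((Polynomial.hermite n).map (Int.castRingHom ℝ)).comp
        (Polynomial.C 2 * Polynomial.X)).natDegree = n := by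
      rw [Polynomial.natDegree_comp, h1, Polynomial.natDegree_C_mul_X _ (by norm_num), mul_one]
    rcases Nat.eq_zero_or_pos n with rfl | hn
    · simp
    · exact (Polynomial.degree_eq_iff_natDegree_eq_of_pos hn).2 h2

/-- The rescaled Hermite polynomials have one member of each degree, so they span all polynomials.
-/
theorem orthPoly_eq_top {h : Mode} (hh : ∀ n, ⟪numberState n, h⟫_ℂ = 0) : orthPoly h = ⊤ := by
  rw [eq_top_iff, ← hermiteSeq.span fun i => by
    simp [Polynomial.leadingCoeff_eq_zero, hermiteSeq.ne_zero i], Submodule.span_le]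
  rintro _ ⟨n, rfl⟩
  have h0 := hh n
  rw [L2.inner_def] at h0
  set c : ℝ := (2 / Real.pi) ^ (1 / 4 : ℝ) / Real.sqrt (n.factorial : ℝ) with hc
  have hc0 : (c : ℂ) ≠ 0 := by
    have : 0 < c := by positivity
    exact_mod_cast this.ne'
  have e : (∫ x, ⟪numberState n x, h x⟫_ℂ)
      = c * ∫ x : ℝ, (((hermiteSeq n).eval x * Real.exp (-x ^ 2) : ℝ) : ℂ) * h x := by
    rw [← integral_const_mul]
    refine integral_congr_ae ?_
    filter_upwards [(memLp_numberWave n).coeFn_toLp] with x hx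
    have e1 : (hermiteSeq n).eval x = Polynomial.aeval (2 * x) (Polynomial.hermite n) := by
      simp [hermiteSeq, Polynomial.eval_comp, Polynomial.aeval_def, Polynomial.eval_map]
    rw [numberState, hx, RCLike.inner_apply, numberWave, Complex.conj_ofReal, e1, ← hc]
    push_cast
    ring
  rw [e] at h0
  exact (mul_eq_zero.1 h0).resolve_left hc0

/-- Completing the square makes e^{rx}e^{-x²} a translated Gaussian, and e^{r|x|} ≤ e^{rx} +
e^{-rx}. It provides the integrable majorant for the exponential series below. -/
theorem memLp_exp_mul_gauss (r : ℝ) : MemLp (fun x : ℝ => Real.exp (r * |x|) * Real.exp (-x ^ 2)) 2 := by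
  have hs : ∀ r : ℝ, MemLp (fun x : ℝ => Real.exp (r * x) * Real.exp (-x ^ 2)) 2 := by
    intro r
    have h1 := ((memLp_pow_mul_gauss 0).comp_measurePreserving
      (measurePreserving_sub_right volume (r / 2))).const_mul (Real.exp (r ^ 2 / 4))
    refine h1.congr_norm (by fun_prop) (Filter.Eventually.of_forall fun x => ?_)
    congr 1
    simp only [Function.comp, pow_zero, one_mul]
    rw [← Real.exp_add, ← Real.exp_add]
    congr 1
    ring
  refine ((hs r).add (hs (-r))).mono (by fun_prop) (Filter.Eventually.of_forall fun x => ?_)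
  rw [Pi.add_apply, ← add_mul, Real.norm_of_nonneg (by positivity), Real.norm_of_nonneg (by positivity)]
  refine mul_le_mul_of_nonneg_right ?_ (by positivity)
  rcases abs_cases x with ⟨hx, _⟩ | ⟨hx, _⟩ <;> rw [hx]
  · linarith [Real.exp_pos (-r * x)]
  · rw [show r * -x = -r * x by ring]
    linarith [Real.exp_pos (r * x)]

/-- Expand e^{zx} in its power series: every term is a polynomial times the Gaussian, hence
orthogonal, and dominated convergence allows the termwise integration. -/
theorem integral_exp_mul_gauss_mul_eq_zero {h : Mode} (hh : ∀ n, ⟪numberState n, h⟫_ℂ = 0) (z : ℂ) :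
    ∫ x : ℝ, exp (z * x) * (Real.exp (-x ^ 2) : ℂ) * h x = 0 := by
  have hpow : ∀ n : ℕ, ∫ x : ℝ, ((x ^ n * Real.exp (-x ^ 2) : ℝ) : ℂ) * h x = 0 := by
    intro n
    have : (Polynomial.X ^ n : Polynomial ℝ) ∈ orthPoly h := by
      rw [orthPoly_eq_top hh]; trivial
    simpa [orthPoly] using this
  have hsum := hasSum_integral_of_dominated_convergence (μ := volume)
    (F := fun (n : ℕ) (x : ℝ) => (z ^ n / n.factorial) *
      (((x ^ n * Real.exp (-x ^ 2) : ℝ) : ℂ) * h x))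
    (f := fun x : ℝ => exp (z * x) * (Real.exp (-x ^ 2) : ℂ) * h x)
    (fun n x => (‖z‖ * |x|) ^ n / n.factorial * (Real.exp (-x ^ 2) * ‖h x‖))
    (fun n => ?_) (fun n => Filter.Eventually.of_forall fun x => ?_)
    (Filter.Eventually.of_forall fun x => ?_) ?_ (Filter.Eventually.of_forall fun x => ?_)
  · have : ∀ n : ℕ, ∫ x : ℝ, (z ^ n / n.factorial) *
      (((x ^ n * Real.exp (-x ^ 2) : ℝ) : ℂ) * h x) = 0 := by
      intro n
      rw [integral_const_mul, hpow, mul_zero]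
    simp only [this] at hsum
    exact hsum.unique hasSum_zero
  · have := Lp.aestronglyMeasurable h
    fun_prop
  · apply le_of_eq
    simp only [norm_mul, norm_div, norm_pow, norm_real, Real.norm_eq_abs, Real.abs_exp, RCLike.norm_natCast, mul_pow]
    ring
  · exact (Real.summable_pow_div_factorial _).mul_right _
  · have e : (fun x : ℝ => ∑' n : ℕ, (‖z‖ * |x|) ^ n / n.factorial * (Real.exp (-x ^ 2) * ‖h x‖))
        = fun x => Real.exp (‖z‖ * |x|) * Real.exp (-x ^ 2) * ‖h x‖ := by
      ext x
      rw [tsum_mul_right, Real.exp_eq_exp_ℝ, NormedSpace.exp_eq_tsum_div, mul_assoc]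
    rw [e]
    exact (memLp_exp_mul_gauss ‖z‖).integrable_mul (Lp.memLp h).norm
  · have h1 := NormedSpace.expSeries_div_hasSum_exp (𝔸 := ℂ) (z * x)
    rw [← Complex.exp_eq_exp_ℂ] at h1
    have := h1.mul_right ((Real.exp (-x ^ 2) : ℂ) * h x)
    rw [← mul_assoc] at this
    convert! this using 2 with n
    rw [mul_pow]
    push_cast
    ring

/-- Coherent states are exponentials times the Gaussian, so all coherent overlaps of `h` vanish, and
the resolution of the identity then gives norm zero. -/
theorem eq_zero_of_inner_numberState {h : Mode} (hh : ∀ n, ⟪numberState n, h⟫_ℂ = 0) : h = 0 := by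
  have h0 : ∀ p : ℝ × ℝ, ⟪coherent ⟨p.1, p.2⟩, h⟫_ℂ = 0 := by
    rintro ⟨w, t⟩
    rw [inner_coherent]
    -- The exponent is the coefficient of x in the conjugate coherent wave function once e^{-x²} is
    -- split off.
    have := integral_exp_mul_gauss_mul_eq_zero hh (2 * (w - I * t))
    set c : ℂ := (((2 / Real.pi) ^ (1 / 4 : ℝ) : ℝ) : ℂ) * exp (-w ^ 2 + I * w * t) with hc
    have e : ∀ x : ℝ, star (coherentWave ⟨w, t⟩ x) * h x
        = c * (exp (2 * (w - I * t) * x) * (Real.exp (-x ^ 2) : ℂ) * h x) := by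
      intro x
      rw [coherentWave, RCLike.star_def, map_mul, Complex.conj_ofReal, ← Complex.exp_conj, hc,
        Complex.ofReal_exp]
      have e1 : exp (-w ^ 2 + I * w * t) * exp (2 * (w - I * t) * x) * exp ((-x ^ 2 : ℝ) : ℂ)
          = exp ((starRingEnd ℂ) (-((x : ℂ) - w) ^ 2 + 2 * I * t * x - I * w * t)) := by
        rw [← Complex.exp_add, ← Complex.exp_add]
        congr 1
        simp only [map_sub, map_mul, map_add, map_neg, map_pow, Complex.conj_I,
          Complex.conj_ofReal, map_ofNat]
        push_cast
        ring
      rw [← e1]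
      ring
    simp_rw [e]
    rw [integral_const_mul, this, mul_zero]
  have h1 := integral_norm_sq_inner_coherent h
  simp only [h0, norm_zero, ne_eq, OfNat.ofNat_ne_zero, not_false_eq_true, zero_pow,
    integral_zero] at h1
  have h2 : ‖h‖ ^ 2 = 0 := (mul_eq_zero.1 h1.symm).resolve_left Real.pi_ne_zero
  simpa using h2

/-- Parity acts as (-1)^δ on the closed span, and the number states are complete; δ = 0 and δ = 1
treat the even and the odd projection together. -/
theorem starProjection_numberState (δ : ℕ) (hδ : δ < 2) (ψ : Mode) :
    (Submodule.span ℂ (Set.range fun k : ℕ =>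
      numberState (2 * k + δ))).topologicalClosure.starProjection ψ
      = (2⁻¹ : ℂ) • (ψ + ((-1) ^ δ : ℂ) • parity ψ) := by
  set ε : ℂ := (-1) ^ δ with hε
  have hε2 : ε * ε = 1 := by rw [hε, ← mul_pow]; simp
  have hεc : (starRingEnd ℂ) ε = ε := by rw [hε]; simp
  set K := (Submodule.span ℂ (Set.range fun k : ℕ => numberState (2 * k + δ))).topologicalClosure
  have hnK : ∀ k : ℕ, numberState (2 * k + δ) ∈ K := fun k =>
    Submodule.le_topologicalClosure _ (Submodule.subset_span ⟨k, rfl⟩)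
  have hpar : ∀ v ∈ K, parity v = ε • v := by
    have hle : K ≤ (parity - ε • (1 : Mode →L[ℂ] Mode)).ker := by
      refine Submodule.topologicalClosure_minimal _ ?_
        (ContinuousLinearMap.isClosed_ker (parity - ε • (1 : Mode →L[ℂ] Mode)))
      rw [Submodule.span_le]
      rintro _ ⟨k, rfl⟩
      simp [parity_numberState, pow_add, pow_mul, hε]
    intro v hv
    have := hle hv
    simpa [sub_eq_zero] using this
  refine Submodule.eq_starProjection_of_mem_of_inner_eq_zero ?_ ?_
  -- Membership is tested against vectors h orthogonal to K. The overlap of h ± Ph with |n⟩ vanishes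
  -- by parity when n has the wrong parity and by h ⊥ K otherwise, so h ± Ph = 0 by completeness.
  · have hK : K = Kᗮᗮ := by rw [Submodule.orthogonal_orthogonal]
    change _ ∈ K
    rw [hK, Submodule.mem_orthogonal]
    intro h hh
    rw [Submodule.mem_orthogonal] at hh
    have h0 : h + ε • parity h = 0 := by
      refine eq_zero_of_inner_numberState fun n => ?_
      rw [inner_add_right, inner_smul_right, ← inner_parity_left, parity_numberState,
        inner_smul_left, map_pow, map_neg, map_one, ← mul_assoc, hε, ← pow_add, ← one_add_mul]
      rcases Nat.even_or_odd (δ + n) with hpar | hpar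
      · have : n % 2 = δ := by
          obtain ⟨r, hr⟩ := hpar
          omega
        have hn : n = 2 * (n / 2) + δ := by omega
        rw [hn, hh _ (hnK _), mul_zero]
      · rw [hpar.neg_one_pow]; simp
    rw [inner_smul_right, inner_add_right, inner_smul_right, ← inner_parity_left]
    have h2 : ⟪h + ε • parity h, ψ⟫_ℂ = 0 := by rw [h0, inner_zero_left]
    rw [inner_add_left, inner_smul_left, hεc] at h2
    rw [h2, mul_zero]
  · intro v hv
    have h2 := hpar v hv
    have h3 : ⟪parity ψ, v⟫_ℂ = ε * ⟪ψ, v⟫_ℂ := by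
      rw [inner_parity_left, h2, inner_smul_right]
    rw [inner_sub_left, inner_smul_left, inner_add_left, inner_smul_left, h3, hεc, ← mul_assoc ε,
      hε2]
    simp only [map_inv₀, map_ofNat]
    ring

theorem evProj_apply (ψ : Mode) : evProj ψ = (2⁻¹ : ℂ) • (ψ + parity ψ) := by
  have h := starProjection_numberState 0 (by norm_num) ψ
  rwa [pow_zero, one_smul] at h

theorem odProj_apply (ψ : Mode) : odProj ψ = (2⁻¹ : ℂ) • (ψ - parity ψ) := by
  have h := starProjection_numberState 1 (by norm_num) ψ
  rwa [pow_one, neg_one_smul, ← sub_eq_add_neg] at h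

/-! ### The twisting unitary in closed form -/

/-- The reflection `sin θ Z + cos θ X`. -/
def reflection (θ : ℝ) : Matrix (Fin 2) (Fin 2) ℂ :=
  !![(Real.sin θ : ℂ), (Real.cos θ : ℂ); (Real.cos θ : ℂ), -(Real.sin θ : ℂ)]

theorem proj_apply (u : Fin 2 → ℂ) (i j : Fin 2) : proj u i j = u i * (starRingEnd ℂ) (u j) := rfl

theorem inv_sqrt_two_mul_self : (Real.sqrt 2 : ℂ)⁻¹ * (Real.sqrt 2 : ℂ)⁻¹ = 2⁻¹ := by
  rw [← mul_inv]
  congr 1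
  exact_mod_cast Real.mul_self_sqrt (by norm_num : (0 : ℝ) ≤ 2)

/-- The ratio of the two densities is e^{4βw}, so each is their geometric mean times e^{±2βw}. -/
theorem gaussianPDFReal_eq (β w : ℝ) :
    gaussianPDFReal β (1 / 2) w = Real.sqrt (gaussianPDFReal β (1 / 2) w) *
      Real.sqrt (gaussianPDFReal (-β) (1 / 2) w) * Real.exp (2 * β * w) := by
  rw [← Real.sqrt_mul (gaussianPDFReal_nonneg _ _ _)]
  have e : gaussianPDFReal β (1 / 2) w * gaussianPDFReal (-β) (1 / 2) w
      = (gaussianPDFReal β (1 / 2) w * Real.exp (-(2 * β * w))) ^ 2 := by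
    simp only [gaussianPDFReal]
    rw [mul_mul_mul_comm, ← Real.exp_add, mul_assoc _ (Real.exp _) (Real.exp _), ← Real.exp_add,
      mul_pow, ← Real.exp_nat_mul, sq (Real.sqrt _)⁻¹]
    congr 2
    push_cast
    ring
  rw [e, Real.sqrt_sq (mul_nonneg (gaussianPDFReal_nonneg _ _ _) (Real.exp_pos _).le), mul_assoc,
    ← Real.exp_add]
  simp

/-- Since ⟨0|±⟩⟨±|1⟩ = ±1/2, the diagonal of the matrix carries (1-q) - q = e^{-2(μ-β²)} and the
off-diagonal (1-q) + q = 1. The constant c is half the geometric mean of the two Gaussian densities.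
-/
theorem tau01_eq (μ β w : ℝ) : ∃ c : ℝ, 0 < c ∧ tau01 μ β w =
    !![((Real.exp (-2 * (μ - β ^ 2)) * (c * Real.exp (2 * β * w)) : ℝ) : ℂ), (c : ℂ);
      (c : ℂ), ((Real.exp (-2 * (μ - β ^ 2)) * (c * Real.exp (-(2 * β * w))) : ℝ) : ℂ)] := by
  set a := Real.sqrt (gaussianPDFReal β (1 / 2) w) with ha
  set b := Real.sqrt (gaussianPDFReal (-β) (1 / 2) w) with hb
  have ha2 : a * a = a * b * Real.exp (2 * β * w) := by
    rw [ha, Real.mul_self_sqrt (gaussianPDFReal_nonneg _ _ _), ← gaussianPDFReal_eq]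
  have hb2 : b * b = a * b * Real.exp (-(2 * β * w)) := by
    have := gaussianPDFReal_eq (-β) w
    rw [neg_neg, ← ha, ← hb] at this
    have e : b * b = gaussianPDFReal (-β) (1 / 2) w :=
      Real.mul_self_sqrt (gaussianPDFReal_nonneg _ _ _)
    rw [e, this]
    ring_nf
  have ha0 : 0 < a := Real.sqrt_pos.2 (gaussianPDFReal_pos _ _ _ (by norm_num))
  have hb0 : 0 < b := Real.sqrt_pos.2 (gaussianPDFReal_pos _ _ _ (by norm_num))
  refine ⟨a * b / 2, by positivity, ?_⟩
  have e1 : a * b / 2 * Real.exp (2 * β * w) = a * a / 2 := by rw [ha2]; ring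
  have e2 : a * b / 2 * Real.exp (-(2 * β * w)) = b * b / 2 := by rw [hb2]; ring
  rw [e1, e2]
  have hP : proj ketP 0 1 = 2⁻¹ := by rw [proj_apply]; simp [ketP, inv_sqrt_two_mul_self]
  have hM : proj ketM 0 1 = -2⁻¹ := by rw [proj_apply]; simp [ketM, inv_sqrt_two_mul_self]
  have hτ : ∀ i j, tau01 μ β w i j = ((1 - qErr μ β : ℝ) : ℂ) *
      (gaussKet β 1 w i * (starRingEnd ℂ) (gaussKet β 1 w j) * 2⁻¹) + (qErr μ β : ℂ) *
      (gaussKet β (-1) w i * (starRingEnd ℂ) (gaussKet β (-1) w j) * -2⁻¹) := by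
    intro i j
    simp only [tau01, tauAB, Matrix.of_apply, Matrix.add_apply, Matrix.smul_apply,
      Matrix.kroneckerMap_apply, smul_eq_mul, hP, hM]
    rw [proj_apply, proj_apply]
  have hg : ∀ s : ℝ, gaussKet β s w = ![(a : ℂ), (s * b : ℂ)] := fun s => rfl
  clear_value a b
  ext i j
  rw [hτ, hg, hg]
  fin_cases i <;> fin_cases j <;>
  · simp [qErr]
    ring

/-- With eigenvalues l > m one has (l - m)W = 2T - (tr T)I, which is proportional to XZ + σ_x with X
= tan θ; W² = 1 and l > m fix the positive factor. The choice of phases of the eigenvectors drops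
out. -/
theorem twistW_eq {μ β : ℝ} {up um : ℝ → Fin 2 → ℂ} {w : ℝ}
    (hup : IsPosEigenvector (tau01 μ β w) (up w)) (hum : IsNegEigenvector (tau01 μ β w) (um w)) :
    twistW up um w = reflection (theta μ β w) := by
  obtain ⟨c, hc, hT⟩ := tau01_eq μ β w
  obtain ⟨hu, l, hl, hul⟩ := hup
  obtain ⟨hv, m, hm, hvm⟩ := hum
  set r := Real.exp (-2 * (μ - β ^ 2)) with hr
  have hθ : theta μ β w = Real.arctan (r * Real.sinh (2 * β * w)) := rfl
  set X := r * Real.sinh (2 * β * w) with hX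
  rw [hT] at hul hvm
  set p : ℝ := r * (c * Real.exp (2 * β * w)) with hp
  set q : ℝ := r * (c * Real.exp (-(2 * β * w))) with hq
  have hpq : p - q = 2 * c * X := by
    rw [hp, hq, hX, Real.sinh_eq]; ring
  have u0 := congrFun hul 0
  have u1 := congrFun hul 1
  have v0 := congrFun hvm 0
  have v1 := congrFun hvm 1
  simp only [Matrix.mulVec, dotProduct, Fin.sum_univ_two, Matrix.of_apply, Matrix.cons_val_zero,
    Matrix.cons_val_one, Pi.smul_apply, smul_eq_mul, Pi.star_apply, RCLike.star_def,
    Matrix.cons_val', Matrix.cons_val_fin_one] at u0 u1 v0 v1 hu hv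
  have cu0 := congrArg (starRingEnd ℂ) u0
  have cu1 := congrArg (starRingEnd ℂ) u1
  have cv0 := congrArg (starRingEnd ℂ) v0
  have cv1 := congrArg (starRingEnd ℂ) v1
  simp only [map_add, map_mul, Complex.conj_ofReal] at cu0 cu1 cv0 cv1
  have hlm : ((l : ℂ) - m) ≠ 0 := by
    have : l - m ≠ 0 := by linarith
    exact_mod_cast this
  -- Eigenvectors of a Hermitian matrix for distinct eigenvalues are orthogonal.
  have horth : (starRingEnd ℂ) (um w 0) * up w 0 + (starRingEnd ℂ) (um w 1) * up w 1 = 0 := by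
    refine (mul_eq_zero.1 ?_).resolve_left hlm
    linear_combination up w 0 * cv0 + up w 1 * cv1 - (starRingEnd ℂ) (um w 0) * u0
      - (starRingEnd ℂ) (um w 1) * u1
  have horth' : (starRingEnd ℂ) (up w 0) * um w 0 + (starRingEnd ℂ) (up w 1) * um w 1 = 0 := by
    have := congrArg (starRingEnd ℂ) horth
    simp only [map_add, map_mul, Complex.conj_conj, map_zero] at this
    linear_combination this
  have hU : !![(starRingEnd ℂ) (up w 0), (starRingEnd ℂ) (up w 1);
      (starRingEnd ℂ) (um w 0), (starRingEnd ℂ) (um w 1)]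
      * !![up w 0, um w 0; up w 1, um w 1] = 1 := by
    rw [Matrix.mul_fin_two, Matrix.one_fin_two, hu, hv, horth, horth']
  -- A left inverse of a square matrix is a right inverse, so orthonormality becomes the
  -- completeness relation of the two eigenvectors.
  rw [mul_eq_one_comm, Matrix.mul_fin_two, Matrix.one_fin_two] at hU
  have g00 := congrFun (congrFun hU 0) 0
  have g01 := congrFun (congrFun hU 0) 1
  have g10 := congrFun (congrFun hU 1) 0
  have g11 := congrFun (congrFun hU 1) 1
  simp only [Matrix.of_apply, Matrix.cons_val_zero, Matrix.cons_val_one, Matrix.cons_val',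
    Matrix.cons_val_fin_one] at g00 g01 g10 g11
  have hW : twistW up um w = !![up w 0 * (starRingEnd ℂ) (up w 0)
        - um w 0 * (starRingEnd ℂ) (um w 0),
      up w 0 * (starRingEnd ℂ) (up w 1) - um w 0 * (starRingEnd ℂ) (um w 1);
      up w 1 * (starRingEnd ℂ) (up w 0) - um w 1 * (starRingEnd ℂ) (um w 0),
      up w 1 * (starRingEnd ℂ) (up w 1) - um w 1 * (starRingEnd ℂ) (um w 1)] := by
    ext i j
    fin_cases i <;> fin_cases j <;> rfl
  generalize up w 0 = a at *
  generalize up w 1 = b at *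
  generalize um w 0 = x at *
  generalize um w 1 = y at *
  have hpqC : (p : ℂ) - q = 2 * c * X := by exact_mod_cast congrArg Complex.ofReal hpq
  have w00 : ((l : ℂ) - m) * (a * (starRingEnd ℂ) a - x * (starRingEnd ℂ) x) = 2 * c * X := by
    linear_combination hpqC - (starRingEnd ℂ) a * u0 - (starRingEnd ℂ) x * v0
      + (starRingEnd ℂ) b * u1 + (starRingEnd ℂ) y * v1 + p * g00 + c * g10 - c * g01 - q * g11
      + l * (hu - g00) + m * (hv - g00)
  have w01 : ((l : ℂ) - m) * (a * (starRingEnd ℂ) b) = c := by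
    linear_combination - (starRingEnd ℂ) b * u0 - (starRingEnd ℂ) y * v0 + p * g01 + c * g11
      - m * g01
  have w10 : ((l : ℂ) - m) * (b * (starRingEnd ℂ) a) = c := by
    linear_combination - (starRingEnd ℂ) a * u1 - (starRingEnd ℂ) x * v1 + q * g10 + c * g00
      - m * g10
  -- The content of W² = 1: the spectral gap equals 2c√(1 + X²), that is, 2c / cos θ.
  have hsq : (2 * c) ^ 2 * (1 + X ^ 2) = (l - m) ^ 2 := by
    have e1 : (a * (starRingEnd ℂ) a - x * (starRingEnd ℂ) x) ^ 2
        + 4 * (a * (starRingEnd ℂ) b) * (b * (starRingEnd ℂ) a) = 1 := by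
      have e2 : x * (starRingEnd ℂ) x = 1 - a * (starRingEnd ℂ) a := by linear_combination g00
      have e3 : (starRingEnd ℂ) b * b = 1 - a * (starRingEnd ℂ) a := by linear_combination hu
      rw [e2]
      linear_combination 4 * a * (starRingEnd ℂ) a * e3
    have : ((2 * c) ^ 2 * (1 + X ^ 2) : ℂ) = (l - m) ^ 2 := by
      linear_combination ((l : ℂ) - m) ^ 2 * e1 - (((l : ℂ) - m) * (a * (starRingEnd ℂ) a
        - x * (starRingEnd ℂ) x) + 2 * c * X) * w00 - 4 * c * w01
        - 4 * ((l : ℂ) - m) * (a * (starRingEnd ℂ) b) * w10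
    exact_mod_cast this
  have hs0 : 0 < Real.sqrt (1 + X ^ 2) := by positivity
  have hs : 2 * c * Real.sqrt (1 + X ^ 2) = l - m := by
    have h1 : 0 ≤ 2 * c * Real.sqrt (1 + X ^ 2) := by positivity
    rw [← Real.sqrt_sq h1, mul_pow, Real.sq_sqrt (by positivity), hsq,
      Real.sqrt_sq (by linarith)]
  have hcos : Real.cos (theta μ β w) * (l - m) = 2 * c := by
    rw [hθ, Real.cos_arctan, ← hs]
    field_simp
  have hsin : Real.sin (theta μ β w) * (l - m) = 2 * c * X := by
    rw [hθ, Real.sin_arctan, ← hs]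
    field_simp
  have hcosC : (Real.cos (theta μ β w) : ℂ) * (l - m) = 2 * c := by exact_mod_cast hcos
  have hsinC : (Real.sin (theta μ β w) : ℂ) * (l - m) = 2 * c * X := by exact_mod_cast hsin
  rw [hW, reflection]
  congr 1
  congr 1
  · congr 1
    · refine mul_left_cancel₀ hlm ?_
      linear_combination w00 - hsinC
    · congr 1
      refine mul_left_cancel₀ hlm ?_
      linear_combination 2 * w01 - hcosC - ((l : ℂ) - m) * g01
  · congr 1
    congr 1
    · refine mul_left_cancel₀ hlm ?_
      linear_combination 2 * w10 - hcosC - ((l : ℂ) - m) * g10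
    · congr 1
      refine mul_left_cancel₀ hlm ?_
      linear_combination -w00 + hsinC + ((l : ℂ) - m) * (hu - hv)

/-! ### The density of the phase-error operator -/

theorem projB_ket0_zero (v : Qubit) : projB ket0 v 0 = v 0 := by
  simp [projB, ket0, PiLp.inner_apply]

theorem projB_ket0_one (v : Qubit) : projB ket0 v 1 = 0 := by
  simp [projB, ket0]

theorem projB_ket1_zero (v : Qubit) : projB ket1 v 0 = 0 := by
  simp [projB, ket1]

theorem projB_ket1_one (v : Qubit) : projB ket1 v 1 = v 1 := by
  simp [projB, ket1, PiLp.inner_apply]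

theorem inner_ketM (v : Qubit) :
    ⟪(WithLp.toLp 2 ketM : Qubit), v⟫_ℂ = (Real.sqrt 2 : ℂ)⁻¹ * (v 0 - v 1) := by
  simp [ketM, PiLp.inner_apply]
  ring

theorem Ksuc_zero (f : ℝ → ℝ) (ω : ℂ) (ψ : Mode) :
    Ksuc f ω ψ 0 = (Real.sqrt (f ω.re / Real.pi) : ℂ) * ⟪coherent ω, ψ⟫_ℂ := by
  simp [Ksuc, ket0, ket1]

/-- The state |-ω⟩ is the parity image of |ω⟩, so every amplitude can be expressed through overlaps
with |ω⟩ alone. -/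
theorem Ksuc_one (f : ℝ → ℝ) (ω : ℂ) (ψ : Mode) :
    Ksuc f ω ψ 1 = (Real.sqrt (f ω.re / Real.pi) : ℂ) * ⟪coherent ω, parity ψ⟫_ℂ := by
  rw [← inner_parity_left, parity_coherent]
  simp [Ksuc, ket0, ket1]

/-- The effect |-⟩⟨-| on B has rank one, so the density is a sum, over the two components of A, of
products of scalar amplitudes. -/
theorem phForm_eq_sum (β : ℝ) (f : ℝ → ℝ) (up um : ℝ → Fin 2 → ℂ) (p : ℝ × ℝ) (Φ Ψ : WithA Mode) :
    phForm β f up um p Φ Ψ = ∑ i,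
      (starRingEnd ℂ) ⟪(WithLp.toLp 2 ketM : Qubit),
        (ctrlV β up um ⟨p.1, p.2⟩ ∘L tens 1 (Ksuc f ⟨p.1, p.2⟩)) Φ i⟫_ℂ *
      ⟪(WithLp.toLp 2 ketM : Qubit),
        (ctrlV β up um ⟨p.1, p.2⟩ ∘L tens 1 (Ksuc f ⟨p.1, p.2⟩)) Ψ i⟫_ℂ := by
  rw [phForm, phaseErrorDensity]
  generalize ctrlV β up um ⟨p.1, p.2⟩ ∘L tens 1 (Ksuc f ⟨p.1, p.2⟩) = L
  rw [ContinuousLinearMap.comp_apply,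
    ContinuousLinearMap.adjoint_inner_right, PiLp.inner_apply]
  refine Finset.sum_congr rfl fun i _ => ?_
  rw [ContinuousLinearMap.comp_apply, tens_apply]
  simp only [Matrix.one_apply, ite_smul, one_smul, zero_smul, Finset.sum_ite_eq, Finset.mem_univ,
    if_true]
  rw [projB, InnerProductSpace.rankOne_apply, inner_smul_right, inner_conj_symm, mul_comm]

/-- The bra ⟨-|_B takes the difference of the branches: control 0 contributes R†⟨ω|, control 1
contributes W R† X_A ⟨ω|P. -/
theorem inner_ketM_ctrlV {β : ℝ} {up um : ℝ → Fin 2 → ℂ} {ω : ℂ} {θ : ℝ} (f : ℝ → ℝ)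
    (hW : twistW up um ω.re = reflection θ) (Ψ : WithA Mode) :
    ⟪(WithLp.toLp 2 ketM : Qubit), (ctrlV β up um ω ∘L tens 1 (Ksuc f ω)) Ψ 0⟫_ℂ
      = (Real.sqrt 2 : ℂ)⁻¹ * (Real.sqrt (f ω.re / Real.pi) : ℂ) *
        (exp (I * β * ω.im) * ⟪coherent ω, Ψ 0⟫_ℂ
          - (Real.sin θ * exp (I * β * ω.im) * ⟪coherent ω, parity (Ψ 1)⟫_ℂ
            + Real.cos θ * exp (-(I * β * ω.im)) * ⟪coherent ω, parity (Ψ 0)⟫_ℂ)) ∧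
    ⟪(WithLp.toLp 2 ketM : Qubit), (ctrlV β up um ω ∘L tens 1 (Ksuc f ω)) Ψ 1⟫_ℂ
      = (Real.sqrt 2 : ℂ)⁻¹ * (Real.sqrt (f ω.re / Real.pi) : ℂ) *
        (exp (-(I * β * ω.im)) * ⟪coherent ω, Ψ 1⟫_ℂ
          - (Real.cos θ * exp (I * β * ω.im) * ⟪coherent ω, parity (Ψ 1)⟫_ℂ
            - Real.sin θ * exp (-(I * β * ω.im)) * ⟪coherent ω, parity (Ψ 0)⟫_ℂ)) := by
  have hR : (rotZ (2 * ω.im * β)).conjTranspose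
      = !![exp (I * β * ω.im), 0; 0, exp (-(I * β * ω.im))] := by
    ext i j
    fin_cases i <;> fin_cases j <;> 
      simp [rotZ, ← Complex.exp_conj, show (starRingEnd ℂ) 2 = 2 from map_ofNat _ 2] <;> ring_nf
  rw [ctrlV, hW, hR]
  simp only [inner_ketM, ContinuousLinearMap.comp_apply, add_apply, PiLp.add_apply, tens_apply,
    Fin.sum_univ_two, cX, pauliX, reflection, Matrix.mul_fin_two, Matrix.of_apply,
    Matrix.cons_val_zero, Matrix.cons_val_one, Matrix.cons_val', Matrix.cons_val_fin_one,
    PiLp.smul_apply, smul_eq_mul, projB_ket0_zero, projB_ket0_one, projB_ket1_zero,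
    projB_ket1_one, Matrix.one_apply, Ksuc_zero, Ksuc_one, one_smul, zero_smul]
  constructor
  · simp
    ring
  · simp
    ring

/-! ### The blocks in coherent-state form -/

/-- The odd-odd combination of a family of elementary forms. -/
def ooComb (F : (ℝ → ℝ) → ℝ → ℝ → ℝ × ℝ → Mode → Mode → ℂ) (μ β : ℝ) (f : ℝ → ℝ) (p : ℝ × ℝ)
    (φ ψ : Mode) : ℂ :=
  F f 0 0 p (odProj φ) (odProj ψ)
    + (F (fun w => f w * (Real.cos (theta μ β w) / 2)) 0 β p (odProj φ) (odProj ψ)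
      + F (fun w => f w * (Real.cos (theta μ β w) / 2)) β 0 p (odProj φ) (odProj ψ))

/-- The even-even combination of a family of elementary forms. -/
def eeComb (F : (ℝ → ℝ) → ℝ → ℝ → ℝ × ℝ → Mode → Mode → ℂ) (μ β : ℝ) (f : ℝ → ℝ) (p : ℝ × ℝ)
    (φ ψ : Mode) : ℂ :=
  F f 0 0 p (evProj φ) (evProj ψ)
    - (F (fun w => f w * (Real.cos (theta μ β w) / 2)) 0 β p (evProj φ) (evProj ψ)
      + F (fun w => f w * (Real.cos (theta μ β w) / 2)) β 0 p (evProj φ) (evProj ψ))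

/-- The odd-even combination of a family of elementary forms. -/
def oeComb (F : (ℝ → ℝ) → ℝ → ℝ → ℝ × ℝ → Mode → Mode → ℂ) (μ β : ℝ) (f : ℝ → ℝ) (s : ℝ)
    (p : ℝ × ℝ) (φ ψ : Mode) : ℂ :=
  (s : ℂ) * F (fun w => f w * Real.sin (theta μ β w)) 0 0 p (odProj φ) (evProj ψ)
    - (F (fun w => f w * (Real.cos (theta μ β w) / 2)) 0 β p (odProj φ) (evProj ψ)
      - F (fun w => f w * (Real.cos (theta μ β w) / 2)) β 0 p (odProj φ) (evProj ψ))

theorem ooForm_eq (μ β : ℝ) (f : ℝ → ℝ) (p : ℝ × ℝ) (φ ψ : Mode) :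
    ooForm μ β f p φ ψ = ooComb posForm μ β f p φ ψ := by
  simp only [ooForm, ooComb, posForm, sub_zero]
  push_cast
  ring

theorem eeForm_eq (μ β : ℝ) (f : ℝ → ℝ) (p : ℝ × ℝ) (φ ψ : Mode) :
    eeForm μ β f p φ ψ = eeComb posForm μ β f p φ ψ := by
  simp only [eeForm, eeComb, posForm, sub_zero]
  push_cast
  ring

theorem oeForm_eq (μ β : ℝ) (f : ℝ → ℝ) (s : ℝ) (p : ℝ × ℝ) (φ ψ : Mode) :
    oeForm μ β f s p φ ψ = oeComb posForm μ β f s p φ ψ := by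
  simp only [oeForm, oeComb, posForm, sub_zero]
  push_cast
  ring

@[fun_prop]
theorem measurable_theta (μ β : ℝ) : Measurable (theta μ β) := by
  unfold theta; fun_prop

/-! ### Existence of the block operators, in position and in coherent-state form -/

section Existence

variable {μ β : ℝ} {f : ℝ → ℝ}

theorem abs_mul_cos_le (hf1 : ∀ x, |f x| ≤ 1) (w : ℝ) :
    |f w * (Real.cos (theta μ β w) / 2)| ≤ 1 := by
  rw [abs_mul, abs_div, abs_two]
  have := Real.abs_cos_le_one (theta μ β w)
  nlinarith [hf1 w, abs_nonneg (f w), abs_nonneg (Real.cos (theta μ β w))]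

theorem abs_mul_sin_le (hf1 : ∀ x, |f x| ≤ 1) (w : ℝ) :
    |f w * Real.sin (theta μ β w)| ≤ 1 := by
  rw [abs_mul]
  exact mul_le_one₀ (hf1 w) (abs_nonneg _) (Real.abs_sin_le_one _)

theorem exists_hasWeakIntegral_oo (hf : Measurable f) (hf1 : ∀ x, |f x| ≤ 1) :
    ∃ M, HasWeakIntegral volume (ooForm μ β f) M ∧
      HasWeakIntegral volume (ooComb cohForm μ β f) M := by
  obtain ⟨A, hA, hA'⟩ := exists_hasWeakIntegral_posForm_cohForm hf hf1 0 0
  have hm : Measurable fun w => f w * (Real.cos (theta μ β w) / 2) := by fun_prop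
  obtain ⟨B, hB, hB'⟩ := exists_hasWeakIntegral_posForm_cohForm hm (abs_mul_cos_le hf1) 0 β
  obtain ⟨C, hC, hC'⟩ := exists_hasWeakIntegral_posForm_cohForm hm (abs_mul_cos_le hf1) β 0
  exact ⟨_, (((hA.comp odProj odProj).add
      ((hB.comp odProj odProj).add (hC.comp odProj odProj)))).congr (ooForm_eq μ β f),
    (hA'.comp odProj odProj).add ((hB'.comp odProj odProj).add (hC'.comp odProj odProj))⟩

theorem exists_hasWeakIntegral_ee (hf : Measurable f) (hf1 : ∀ x, |f x| ≤ 1) :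
    ∃ M, HasWeakIntegral volume (eeForm μ β f) M ∧
      HasWeakIntegral volume (eeComb cohForm μ β f) M := by
  obtain ⟨A, hA, hA'⟩ := exists_hasWeakIntegral_posForm_cohForm hf hf1 0 0
  have hm : Measurable fun w => f w * (Real.cos (theta μ β w) / 2) := by fun_prop
  obtain ⟨B, hB, hB'⟩ := exists_hasWeakIntegral_posForm_cohForm hm (abs_mul_cos_le hf1) 0 β
  obtain ⟨C, hC, hC'⟩ := exists_hasWeakIntegral_posForm_cohForm hm (abs_mul_cos_le hf1) β 0
  exact ⟨_, (((hA.comp evProj evProj).sub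
      ((hB.comp evProj evProj).add (hC.comp evProj evProj)))).congr (eeForm_eq μ β f),
    (hA'.comp evProj evProj).sub ((hB'.comp evProj evProj).add (hC'.comp evProj evProj))⟩

theorem exists_hasWeakIntegral_oe (hf : Measurable f) (hf1 : ∀ x, |f x| ≤ 1) (s : ℝ) :
    ∃ M, HasWeakIntegral volume (oeForm μ β f s) M ∧
      HasWeakIntegral volume (oeComb cohForm μ β f s) M := by
  have hs : Measurable fun w => f w * Real.sin (theta μ β w) := by fun_prop
  obtain ⟨A, hA, hA'⟩ := exists_hasWeakIntegral_posForm_cohForm hs (abs_mul_sin_le hf1) 0 0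
  have hm : Measurable fun w => f w * (Real.cos (theta μ β w) / 2) := by fun_prop
  obtain ⟨B, hB, hB'⟩ := exists_hasWeakIntegral_posForm_cohForm hm (abs_mul_cos_le hf1) 0 β
  obtain ⟨C, hC, hC'⟩ := exists_hasWeakIntegral_posForm_cohForm hm (abs_mul_cos_le hf1) β 0
  exact ⟨_, ((((hA.comp odProj evProj).const_mul s).sub
      ((hB.comp odProj evProj).sub (hC.comp odProj evProj)))).congr (oeForm_eq μ β f s),
    ((hA'.comp odProj evProj).const_mul s).sub
      ((hB'.comp odProj evProj).sub (hC'.comp odProj evProj))⟩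

theorem hasWeakIntegral_Moo (hf : Measurable f) (hf1 : ∀ x, |f x| ≤ 1) :
    HasWeakIntegral volume (ooForm μ β f) (Moo μ β f) ∧
      HasWeakIntegral volume (ooComb cohForm μ β f) (Moo μ β f) := by
  obtain ⟨M, h, h'⟩ := exists_hasWeakIntegral_oo (μ := μ) (β := β) hf hf1
  rw [Moo, h.weakIntegral_eq]
  exact ⟨h, h'⟩

theorem hasWeakIntegral_Mee (hf : Measurable f) (hf1 : ∀ x, |f x| ≤ 1) :
    HasWeakIntegral volume (eeForm μ β f) (Mee μ β f) ∧
      HasWeakIntegral volume (eeComb cohForm μ β f) (Mee μ β f) := by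
  obtain ⟨M, h, h'⟩ := exists_hasWeakIntegral_ee (μ := μ) (β := β) hf hf1
  rw [Mee, h.weakIntegral_eq]
  exact ⟨h, h'⟩

theorem hasWeakIntegral_Moe (hf : Measurable f) (hf1 : ∀ x, |f x| ≤ 1) (s : ℝ) :
    HasWeakIntegral volume (oeForm μ β f s) (Moe μ β f s) ∧
      HasWeakIntegral volume (oeComb cohForm μ β f s) (Moe μ β f s) := by
  obtain ⟨M, h, h'⟩ := exists_hasWeakIntegral_oe (μ := μ) (β := β) hf hf1 s
  rw [Moe, h.weakIntegral_eq]
  exact ⟨h, h'⟩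

end Existence

/-- The shifts by β in position have become the phases e^{±2iβt}, written as squares of the entries
of R† so that they match the amplitudes of the phase-error density. -/
theorem ooComb_cohForm (μ β : ℝ) (f : ℝ → ℝ) (w t : ℝ) (φ ψ : Mode) :
    ooComb cohForm μ β f (w, t) φ ψ = (f w / Real.pi : ℂ) *
      (1 + Real.cos (theta μ β w) / 2 * (exp (-(I * β * t)) ^ 2 + exp (I * β * t) ^ 2)) *
      (⟪odProj φ, coherent ⟨w, t⟩⟫_ℂ * ⟪coherent ⟨w, t⟩, odProj ψ⟫_ℂ) := by
  have e0 : exp (2 * I * (((0 : ℝ) : ℂ) - ((0 : ℝ) : ℂ)) * t) = 1 := by simp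
  have e1 : exp (2 * I * (((0 : ℝ) : ℂ) - β) * t) = exp (-(I * β * t)) ^ 2 := by
    rw [← Complex.exp_nat_mul]; congr 1; push_cast; ring
  have e2 : exp (2 * I * ((β : ℂ) - ((0 : ℝ) : ℂ)) * t) = exp (I * β * t) ^ 2 := by
    rw [← Complex.exp_nat_mul]; congr 1; push_cast; ring
  simp only [ooComb, cohForm, e0, e1, e2]
  push_cast
  ring

theorem eeComb_cohForm (μ β : ℝ) (f : ℝ → ℝ) (w t : ℝ) (φ ψ : Mode) :
    eeComb cohForm μ β f (w, t) φ ψ = (f w / Real.pi : ℂ) *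
      (1 - Real.cos (theta μ β w) / 2 * (exp (-(I * β * t)) ^ 2 + exp (I * β * t) ^ 2)) *
      (⟪evProj φ, coherent ⟨w, t⟩⟫_ℂ * ⟪coherent ⟨w, t⟩, evProj ψ⟫_ℂ) := by
  have e0 : exp (2 * I * (((0 : ℝ) : ℂ) - ((0 : ℝ) : ℂ)) * t) = 1 := by simp
  have e1 : exp (2 * I * (((0 : ℝ) : ℂ) - β) * t) = exp (-(I * β * t)) ^ 2 := by
    rw [← Complex.exp_nat_mul]; congr 1; push_cast; ring
  have e2 : exp (2 * I * ((β : ℂ) - ((0 : ℝ) : ℂ)) * t) = exp (I * β * t) ^ 2 := by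
    rw [← Complex.exp_nat_mul]; congr 1; push_cast; ring
  simp only [eeComb, cohForm, e0, e1, e2]
  push_cast
  ring

theorem oeComb_cohForm (μ β : ℝ) (f : ℝ → ℝ) (s : ℝ) (w t : ℝ) (φ ψ : Mode) :
    oeComb cohForm μ β f s (w, t) φ ψ = (f w / Real.pi : ℂ) *
      (s * Real.sin (theta μ β w)
        - Real.cos (theta μ β w) / 2 * (exp (-(I * β * t)) ^ 2 - exp (I * β * t) ^ 2)) *
      (⟪odProj φ, coherent ⟨w, t⟩⟫_ℂ * ⟪coherent ⟨w, t⟩, evProj ψ⟫_ℂ) := by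
  have e0 : exp (2 * I * (((0 : ℝ) : ℂ) - ((0 : ℝ) : ℂ)) * t) = 1 := by simp
  have e1 : exp (2 * I * (((0 : ℝ) : ℂ) - β) * t) = exp (-(I * β * t)) ^ 2 := by
    rw [← Complex.exp_nat_mul]; congr 1; push_cast; ring
  have e2 : exp (2 * I * ((β : ℂ) - ((0 : ℝ) : ℂ)) * t) = exp (I * β * t) ^ 2 := by
    rw [← Complex.exp_nat_mul]; congr 1; push_cast; ring
  simp only [oeComb, cohForm, e0, e1, e2]
  push_cast
  ring

/-- The map `|0⟩⊗ψ₀ + |1⟩⊗ψ₁ ↦ (ψ₀ + s ψ₁)/√2`, that is `⟨+|_A` for `s = 1` and `⟨-|_A` for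
`s = -1`. -/
def braA (s : ℝ) : WithA Mode →L[ℂ] Mode :=
  (Real.sqrt 2 : ℂ)⁻¹ • (PiLp.proj 2 (fun _ : Fin 2 => Mode) 0
    + (s : ℂ) • PiLp.proj 2 (fun _ : Fin 2 => Mode) 1)

theorem braA_apply (s : ℝ) (Ψ : WithA Mode) :
    braA s Ψ = (Real.sqrt 2 : ℂ)⁻¹ • (Ψ 0 + (s : ℂ) • Ψ 1) := rfl

/-- The matrix element of the two-by-two block operator of one sector. -/
def sectorForm (μ β : ℝ) (f : ℝ → ℝ) (s : ℝ) (p : ℝ × ℝ) (Φ Ψ : WithA Mode) : ℂ :=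
  (ooComb cohForm μ β f p (braA s Φ) (braA s Ψ) + eeComb cohForm μ β f p (braA (-s) Φ) (braA (-s) Ψ))
    + (oeComb cohForm μ β f s p (braA s Φ) (braA (-s) Ψ)
      + (starRingEnd ℂ) (oeComb cohForm μ β f s p (braA s Ψ) (braA (-s) Φ)))

/-- At each ω the density commutes with X_A ⊗ P, so the two sectors do not mix. In terms of the
overlaps of |ω⟩ with Ψ₀, Ψ₁ and their parity images this is a polynomial identity modulo sin²θ +
cos²θ = 1, e^{iβt}e^{-iβt} = 1 and (1/√2)² = 1/2. -/
theorem phForm_eq_sectorForm {μ β : ℝ} {f : ℝ → ℝ} {up um : ℝ → Fin 2 → ℂ} (hf0 : ∀ x, 0 ≤ f x)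
    (hW : ∀ w, twistW up um w = reflection (theta μ β w)) (p : ℝ × ℝ) (Φ Ψ : WithA Mode) :
    phForm β f up um p Φ Ψ = sectorForm μ β f 1 p Φ Ψ + sectorForm μ β f (-1) p Φ Ψ := by
  obtain ⟨w, t⟩ := p
  have hcE : (starRingEnd ℂ) (exp (I * β * t)) = exp (-(I * β * t)) := by
    rw [← Complex.exp_conj]; simp
  have hcF : (starRingEnd ℂ) (exp (-(I * β * t))) = exp (I * β * t) := by
    rw [← Complex.exp_conj]; simp
  have hEF : exp (I * β * t) * exp (-(I * β * t)) = 1 := by rw [← Complex.exp_add]; simp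
  have hsc : (Real.sin (theta μ β w) : ℂ) ^ 2 + (Real.cos (theta μ β w) : ℂ) ^ 2 = 1 := by
    exact_mod_cast Real.sin_sq_add_cos_sq (theta μ β w)
  have hf2 : (Real.sqrt (f w / Real.pi) : ℂ) * Real.sqrt (f w / Real.pi) = f w / Real.pi := by
    exact_mod_cast Real.mul_self_sqrt (div_nonneg (hf0 w) Real.pi_pos.le)
  have h2 := inv_sqrt_two_mul_self
  rw [phForm_eq_sum, Fin.sum_univ_two]
  obtain ⟨h0, h1⟩ := inner_ketM_ctrlV (β := β) (ω := ⟨w, t⟩) f (hW w) Φ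
  obtain ⟨k0, k1⟩ := inner_ketM_ctrlV (β := β) (ω := ⟨w, t⟩) f (hW w) Ψ
  simp only at h0 h1 k0 k1 ⊢
  rw [h0, h1, k0, k1]
  simp only [sectorForm, ooComb_cohForm, eeComb_cohForm, oeComb_cohForm, evProj_apply, odProj_apply,
    braA_apply, inner_smul_left, inner_smul_right, inner_add_left, inner_add_right, inner_sub_left,
    inner_sub_right, map_smul, map_add, map_mul, map_sub, map_inv₀, map_ofNat, map_div₀, map_pow,
    map_neg, map_one, Complex.conj_ofReal, hcE, hcF, inner_conj_symm, Complex.ofReal_neg,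
    Complex.ofReal_one, one_mul, neg_neg]
  generalize exp (I * β * t) = E at *
  generalize exp (-(I * β * t)) = F at *
  generalize (Real.sin (theta μ β w) : ℂ) = S at *
  generalize (Real.cos (theta μ β w) : ℂ) = C at *
  generalize (f w : ℂ) / (Real.pi : ℂ) = r at *
  generalize (Real.sqrt (f w / Real.pi) : ℂ) = q at *
  generalize (Real.sqrt 2 : ℂ)⁻¹ = d at *
  generalize ⟪coherent ⟨w, t⟩, Ψ 0⟫_ℂ = a0
  generalize ⟪coherent ⟨w, t⟩, Ψ 1⟫_ℂ = a1
  generalize ⟪coherent ⟨w, t⟩, parity (Ψ 0)⟫_ℂ = A0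
  generalize ⟪coherent ⟨w, t⟩, parity (Ψ 1)⟫_ℂ = A1
  generalize ⟪Φ 0, coherent ⟨w, t⟩⟫_ℂ = b0
  generalize ⟪Φ 1, coherent ⟨w, t⟩⟫_ℂ = b1
  generalize ⟪parity (Φ 0), coherent ⟨w, t⟩⟫_ℂ = B0
  generalize ⟪parity (Φ 1), coherent ⟨w, t⟩⟫_ℂ = B1
  have hL : ∀ x y x' y' : ℂ, d * q * x * (d * q * y) + d * q * x' * (d * q * y')
      = r * 2⁻¹ * (x * y + x' * y') := by
    intro x y x' y'
    rw [← hf2, ← h2]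
    ring
  rw [hL]
  linear_combination (r * 2⁻¹ * (a0 * b0 + a1 * b1
      - S * (a0 * B1 + A1 * b0 - a1 * B0 - A0 * b1) + (S ^ 2 + C ^ 2) * (A1 * B1 + A0 * B0))) * hEF
    + (r * 2⁻¹ * (A1 * B1 + A0 * B0)) * hsc
    - (r * (a0 * b0 + a1 * b1 - S * (a0 * B1 + A1 * b0 - a1 * B0 - A0 * b1) + (A1 * B1 + A0 * B0)
      - C * (F ^ 2 * (b0 * A0 + B1 * a1) + E ^ 2 * (B0 * a0 + A1 * b1)))) * h2

/-! ### Decomposition of the phase-error operator and the bound on each sector -/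

/-- The operator of one sector, acting on `ℂ² ⊗ L²`. -/
def sectorOp (μ β : ℝ) (f : ℝ → ℝ) (s : ℝ) : WithA Mode →L[ℂ] WithA Mode :=
  (ContinuousLinearMap.adjoint (braA s) ∘L Moo μ β f ∘L braA s
      + ContinuousLinearMap.adjoint (braA (-s)) ∘L Mee μ β f ∘L braA (-s))
    + (ContinuousLinearMap.adjoint (braA s) ∘L Moe μ β f s ∘L braA (-s)
      + ContinuousLinearMap.adjoint
        (ContinuousLinearMap.adjoint (braA s) ∘L Moe μ β f s ∘L braA (-s)))

theorem hasWeakIntegral_sectorForm {μ β : ℝ} {f : ℝ → ℝ} (hf : Measurable f)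
    (hf1 : ∀ x, |f x| ≤ 1) (s : ℝ) :
    HasWeakIntegral volume (sectorForm μ β f s) (sectorOp μ β f s) := by
  have h1 := (hasWeakIntegral_Moo (μ := μ) (β := β) hf hf1).2.comp (braA s) (braA s)
  have h2 := (hasWeakIntegral_Mee (μ := μ) (β := β) hf hf1).2.comp (braA (-s)) (braA (-s))
  have h3 := (hasWeakIntegral_Moe (μ := μ) (β := β) hf hf1 s).2.comp (braA s) (braA (-s))
  exact (h1.add h2).add (h3.add h3.adjoint)

theorem hasWeakIntegral_phForm {μ β : ℝ} {f : ℝ → ℝ} {up um : ℝ → Fin 2 → ℂ} (hf : Measurable f)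
    (hf0 : ∀ x, 0 ≤ f x) (hf1 : ∀ x, |f x| ≤ 1)
    (hW : ∀ w, twistW up um w = reflection (theta μ β w)) :
    HasWeakIntegral volume (phForm β f up um) (sectorOp μ β f 1 + sectorOp μ β f (-1)) :=
  ((hasWeakIntegral_sectorForm hf hf1 1).add (hasWeakIntegral_sectorForm hf hf1 (-1))).congr
    fun p Φ Ψ => phForm_eq_sectorForm hf0 hW p Φ Ψ

/-- The quadratic form of one sector on a pair (odd part, even part). -/
def sectorQuad (μ β : ℝ) (f : ℝ → ℝ) (s : ℝ) (φ ψ : Mode) : ℝ :=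
  (⟪φ, Moo μ β f φ⟫_ℂ).re + (⟪ψ, Mee μ β f ψ⟫_ℂ).re + 2 * (⟪φ, Moe μ β f s ψ⟫_ℂ).re

/-- The form with diagonal 1 ± a and off-diagonal entry z has determinant 0, so the inequality of
arithmetic and geometric means applied to √(1+a)‖x‖ and √(1-a)‖y‖ bounds the cross term exactly. -/
theorem two_re_le {a : ℝ} (ha : |a| ≤ 1) {z x y : ℂ} (hz : ‖z‖ ^ 2 = 1 - a ^ 2) :
    |2 * (z * ((starRingEnd ℂ) x * y)).re| ≤ (1 + a) * ‖x‖ ^ 2 + (1 - a) * ‖y‖ ^ 2 := by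
  obtain ⟨h1, h2⟩ := abs_le.1 ha
  have e1 : ‖z‖ = Real.sqrt (1 + a) * Real.sqrt (1 - a) := by
    rw [← Real.sqrt_mul (by linarith), ← Real.sqrt_sq (norm_nonneg z), hz]
    congr 1
    ring
  have e2 : |2 * (z * ((starRingEnd ℂ) x * y)).re| ≤ 2 * (‖z‖ * (‖x‖ * ‖y‖)) := by
    rw [abs_mul, abs_two]
    refine mul_le_mul_of_nonneg_left ((Complex.abs_re_le_norm _).trans ?_) (by norm_num)
    rw [norm_mul, norm_mul, RCLike.norm_conj]
  have e3 := Real.sq_sqrt (show 0 ≤ 1 + a by linarith)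
  have e4 := Real.sq_sqrt (show 0 ≤ 1 - a by linarith)
  rw [e1] at e2
  refine e2.trans ?_
  nlinarith [sq_nonneg (Real.sqrt (1 + a) * ‖x‖ - Real.sqrt (1 - a) * ‖y‖)]

/-- The integrand of `sectorQuad`, up to the factor `f(w)/π`. -/
def sectorDensity (μ β s : ℝ) (φ ψ : Mode) (p : ℝ × ℝ) : ℝ :=
  (1 + Real.cos (theta μ β p.1) * Real.cos (2 * β * p.2))
      * ‖⟪coherent ⟨p.1, p.2⟩, odProj φ⟫_ℂ‖ ^ 2
    + (1 - Real.cos (theta μ β p.1) * Real.cos (2 * β * p.2))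
      * ‖⟪coherent ⟨p.1, p.2⟩, evProj ψ⟫_ℂ‖ ^ 2
    + 2 * ((s * Real.sin (theta μ β p.1) + Real.cos (theta μ β p.1) * Real.sin (2 * β * p.2) * I)
      * ((starRingEnd ℂ) ⟪coherent ⟨p.1, p.2⟩, odProj φ⟫_ℂ
        * ⟪coherent ⟨p.1, p.2⟩, evProj ψ⟫_ℂ)).re

/-- The off-diagonal entry satisfies |z|² = sin²θ + cos²θ sin²(2βt) = 1 - cos²θ cos²(2βt). Thus
`two_re_le` with a = cos θ cos(2βt) gives positivity, and with -a the upper bound 2. -/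
theorem sectorDensity_bounds {μ β s : ℝ} (hs : s ^ 2 = 1) (φ ψ : Mode) (p : ℝ × ℝ) :
    0 ≤ sectorDensity μ β s φ ψ p ∧ sectorDensity μ β s φ ψ p ≤
      2 * (‖⟪coherent ⟨p.1, p.2⟩, odProj φ⟫_ℂ‖ ^ 2 + ‖⟪coherent ⟨p.1, p.2⟩, evProj ψ⟫_ℂ‖ ^ 2) := by
  unfold sectorDensity
  set c := Real.cos (theta μ β p.1) with hc
  set k := Real.cos (2 * β * p.2) with hk
  set z : ℂ := s * Real.sin (theta μ β p.1) + c * Real.sin (2 * β * p.2) * I with hz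
  have hz2 : ‖z‖ ^ 2 = 1 - (c * k) ^ 2 := by
    have e : z = ((s * Real.sin (theta μ β p.1) : ℝ) : ℂ)
        + ((c * Real.sin (2 * β * p.2) : ℝ) : ℂ) * I := by rw [hz]; push_cast; ring
    rw [e, ← Complex.normSq_eq_norm_sq, Complex.normSq_add_mul_I, mul_pow, mul_pow, hs,
      Real.sin_sq, Real.sin_sq, ← hc, ← hk]
    ring
  have hck : |c * k| ≤ 1 := by
    rw [abs_mul]
    exact mul_le_one₀ (Real.abs_cos_le_one _) (abs_nonneg _) (Real.abs_cos_le_one _)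
  have h1 := (abs_le.1 (two_re_le hck (x := ⟪coherent ⟨p.1, p.2⟩, odProj φ⟫_ℂ)
    (y := ⟪coherent ⟨p.1, p.2⟩, evProj ψ⟫_ℂ) hz2)).1
  have h2 := (abs_le.1 (two_re_le (a := -(c * k)) (by rwa [abs_neg])
    (x := ⟪coherent ⟨p.1, p.2⟩, odProj φ⟫_ℂ) (y := ⟪coherent ⟨p.1, p.2⟩, evProj ψ⟫_ℂ)
    (by rwa [neg_sq]))).2
  constructor <;> linarith

theorem parity_odProj (φ : Mode) : parity (odProj φ) = -odProj φ := by
  rw [odProj_apply, map_smul, map_sub, parity_parity, ← smul_neg, neg_sub]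

theorem parity_evProj (φ : Mode) : parity (evProj φ) = evProj φ := by
  rw [evProj_apply, map_smul, map_add, parity_parity, add_comm]

theorem theta_neg (μ β w : ℝ) : theta μ β (-w) = -theta μ β w := by
  rw [theta, theta, ← Real.arctan_neg, ← mul_neg, ← Real.sinh_neg]
  congr 3
  ring

/-- The angle θ is odd in w, so z changes sign under ω ↦ -ω; so does the overlap with the odd
vector, and the two signs cancel. -/
theorem sectorDensity_neg (μ β s : ℝ) (φ ψ : Mode) (p : ℝ × ℝ) :
    sectorDensity μ β s φ ψ (-p) = sectorDensity μ β s φ ψ p := by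
  have hω : (⟨-p.1, -p.2⟩ : ℂ) = -⟨p.1, p.2⟩ := rfl
  have h1 : ⟪coherent ⟨-p.1, -p.2⟩, odProj φ⟫_ℂ = -⟪coherent ⟨p.1, p.2⟩, odProj φ⟫_ℂ := by
    rw [hω, ← parity_coherent, inner_parity_left, parity_odProj, inner_neg_right]
  have h2 : ⟪coherent ⟨-p.1, -p.2⟩, evProj ψ⟫_ℂ = ⟪coherent ⟨p.1, p.2⟩, evProj ψ⟫_ℂ := by
    rw [hω, ← parity_coherent, inner_parity_left, parity_evProj]
  simp only [sectorDensity, Prod.fst_neg, Prod.snd_neg, theta_neg, Real.cos_neg, Real.sin_neg,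
    mul_neg, h1, h2, norm_neg, map_neg]
  congr 3
  push_cast
  ring

theorem norm_odProj_le (φ : Mode) : ‖odProj φ‖ ≤ ‖φ‖ := Submodule.norm_starProjection_apply_le _ φ

theorem norm_evProj_le (φ : Mode) : ‖evProj φ‖ ≤ ‖φ‖ := Submodule.norm_starProjection_apply_le _ φ

theorem integral_sectorDensity {μ β : ℝ} {f : ℝ → ℝ} (hf : Measurable f) (hf1 : ∀ x, |f x| ≤ 1)
    (s : ℝ) (φ ψ : Mode) :
    Integrable (fun p : ℝ × ℝ => f p.1 / Real.pi * sectorDensity μ β s φ ψ p) ∧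
      sectorQuad μ β f s φ ψ = ∫ p : ℝ × ℝ, f p.1 / Real.pi * sectorDensity μ β s φ ψ p := by
  obtain ⟨i1, e1⟩ := (hasWeakIntegral_Moo (μ := μ) (β := β) hf hf1).2 φ φ
  obtain ⟨i2, e2⟩ := (hasWeakIntegral_Mee (μ := μ) (β := β) hf hf1).2 ψ ψ
  obtain ⟨i3, e3⟩ := (hasWeakIntegral_Moe (μ := μ) (β := β) hf hf1 s).2 φ ψ
  have key : ∀ p : ℝ × ℝ, f p.1 / Real.pi * sectorDensity μ β s φ ψ p
      = (ooComb cohForm μ β f p φ φ).re + (eeComb cohForm μ β f p ψ ψ).re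
        + 2 * (oeComb cohForm μ β f s p φ ψ).re := by
    rintro ⟨w, t⟩
    have hE : exp (I * β * t) ^ 2 = ((Real.cos (2 * β * t) : ℝ) : ℂ)
        + ((Real.sin (2 * β * t) : ℝ) : ℂ) * I := by
      rw [← Complex.exp_nat_mul, Complex.ofReal_cos, Complex.ofReal_sin, ← Complex.exp_mul_I]
      congr 1; push_cast; ring
    have hF : exp (-(I * β * t)) ^ 2 = ((Real.cos (2 * β * t) : ℝ) : ℂ)
        - ((Real.sin (2 * β * t) : ℝ) : ℂ) * I := by
      have h := congrArg (starRingEnd ℂ) hE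
      simp only [map_pow, map_add, map_mul, Complex.conj_ofReal, Complex.conj_I,
        ← Complex.exp_conj] at h
      rw [show -(I * (β : ℂ) * t) = -I * β * t by ring, h]
      ring
    rw [ooComb_cohForm, eeComb_cohForm, oeComb_cohForm, hE, hF, sectorDensity]
    simp only
    rw [← inner_conj_symm (odProj φ) (coherent ⟨w, t⟩), ← inner_conj_symm (evProj ψ) (coherent ⟨w, t⟩),
      ← Complex.normSq_eq_conj_mul_self, ← Complex.normSq_eq_conj_mul_self,
      Complex.normSq_eq_norm_sq, Complex.normSq_eq_norm_sq]
    generalize (starRingEnd ℂ) ⟪coherent ⟨w, t⟩, odProj φ⟫_ℂ * ⟪coherent ⟨w, t⟩, evProj ψ⟫_ℂ = z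
    generalize ‖⟪coherent ⟨w, t⟩, odProj φ⟫_ℂ‖ ^ 2 = X
    generalize ‖⟪coherent ⟨w, t⟩, evProj ψ⟫_ℂ‖ ^ 2 = Y
    generalize Real.cos (theta μ β w) = c
    generalize Real.sin (theta μ β w) = d
    generalize Real.cos (2 * β * t) = k
    generalize Real.sin (2 * β * t) = m
    rw [show ((f w : ℂ) / (Real.pi : ℂ)) = ((f w / Real.pi : ℝ) : ℂ) by push_cast; rfl]
    generalize f w / Real.pi = r
    simp [Complex.mul_re, Complex.mul_im]
    ring
  have j1 : Integrable fun p => (ooComb cohForm μ β f p φ φ).re := i1.re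
  have j2 : Integrable fun p => (eeComb cohForm μ β f p ψ ψ).re := i2.re
  have j3 : Integrable fun p => 2 * (oeComb cohForm μ β f s p φ ψ).re := i3.re.const_mul 2
  have r1 : ∫ p, (ooComb cohForm μ β f p φ φ).re = (∫ p, ooComb cohForm μ β f p φ φ).re :=
    integral_re i1
  have r2 : ∫ p, (eeComb cohForm μ β f p ψ ψ).re = (∫ p, eeComb cohForm μ β f p ψ ψ).re :=
    integral_re i2
  have r3 : ∫ p, (oeComb cohForm μ β f s p φ ψ).re = (∫ p, oeComb cohForm μ β f s p φ ψ).re :=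
    integral_re i3
  simp_rw [key]
  refine ⟨(j1.add j2).add j3, ?_⟩
  have j12 : Integrable fun p => (ooComb cohForm μ β f p φ φ).re
    + (eeComb cohForm μ β f p ψ ψ).re := j1.add j2
  rw [integral_add j12 j3, integral_add j1 j2, integral_const_mul, r1, r2, r3, ← e1,
    ← e2, ← e3, sectorQuad]

/-- Averaging over ω and -ω replaces f(w) by (f(w) + f(-w))/2 ≤ 1/2, which compensates the
eigenvalue 2 of the density; the resolution of the identity does the rest. -/
theorem sectorQuad_le {μ β : ℝ} {f : ℝ → ℝ} (hf : Measurable f) (hf1 : ∀ x, |f x| ≤ 1)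
    (hfs : ∀ x, f x + f (-x) ≤ 1) {s : ℝ} (hs : s ^ 2 = 1) (φ ψ : Mode) :
    sectorQuad μ β f s φ ψ ≤ ‖φ‖ ^ 2 + ‖ψ‖ ^ 2 := by
  obtain ⟨hi, he⟩ := integral_sectorDensity (μ := μ) (β := β) hf hf1 s φ ψ
  have hi' := hi.comp_neg
  have he' := integral_neg_eq_self
    (fun p : ℝ × ℝ => f p.1 / Real.pi * sectorDensity μ β s φ ψ p) volume
  simp only [sectorDensity_neg, Prod.fst_neg] at hi' he'
  have h2 : 2 * sectorQuad μ β f s φ ψ = ∫ p : ℝ × ℝ, (f p.1 / Real.pi * sectorDensity μ β s φ ψ p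
      + f (-p.1) / Real.pi * sectorDensity μ β s φ ψ p) := by
    rw [integral_add hi hi', he', ← he]; ring
  have hb : 2 * sectorQuad μ β f s φ ψ ≤ ∫ p : ℝ × ℝ, Real.pi⁻¹ * 2 *
      (‖⟪coherent ⟨p.1, p.2⟩, odProj φ⟫_ℂ‖ ^ 2 + ‖⟪coherent ⟨p.1, p.2⟩, evProj ψ⟫_ℂ‖ ^ 2) := by
    rw [h2]
    refine integral_mono (hi.add hi') (((integrable_norm_sq_inner_coherent _).add
      (integrable_norm_sq_inner_coherent _)).const_mul _) fun p => ?_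
    obtain ⟨h0, h1⟩ := sectorDensity_bounds (μ := μ) (β := β) hs φ ψ p
    -- Positivity of the density is needed here: only then may f(w) + f(-w) be replaced by 1.
    have hpi : 0 < Real.pi⁻¹ := inv_pos.2 Real.pi_pos
    calc _ = Real.pi⁻¹ * ((f p.1 + f (-p.1)) * sectorDensity μ β s φ ψ p) := by
          ring
      _ ≤ Real.pi⁻¹ * (1 * sectorDensity μ β s φ ψ p) := by
          gcongr
          exact hfs _
      _ ≤ _ := by
          rw [one_mul, mul_assoc]
          gcongr
  rw [integral_const_mul, integral_add (integrable_norm_sq_inner_coherent _)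
    (integrable_norm_sq_inner_coherent _), integral_norm_sq_inner_coherent,
    integral_norm_sq_inner_coherent] at hb
  have hpi := Real.pi_ne_zero
  have e : Real.pi⁻¹ * 2 * (Real.pi * ‖odProj φ‖ ^ 2 + Real.pi * ‖evProj ψ‖ ^ 2)
      = 2 * (‖odProj φ‖ ^ 2 + ‖evProj ψ‖ ^ 2) := by field_simp
  rw [e] at hb
  have h3 := pow_le_pow_left₀ (norm_nonneg _) (norm_odProj_le φ) 2
  have h4 := pow_le_pow_left₀ (norm_nonneg _) (norm_evProj_le ψ) 2
  linarith

/-! ### The largest eigenvalue of a Hermitian matrix -/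

section SigmaSup

variable {n : Type*} [Fintype n] [DecidableEq n] {A : Matrix n n ℂ}

-- The spectrum of `sigmaSup A` · 1 - `A` is the reflected and shifted spectrum of `A`, hence
-- nonnegative, so this difference is positive semidefinite.
open ComplexOrder in
theorem re_dotProduct_le_sigmaSup (hA : A.IsHermitian) (z : n → ℂ) :
    (star z ⬝ᵥ A.mulVec z).re ≤ sigmaSup A * ∑ i, ‖z i‖ ^ 2 := by
  have hbdd : BddAbove (spectrum ℝ A) := by
    rw [hA.spectrum_real_eq_range_eigenvalues]
    exact (Set.finite_range _).bddAbove
  set c := sigmaSup A with hc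
  have hB : (algebraMap ℝ (Matrix n n ℂ) c - A).IsHermitian := by
    refine Matrix.IsHermitian.sub ?_ hA
    rw [Matrix.algebraMap_eq_diagonal]
    refine Matrix.isHermitian_diagonal_of_self_adjoint _ ?_
    ext i
    simp
  have hpos : (algebraMap ℝ (Matrix n n ℂ) c - A).PosSemidef := by
    rw [hB.posSemidef_iff_eigenvalues_nonneg]
    intro i
    have hi : hB.eigenvalues i ∈ spectrum ℝ (algebraMap ℝ (Matrix n n ℂ) c - A) := by
      rw [hB.spectrum_real_eq_range_eigenvalues]
      exact ⟨i, rfl⟩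
    rw [← spectrum.singleton_sub_eq] at hi
    obtain ⟨_, rfl, x, hx, h⟩ := hi
    have := le_csSup hbdd hx
    rw [← h]
    simp only [Pi.zero_apply, sub_nonneg]
    exact this
  have h := hpos.re_dotProduct_nonneg z
  have e : star z ⬝ᵥ (algebraMap ℝ (Matrix n n ℂ) c - A).mulVec z
      = ((c * ∑ i, ‖z i‖ ^ 2 : ℝ) : ℂ) - star z ⬝ᵥ A.mulVec z := by
    rw [Matrix.sub_mulVec, dotProduct_sub]
    congr 1
    rw [Algebra.algebraMap_eq_smul_one, Matrix.smul_mulVec, Matrix.one_mulVec, dotProduct_smul]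
    simp only [dotProduct, Pi.star_apply, RCLike.star_def, ← Complex.normSq_eq_conj_mul_self,
      Complex.normSq_eq_norm_sq]
    push_cast
    rfl
  rw [e] at h
  simp only [RCLike.re_to_complex, Complex.sub_re, Complex.ofReal_re] at h
  linarith

/-- Every spectral value is the Rayleigh quotient of a unit eigenvector. -/
theorem sigmaSup_le [Nonempty n] (hA : A.IsHermitian) {m : ℝ}
    (h : ∀ z : n → ℂ, (star z ⬝ᵥ A.mulVec z).re ≤ m * ∑ i, ‖z i‖ ^ 2) : sigmaSup A ≤ m := by
  rw [sigmaSup, hA.spectrum_real_eq_range_eigenvalues]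
  refine csSup_le (Set.range_nonempty _) ?_
  rintro _ ⟨i, rfl⟩
  have h1 := h (hA.eigenvectorBasis i).ofLp
  have hn : ∑ j, ‖(hA.eigenvectorBasis i).ofLp j‖ ^ 2 = 1 := by
    rw [← EuclideanSpace.norm_sq_eq, hA.eigenvectorBasis.norm_eq_one]; norm_num
  rw [hA.mulVec_eigenvectorBasis, dotProduct_smul, hn, mul_one] at h1
  have e : star (hA.eigenvectorBasis i).ofLp ⬝ᵥ (hA.eigenvectorBasis i).ofLp = ((1 : ℝ) : ℂ) := by
    rw [← hn]
    simp only [dotProduct, Pi.star_apply, RCLike.star_def, ← Complex.normSq_eq_conj_mul_self,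
      Complex.normSq_eq_norm_sq]
    push_cast
    rfl
  rw [e] at h1
  simpa using h1

end SigmaSup

/-! ### The six-dimensional compression -/

/-- A real symmetric matrix of the shape of `sixMatrix`. -/
def sixShape (p a b r c d e soo seo soe see : ℝ) : Matrix (Fin 6) (Fin 6) ℂ :=
  !![(p : ℂ), 0, 0, d, 0, 0;
     0, p, soo, soe, 0, 0;
     0, soo, a, c, seo, 0;
     d, soe, c, b, see, e;
     0, 0, seo, see, r, 0;
     0, 0, 0, e, 0, r]

theorem isHermitian_sixShape (p a b r c d e soo seo soe see : ℝ) :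
    (sixShape p a b r c d e soo seo soe see).IsHermitian := by
  ext i j
  fin_cases i <;> fin_cases j <;> simp [sixShape]

/-- The quadratic form of `sixShape`. -/
def sixQuad (p a b r c d e soo seo soe see : ℝ) (z : Fin 6 → ℂ) : ℝ :=
  p * (‖z 0‖ ^ 2 + ‖z 1‖ ^ 2) + a * ‖z 2‖ ^ 2 + b * ‖z 3‖ ^ 2 + r * (‖z 4‖ ^ 2 + ‖z 5‖ ^ 2)
    + 2 * (d * ((starRingEnd ℂ) (z 3) * z 0).re + soo * ((starRingEnd ℂ) (z 2) * z 1).re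
      + soe * ((starRingEnd ℂ) (z 3) * z 1).re + c * ((starRingEnd ℂ) (z 2) * z 3).re
      + seo * ((starRingEnd ℂ) (z 2) * z 4).re + see * ((starRingEnd ℂ) (z 3) * z 4).re
      + e * ((starRingEnd ℂ) (z 3) * z 5).re)

theorem re_dotProduct_sixShape (p a b r c d e soo seo soe see : ℝ) (z : Fin 6 → ℂ) :
    (star z ⬝ᵥ (sixShape p a b r c d e soo seo soe see).mulVec z).re
      = sixQuad p a b r c d e soo seo soe see z := by
  simp only [sixQuad, ← Complex.normSq_eq_norm_sq, Complex.normSq_apply]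
  simp [sixShape, dotProduct, Matrix.mulVec, Fin.sum_univ_succ]
  ring

/-- Gram-Schmidt on r, t: y and x are the coordinates of φ along the normalised r and along the
normalised remainder of t. With 0⁻¹ = 0 a degenerate direction is the zero vector, and Bessel's
inequality persists because both directions have norm at most 1. -/
theorem exists_bessel_pair {H : Type*} [NormedAddCommGroup H] [InnerProductSpace ℂ H] (r t φ : H)
    {s : ℂ} (hs : s = ((‖r‖⁻¹ : ℝ) : ℂ) * ⟪r, t⟫_ℂ) :
    ∃ x y : ℂ, ⟪r, φ⟫_ℂ = ‖r‖ * y ∧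
      ⟪t, φ⟫_ℂ = (starRingEnd ℂ) s * y + Real.sqrt (‖t‖ ^ 2 - ‖s‖ ^ 2) * x ∧
      ‖x‖ ^ 2 + ‖y‖ ^ 2 ≤ ‖φ‖ ^ 2 := by
  have key : ∀ v : H, ∃ e : H, v = (‖v‖ : ℂ) • e ∧ e = ((‖v‖⁻¹ : ℝ) : ℂ) • v ∧ ‖e‖ ≤ 1 := by
    intro v
    refine ⟨((‖v‖⁻¹ : ℝ) : ℂ) • v, ?_, rfl, ?_⟩
    · rcases eq_or_ne v 0 with rfl | hv
      · simp
      · rw [smul_smul, ← Complex.ofReal_mul, mul_inv_cancel₀ (norm_ne_zero_iff.2 hv)]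
        simp
    · rw [norm_smul, Complex.norm_real, norm_inv, norm_norm]
      exact inv_mul_le_one
  obtain ⟨e₁, hr, he₁, hn₁⟩ := key r
  have hst : ⟪e₁, t⟫_ℂ = s := by
    rw [he₁, inner_smul_left, Complex.conj_ofReal, hs]
  -- If r = 0 then e₁ = 0, but also s = 0, so the identity survives.
  have hse : s * ⟪e₁, e₁⟫_ℂ = s := by
    rcases eq_or_ne r 0 with rfl | hr0
    · rw [hs]; simp
    · have : ‖e₁‖ = 1 := by
        rw [he₁, norm_smul, Complex.norm_real, norm_inv, norm_norm,
          inv_mul_cancel₀ (norm_ne_zero_iff.2 hr0)]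
      rw [inner_self_eq_norm_sq_to_K, this]; simp
  set u := t - s • e₁ with hu
  have horth : ⟪e₁, u⟫_ℂ = 0 := by
    rw [hu, inner_sub_right, inner_smul_right, hst, hse, sub_self]
  have hnu : ‖u‖ ^ 2 = ‖t‖ ^ 2 - ‖s‖ ^ 2 := by
    have h1 : ⟪u, u⟫_ℂ = ⟪t, t⟫_ℂ - (starRingEnd ℂ) s * s := by
      conv_lhs => rw [hu, inner_sub_left, inner_smul_left, ← hu, horth, mul_zero, sub_zero, hu,
        inner_sub_right, inner_smul_right, ← inner_conj_symm t e₁, hst]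
      ring
    rw [inner_self_eq_norm_sq_to_K, inner_self_eq_norm_sq_to_K,
      ← Complex.normSq_eq_conj_mul_self, Complex.normSq_eq_norm_sq] at h1
    refine Complex.ofReal_injective ?_
    rw [Complex.ofReal_sub, Complex.ofReal_pow, Complex.ofReal_pow]
    exact h1
  obtain ⟨e₂, hu2, he₂, hn₂⟩ := key u
  have horth2 : ⟪e₁, e₂⟫_ℂ = 0 := by rw [he₂, inner_smul_right, horth, mul_zero]
  refine ⟨⟪e₂, φ⟫_ℂ, ⟪e₁, φ⟫_ℂ, ?_, ?_, ?_⟩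
  · conv_lhs => rw [hr, inner_smul_left, Complex.conj_ofReal]
  · have ht : t = s • e₁ + (‖u‖ : ℂ) • e₂ := by rw [← hu2, hu]; abel
    rw [← hnu, Real.sqrt_sq (norm_nonneg _)]
    conv_lhs => rw [ht, inner_add_left, inner_smul_left, inner_smul_left, Complex.conj_ofReal]
  · have h0 : 0 ≤ ‖φ - (⟪e₁, φ⟫_ℂ • e₁ + ⟪e₂, φ⟫_ℂ • e₂)‖ ^ 2 := by positivity
    rw [@norm_sub_sq ℂ, @norm_add_sq ℂ, inner_add_right, inner_smul_right, inner_smul_right,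
      inner_smul_left, inner_smul_right, horth2, norm_smul, norm_smul, ← inner_conj_symm φ e₁,
      ← inner_conj_symm φ e₂, RCLike.mul_conj, RCLike.mul_conj] at h0
    simp only [mul_zero, map_zero, map_add, add_zero] at h0
    norm_cast at h0
    simp only [mul_pow] at h0
    have h1 : ‖e₁‖ ^ 2 ≤ 1 := pow_le_one₀ (norm_nonneg _) hn₁
    have h2 : ‖e₂‖ ^ 2 ≤ 1 := pow_le_one₀ (norm_nonneg _) hn₂
    nlinarith [sq_nonneg ‖⟪e₁, φ⟫_ℂ‖, sq_nonneg ‖⟪e₂, φ⟫_ℂ‖]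

theorem norm_sq_decomp {H : Type*} [NormedAddCommGroup H] [InnerProductSpace ℂ H] {u φ : H}
    (hu : ‖u‖ = 1) :
    ⟪u, φ - ⟪u, φ⟫_ℂ • u⟫_ℂ = 0 ∧ ‖φ‖ ^ 2 = ‖⟪u, φ⟫_ℂ‖ ^ 2 + ‖φ - ⟪u, φ⟫_ℂ • u‖ ^ 2 := by
  have h0 : ⟪u, φ - ⟪u, φ⟫_ℂ • u⟫_ℂ = 0 := by
    rw [inner_sub_right, inner_smul_right, inner_self_eq_norm_sq_to_K, hu]
    simp
  refine ⟨h0, ?_⟩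
  have h1 := norm_add_sq_eq_norm_sq_add_norm_sq_of_inner_eq_zero (𝕜 := ℂ) (⟪u, φ⟫_ℂ • u)
    (φ - ⟪u, φ⟫_ℂ • u) (by rw [inner_smul_left, h0, mul_zero])
  rw [add_sub_cancel, norm_smul, hu, mul_one] at h1
  simpa [sq] using h1

section Compression

variable {H : Type*} [NormedAddCommGroup H] [InnerProductSpace ℂ H] [CompleteSpace H]

/-- As φ is orthogonal to u, subtracting the multiple of u from Au does not change the cross term;
the residual then has norm σ and is what Gram-Schmidt acts on. -/
theorem re_inner_selfAdjoint_expand {A : H →L[ℂ] H} (hA : IsSelfAdjoint A) {u φ : H} {l : ℝ}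
    (hl : ⟪u, A u⟫_ℂ = l) (hφ : ⟪u, φ⟫_ℂ = 0) (z : ℂ) :
    (⟪z • u + φ, A (z • u + φ)⟫_ℂ).re = l * ‖z‖ ^ 2
      + 2 * ((starRingEnd ℂ) z * ⟪A u - (l : ℂ) • u, φ⟫_ℂ).re + (⟪φ, A φ⟫_ℂ).re := by
  have h1 : ⟪u, A φ⟫_ℂ = ⟪A u, φ⟫_ℂ := by
    rw [← ContinuousLinearMap.adjoint_inner_left, hA.adjoint_eq]
  have h2 : ⟪φ, A u⟫_ℂ = (starRingEnd ℂ) ⟪A u, φ⟫_ℂ := (inner_conj_symm _ _).symm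
  have h3 : ⟪A u - (l : ℂ) • u, φ⟫_ℂ = ⟪A u, φ⟫_ℂ := by
    rw [inner_sub_left, inner_smul_left, hφ, mul_zero, sub_zero]
  rw [h3, map_add, map_smul, inner_add_left, inner_add_right, inner_add_right, inner_smul_left,
    inner_smul_left, inner_smul_right, inner_smul_right, h1, h2, hl, ← Complex.normSq_eq_norm_sq]
  generalize ⟪A u, φ⟫_ℂ = y
  generalize ⟪φ, A φ⟫_ℂ = x
  simp [Complex.normSq_apply]
  ring

theorem re_inner_expand (B : H →L[ℂ] H) {u v φ ψ : H} {l : ℝ} (hl : ⟪u, B v⟫_ℂ = l)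
    (hφ : ⟪u, φ⟫_ℂ = 0) (hψ : ⟪v, ψ⟫_ℂ = 0) (z w : ℂ) :
    (⟪z • u + φ, B (w • v + ψ)⟫_ℂ).re = l * ((starRingEnd ℂ) z * w).re
      + ((starRingEnd ℂ) z * ⟪ContinuousLinearMap.adjoint B u - (l : ℂ) • v, ψ⟫_ℂ).re
      + ((starRingEnd ℂ) w * ⟪B v - (l : ℂ) • u, φ⟫_ℂ).re + (⟪φ, B ψ⟫_ℂ).re := by
  have h2 : ⟪φ, B v⟫_ℂ = (starRingEnd ℂ) ⟪B v, φ⟫_ℂ := (inner_conj_symm _ _).symm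
  have h3 : ⟪B v - (l : ℂ) • u, φ⟫_ℂ = ⟪B v, φ⟫_ℂ := by
    rw [inner_sub_left, inner_smul_left, hφ, mul_zero, sub_zero]
  have h4 : ⟪ContinuousLinearMap.adjoint B u - (l : ℂ) • v, ψ⟫_ℂ = ⟪u, B ψ⟫_ℂ := by
    rw [inner_sub_left, inner_smul_left, hψ, mul_zero, sub_zero,
      ContinuousLinearMap.adjoint_inner_left]
  rw [h3, h4, map_add, map_smul, inner_add_left, inner_add_right, inner_add_right, inner_smul_left,
    inner_smul_left, inner_smul_right, inner_smul_right, h2, hl]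
  generalize ⟪B v, φ⟫_ℂ = y
  generalize ⟪u, B ψ⟫_ℂ = y'
  generalize ⟪φ, B ψ⟫_ℂ = x
  simp
  ring

/-- A two-by-two block form bounded by the identity, perturbed on two unit vectors, is bounded by
the largest eigenvalue of a six-dimensional matrix. -/
theorem block_quad_le_sigmaSup {A B D : H →L[ℂ] H} (hA : IsSelfAdjoint A) (hD : IsSelfAdjoint D)
    (hQ : ∀ φ ψ : H, (⟪φ, A φ⟫_ℂ).re + (⟪ψ, D ψ⟫_ℂ).re + 2 * (⟪φ, B ψ⟫_ℂ).re ≤ ‖φ‖ ^ 2 + ‖ψ‖ ^ 2)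
    {u v : H} (hu : ‖u‖ = 1) (hv : ‖v‖ = 1) {la ld lb soe see : ℝ}
    (hla : ⟪u, A u⟫_ℂ = la) (hld : ⟪v, D v⟫_ℂ = ld) (hlb : ⟪u, B v⟫_ℂ = lb)
    (hsoe : (soe : ℂ) = ((‖A u - (la : ℂ) • u‖⁻¹ : ℝ) : ℂ)
      * ⟪A u - (la : ℂ) • u, B v - (lb : ℂ) • u⟫_ℂ)
    (hsee : (see : ℂ) = ((‖ContinuousLinearMap.adjoint B u - (lb : ℂ) • v‖⁻¹ : ℝ) : ℂ)
      * ⟪ContinuousLinearMap.adjoint B u - (lb : ℂ) • v, D v - (ld : ℂ) • v⟫_ℂ)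
    (κ x y go ge : ℝ) (φ ψ : H) :
    (⟪φ, A φ⟫_ℂ).re + (⟪ψ, D ψ⟫_ℂ).re + 2 * (⟪φ, B ψ⟫_ℂ).re
        + κ * ‖(x : ℂ) * ⟪u, φ⟫_ℂ + (y : ℂ) * ⟪v, ψ⟫_ℂ‖ ^ 2 - go * ‖φ‖ ^ 2 - ge * ‖ψ‖ ^ 2
      ≤ sigmaSup (sixShape (1 - go) (κ * x ^ 2 + la - go) (κ * y ^ 2 + ld - ge) (1 - ge)
          (κ * (x * y) + lb) (Real.sqrt (‖B v - (lb : ℂ) • u‖ ^ 2 - ‖(soe : ℂ)‖ ^ 2))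
          (Real.sqrt (‖D v - (ld : ℂ) • v‖ ^ 2 - ‖(see : ℂ)‖ ^ 2)) ‖A u - (la : ℂ) • u‖
          ‖ContinuousLinearMap.adjoint B u - (lb : ℂ) • v‖ soe see) * (‖φ‖ ^ 2 + ‖ψ‖ ^ 2) := by
  obtain ⟨hφ0, hφn⟩ := norm_sq_decomp (φ := φ) hu
  obtain ⟨hψ0, hψn⟩ := norm_sq_decomp (φ := ψ) hv
  set z2 := ⟪u, φ⟫_ℂ
  set z3 := ⟪v, ψ⟫_ℂ
  set φ' := φ - z2 • u with hφ'
  set ψ' := ψ - z3 • v with hψ'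
  have eφ : φ = z2 • u + φ' := by rw [hφ']; abel
  have eψ : ψ = z3 • v + ψ' := by rw [hψ']; abel
  -- Coordinates z1, z4 lie along the residuals of Au and B†u; z0, z5 lie along the remainders of
  -- the residuals of Bv and Dv. This is the basis order of the matrix.
  obtain ⟨z0, z1, b1, b2, b3⟩ := exists_bessel_pair (A u - (la : ℂ) • u) (B v - (lb : ℂ) • u) φ' hsoe
  obtain ⟨z5, z4, c1, c2, c3⟩ := exists_bessel_pair
    (ContinuousLinearMap.adjoint B u - (lb : ℂ) • v) (D v - (ld : ℂ) • v) ψ' hsee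
  have hA' := re_inner_selfAdjoint_expand hA hla hφ0 z2
  have hD' := re_inner_selfAdjoint_expand hD hld hψ0 z3
  have hB' := re_inner_expand B hlb hφ0 hψ0 z2 z3
  rw [← eφ] at hA' hB'
  rw [← eψ] at hD' hB'
  rw [b1] at hA'
  rw [c2] at hD'
  rw [c1, b2] at hB'
  have hQ' := hQ φ' ψ'
  set soo := ‖A u - (la : ℂ) • u‖
  set seo := ‖ContinuousLinearMap.adjoint B u - (lb : ℂ) • v‖
  set d := Real.sqrt (‖B v - (lb : ℂ) • u‖ ^ 2 - ‖(soe : ℂ)‖ ^ 2)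
  set e := Real.sqrt (‖D v - (ld : ℂ) • v‖ ^ 2 - ‖(see : ℂ)‖ ^ 2)
  have hS := fun z : Fin 6 → ℂ => re_dotProduct_le_sigmaSup (isHermitian_sixShape (1 - go)
    (κ * x ^ 2 + la - go) (κ * y ^ 2 + ld - ge) (1 - ge) (κ * (x * y) + lb) d e soo seo soe see) z
  simp only [re_dotProduct_sixShape] at hS
  set σ := sigmaSup (sixShape (1 - go) (κ * x ^ 2 + la - go) (κ * y ^ 2 + ld - ge) (1 - ge)
    (κ * (x * y) + lb) d e soo seo soe see)
  -- The first and last basis vectors as test vectors; these bounds control the parts of φ and ψ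
  -- outside the six coordinates.
  have hgo : 1 - go ≤ σ := by
    have := hS ![1, 0, 0, 0, 0, 0]
    simpa [sixQuad, Fin.sum_univ_succ] using this
  have hge : 1 - ge ≤ σ := by
    have := hS ![0, 0, 0, 0, 0, 1]
    simpa [sixQuad, Fin.sum_univ_succ] using this
  have hz := hS ![z0, z1, z2, z3, z4, z5]
  have hsum : ∑ i, ‖(![z0, z1, z2, z3, z4, z5] : Fin 6 → ℂ) i‖ ^ 2
      = ‖z0‖ ^ 2 + ‖z1‖ ^ 2 + ‖z2‖ ^ 2 + ‖z3‖ ^ 2 + ‖z4‖ ^ 2 + ‖z5‖ ^ 2 := by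
    simp [Fin.sum_univ_succ]
    ring
  rw [hsum] at hz
  have hk : ‖(x : ℂ) * z2 + (y : ℂ) * z3‖ ^ 2
      = x ^ 2 * ‖z2‖ ^ 2 + y ^ 2 * ‖z3‖ ^ 2 + 2 * (x * y) * ((starRingEnd ℂ) z2 * z3).re := by
    simp only [← Complex.normSq_eq_norm_sq, Complex.normSq_apply]
    simp
    ring
  -- The six-dimensional form is the full one with the contribution of (φ', ψ') replaced by the
  -- squared norm of its four coordinates, and with go, ge charged only on the retained coordinates.
  have hlin : sixQuad (1 - go) (κ * x ^ 2 + la - go) (κ * y ^ 2 + ld - ge) (1 - ge)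
      (κ * (x * y) + lb) d e soo seo soe see ![z0, z1, z2, z3, z4, z5]
      = (⟪φ, A φ⟫_ℂ).re + (⟪ψ, D ψ⟫_ℂ).re + 2 * (⟪φ, B ψ⟫_ℂ).re
        - ((⟪φ', A φ'⟫_ℂ).re + (⟪ψ', D ψ'⟫_ℂ).re + 2 * (⟪φ', B ψ'⟫_ℂ).re)
        + κ * ‖(x : ℂ) * z2 + (y : ℂ) * z3‖ ^ 2 - go * (‖z2‖ ^ 2 + ‖z0‖ ^ 2 + ‖z1‖ ^ 2)
        - ge * (‖z3‖ ^ 2 + ‖z4‖ ^ 2 + ‖z5‖ ^ 2)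
        + (‖z0‖ ^ 2 + ‖z1‖ ^ 2 + ‖z4‖ ^ 2 + ‖z5‖ ^ 2) := by
    rw [hA', hD', hB', hk]
    simp only [sixQuad, Complex.conj_ofReal]
    simp
    ring
  rw [hlin] at hz
  have h5 := mul_le_mul_of_nonneg_right hgo (sub_nonneg.2 b3)
  have h6 := mul_le_mul_of_nonneg_right hge (sub_nonneg.2 c3)
  rw [hφn, hψn]
  linarith [hz, h5, h6, hQ']

end Compression

/-! ### Parity structure of the blocks -/

theorem odProj_odProj (φ : Mode) : odProj (odProj φ) = odProj φ := by
  rw [odProj_apply (odProj φ), parity_odProj, sub_neg_eq_add, ← two_smul ℂ, smul_smul]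
  norm_num

theorem evProj_evProj (φ : Mode) : evProj (evProj φ) = evProj φ := by
  rw [evProj_apply (evProj φ), parity_evProj, ← two_smul ℂ, smul_smul]
  norm_num

theorem inner_odProj_left (φ ψ : Mode) : ⟪odProj φ, ψ⟫_ℂ = ⟪φ, odProj ψ⟫_ℂ :=
  Submodule.inner_starProjection_left_eq_right _ φ ψ

theorem inner_evProj_left (φ ψ : Mode) : ⟪evProj φ, ψ⟫_ℂ = ⟪φ, evProj ψ⟫_ℂ :=
  Submodule.inner_starProjection_left_eq_right _ φ ψ

theorem norm_sq_eq_odProj_add_evProj (φ : Mode) :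
    ‖φ‖ ^ 2 = ‖odProj φ‖ ^ 2 + ‖evProj φ‖ ^ 2 := by
  have h : ⟪odProj φ, evProj φ⟫_ℂ = 0 := by
    have h1 := inner_parity_left (odProj φ) (evProj φ)
    rw [parity_odProj, parity_evProj, inner_neg_left] at h1
    exact self_eq_neg.1 h1.symm
  have h2 := norm_add_sq_eq_norm_sq_add_norm_sq_of_inner_eq_zero (𝕜 := ℂ) _ _ h
  have h3 : odProj φ + evProj φ = φ := by
    rw [odProj_apply, evProj_apply, ← smul_add, sub_add_add_cancel, ← two_smul ℂ, smul_smul]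
    norm_num
  rw [h3] at h2
  simpa [sq] using h2

/-- Used to insert or remove parity projections: these are idempotent inside the integrands, so the
blocks absorb them. -/
theorem HasWeakIntegral.inner_eq {α H : Type*} [MeasurableSpace α] [NormedAddCommGroup H]
    [InnerProductSpace ℂ H] {m : Measure α} {s : α → H → H → ℂ} {M : H →L[ℂ] H}
    (h : HasWeakIntegral m s M) {φ φ' ψ ψ' : H} (e : ∀ a, s a φ ψ = s a φ' ψ') :
    ⟪φ, M ψ⟫_ℂ = ⟪φ', M ψ'⟫_ℂ := by
  rw [(h φ ψ).2, (h φ' ψ').2]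
  simp_rw [e]

section Blocks

variable {μ β : ℝ} {f : ℝ → ℝ}

theorem inner_Moo_odProj (hf : Measurable f) (hf1 : ∀ x, |f x| ≤ 1) (φ ψ : Mode) :
    ⟪odProj φ, Moo μ β f (odProj ψ)⟫_ℂ = ⟪φ, Moo μ β f ψ⟫_ℂ :=
  (hasWeakIntegral_Moo hf hf1).1.inner_eq fun a => by simp only [ooForm, odProj_odProj]

theorem Moo_odProj (hf : Measurable f) (hf1 : ∀ x, |f x| ≤ 1) (ψ : Mode) :
    Moo μ β f (odProj ψ) = Moo μ β f ψ :=
  ext_inner_left ℂ fun φ => (hasWeakIntegral_Moo hf hf1).1.inner_eq fun a => by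
    simp only [ooForm, odProj_odProj]

theorem inner_Mee_evProj (hf : Measurable f) (hf1 : ∀ x, |f x| ≤ 1) (φ ψ : Mode) :
    ⟪evProj φ, Mee μ β f (evProj ψ)⟫_ℂ = ⟪φ, Mee μ β f ψ⟫_ℂ :=
  (hasWeakIntegral_Mee hf hf1).1.inner_eq fun a => by simp only [eeForm, evProj_evProj]

theorem Mee_evProj (hf : Measurable f) (hf1 : ∀ x, |f x| ≤ 1) (ψ : Mode) :
    Mee μ β f (evProj ψ) = Mee μ β f ψ :=
  ext_inner_left ℂ fun φ => (hasWeakIntegral_Mee hf hf1).1.inner_eq fun a => by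
    simp only [eeForm, evProj_evProj]

theorem inner_Moe_proj (hf : Measurable f) (hf1 : ∀ x, |f x| ≤ 1) (s : ℝ) (φ ψ : Mode) :
    ⟪odProj φ, Moe μ β f s (evProj ψ)⟫_ℂ = ⟪φ, Moe μ β f s ψ⟫_ℂ :=
  (hasWeakIntegral_Moe hf hf1 s).1.inner_eq fun a => by
    simp only [oeForm, evProj_evProj, odProj_odProj]

theorem Moe_evProj (hf : Measurable f) (hf1 : ∀ x, |f x| ≤ 1) (s : ℝ) (ψ : Mode) :
    Moe μ β f s (evProj ψ) = Moe μ β f s ψ :=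
  ext_inner_left ℂ fun φ => (hasWeakIntegral_Moe hf hf1 s).1.inner_eq fun a => by
    simp only [oeForm, evProj_evProj]

theorem Meo_odProj (hf : Measurable f) (hf1 : ∀ x, |f x| ≤ 1) (s : ℝ) (φ : Mode) :
    Meo μ β f s (odProj φ) = Meo μ β f s φ :=
  ext_inner_right ℂ fun ψ => by
    rw [Meo, ContinuousLinearMap.adjoint_inner_left, ContinuousLinearMap.adjoint_inner_left]
    exact (hasWeakIntegral_Moe hf hf1 s).1.inner_eq fun a => by simp only [oeForm, odProj_odProj]

theorem conj_exp_neg_sq (β t : ℝ) :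
    (starRingEnd ℂ) (exp (-(I * β * t))) = exp (I * β * t) ∧
      (starRingEnd ℂ) (exp (I * β * t)) = exp (-(I * β * t)) := by
  constructor <;> · rw [← Complex.exp_conj]; simp

/-- In coherent-state form, passing to the adjoint only exchanges the phases e^{2iβt} and e^{-2iβt},
which enter symmetrically. -/
theorem isSelfAdjoint_Moo (hf : Measurable f) (hf1 : ∀ x, |f x| ≤ 1) :
    IsSelfAdjoint (Moo μ β f) := by
  have h := (hasWeakIntegral_Moo (μ := μ) (β := β) hf hf1).2
  rw [ContinuousLinearMap.isSelfAdjoint_iff']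
  refine (h.adjoint.congr ?_).unique h
  rintro ⟨w, t⟩ φ ψ
  obtain ⟨e1, e2⟩ := conj_exp_neg_sq β t
  simp only [ooComb_cohForm, map_mul, map_div₀, map_add, map_pow, map_one, map_ofNat,
    Complex.conj_ofReal, inner_conj_symm, e1, e2]
  ring

theorem isSelfAdjoint_Mee (hf : Measurable f) (hf1 : ∀ x, |f x| ≤ 1) :
    IsSelfAdjoint (Mee μ β f) := by
  have h := (hasWeakIntegral_Mee (μ := μ) (β := β) hf hf1).2
  rw [ContinuousLinearMap.isSelfAdjoint_iff']
  refine (h.adjoint.congr ?_).unique h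
  rintro ⟨w, t⟩ φ ψ
  obtain ⟨e1, e2⟩ := conj_exp_neg_sq β t
  simp only [eeComb_cohForm, map_mul, map_div₀, map_add, map_sub, map_pow, map_one, map_ofNat,
    Complex.conj_ofReal, inner_conj_symm, e1, e2]
  ring

end Blocks

/-! ### Complex conjugation of wave functions -/

/-- Complex conjugation of wave functions. -/
def conjMode : Mode →L[ℝ] Mode := Complex.conjCLE.toContinuousLinearMap.compLpL 2 volume

theorem coeFn_conjMode (φ : Mode) : conjMode φ =ᵐ[volume] fun x => (starRingEnd ℂ) (φ x) :=
  ContinuousLinearMap.coeFn_compLpL _ φ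

theorem conjMode_conjMode (φ : Mode) : conjMode (conjMode φ) = φ := by
  refine Lp.ext ?_
  filter_upwards [coeFn_conjMode (conjMode φ), coeFn_conjMode φ] with x h1 h2
  rw [h1, h2, Complex.conj_conj]

theorem inner_conjMode_conjMode (φ ψ : Mode) :
    ⟪conjMode φ, conjMode ψ⟫_ℂ = (starRingEnd ℂ) ⟪φ, ψ⟫_ℂ := by
  rw [L2.inner_def, L2.inner_def, ← integral_conj]
  refine integral_congr_ae ?_
  filter_upwards [coeFn_conjMode φ, coeFn_conjMode ψ] with x h1 h2
  rw [h1, h2, RCLike.inner_apply, RCLike.inner_apply, map_mul]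

theorem parity_conjMode (φ : Mode) : parity (conjMode φ) = conjMode (parity φ) := by
  refine Lp.ext ?_
  have h := (Measure.measurePreserving_neg (volume : Measure ℝ)).quasiMeasurePreserving.ae
    (coeFn_conjMode φ)
  filter_upwards [coeFn_parity (conjMode φ), coeFn_conjMode (parity φ), coeFn_parity φ, h]
    with x h1 h2 h3 h4
  rw [h1, h2, h3, h4]

theorem conjMode_half_smul (φ : Mode) :
    conjMode ((2⁻¹ : ℂ) • φ) = (2⁻¹ : ℂ) • conjMode φ := by
  have e : ∀ ψ : Mode, (2⁻¹ : ℂ) • ψ = (2⁻¹ : ℝ) • ψ := fun ψ => by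
    rw [show (2⁻¹ : ℂ) = ((2⁻¹ : ℝ) : ℂ) by push_cast; rfl]
    exact (RCLike.real_smul_eq_coe_smul (K := ℂ) _ _).symm
  rw [e, e, map_smul]

theorem odProj_conjMode (φ : Mode) : odProj (conjMode φ) = conjMode (odProj φ) := by
  rw [odProj_apply, odProj_apply, conjMode_half_smul, map_sub, parity_conjMode]

theorem evProj_conjMode (φ : Mode) : evProj (conjMode φ) = conjMode (evProj φ) := by
  rw [evProj_apply, evProj_apply, conjMode_half_smul, map_add, parity_conjMode]

theorem conjMode_coherent (w t : ℝ) : conjMode (coherent ⟨w, t⟩) = coherent ⟨w, -t⟩ := by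
  refine Lp.ext ?_
  filter_upwards [coeFn_conjMode (coherent ⟨w, t⟩), (memLp_coherentWave ⟨w, t⟩).coeFn_toLp,
    (memLp_coherentWave ⟨w, -t⟩).coeFn_toLp] with x h1 h2 h3
  rw [h1, coherent, coherent, h2, h3, coherentWave_mk, coherentWave_mk, map_mul,
    Complex.conj_ofReal, ← Complex.exp_conj]
  congr 2
  simp only [map_sub, map_mul, Complex.conj_I, Complex.conj_ofReal, map_ofNat]
  push_cast
  ring

theorem conjMode_coherent_ofReal (β : ℝ) : conjMode (coherent β) = coherent β := by
  have h := conjMode_coherent β 0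
  rwa [neg_zero] at h

/-- Conjugation of wave functions reflects phase space by t ↦ -t, which preserves Lebesgue measure;
a form covariant under both therefore gives an operator commuting with conjugation. -/
theorem HasWeakIntegral.map_conjMode {s : ℝ × ℝ → Mode → Mode → ℂ} {M : Mode →L[ℂ] Mode}
    (h : HasWeakIntegral volume s M)
    (hs : ∀ w t φ ψ, s (w, t) (conjMode φ) (conjMode ψ) = (starRingEnd ℂ) (s (w, -t) φ ψ))
    (ψ : Mode) : M (conjMode ψ) = conjMode (M ψ) := by
  refine ext_inner_left ℂ fun φ => ?_
  rw [← conjMode_conjMode φ, inner_conjMode_conjMode, (h _ _).2, (h _ _).2, ← integral_conj]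
  have hmp : MeasurePreserving ((MeasurableEquiv.refl ℝ).prodCongr (MeasurableEquiv.neg ℝ))
      (volume : Measure (ℝ × ℝ)) volume :=
    (MeasurePreserving.id volume).prod (Measure.measurePreserving_neg volume)
  rw [← hmp.integral_comp (MeasurableEquiv.measurableEmbedding _)
    (fun p => (starRingEnd ℂ) (s p (conjMode φ) ψ))]
  congr 1 with p
  rw [conjMode_conjMode]
  have := hs p.1 p.2 (conjMode φ) ψ
  rw [conjMode_conjMode] at this
  exact this

section Conj

variable {μ β : ℝ} {f : ℝ → ℝ}

theorem inner_coherent_conjMode (w t : ℝ) (ψ : Mode) :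
    ⟪coherent ⟨w, t⟩, conjMode ψ⟫_ℂ = (starRingEnd ℂ) ⟪coherent ⟨w, -t⟩, ψ⟫_ℂ := by
  rw [← inner_conjMode_conjMode, conjMode_coherent, neg_neg]

theorem inner_conjMode_coherent (w t : ℝ) (ψ : Mode) :
    ⟪conjMode ψ, coherent ⟨w, t⟩⟫_ℂ = (starRingEnd ℂ) ⟪ψ, coherent ⟨w, -t⟩⟫_ℂ := by
  rw [← inner_conjMode_conjMode, conjMode_coherent, neg_neg]

theorem cohForm_conjMode (k : ℝ → ℝ) (a b w t : ℝ) (φ ψ : Mode) :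
    cohForm k a b (w, t) (conjMode φ) (conjMode ψ)
      = (starRingEnd ℂ) (cohForm k a b (w, -t) φ ψ) := by
  simp only [cohForm, inner_coherent_conjMode, inner_conjMode_coherent, map_mul, map_div₀,
    Complex.conj_ofReal, ← Complex.exp_conj, map_sub, Complex.conj_I, map_ofNat,
    Complex.ofReal_neg, map_neg]
  ring_nf

theorem Moo_conjMode (hf : Measurable f) (hf1 : ∀ x, |f x| ≤ 1) (ψ : Mode) :
    Moo μ β f (conjMode ψ) = conjMode (Moo μ β f ψ) :=
  (hasWeakIntegral_Moo hf hf1).2.map_conjMode (fun w t φ ψ => by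
    simp only [ooComb, odProj_conjMode, cohForm_conjMode, map_add]) ψ

theorem Mee_conjMode (hf : Measurable f) (hf1 : ∀ x, |f x| ≤ 1) (ψ : Mode) :
    Mee μ β f (conjMode ψ) = conjMode (Mee μ β f ψ) :=
  (hasWeakIntegral_Mee hf hf1).2.map_conjMode (fun w t φ ψ => by
    simp only [eeComb, evProj_conjMode, cohForm_conjMode, map_add, map_sub]) ψ

theorem Moe_conjMode (hf : Measurable f) (hf1 : ∀ x, |f x| ≤ 1) (s : ℝ) (ψ : Mode) :
    Moe μ β f s (conjMode ψ) = conjMode (Moe μ β f s ψ) :=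
  (hasWeakIntegral_Moe hf hf1 s).2.map_conjMode (fun w t φ ψ => by
    simp only [oeComb, evProj_conjMode, odProj_conjMode, cohForm_conjMode, map_mul, map_sub,
      Complex.conj_ofReal]) ψ

/-- The coherent state of real amplitude is a real wave function, hence fixed by conjugation. All
reality statements for the parameters rest on this. -/
theorem star_expect {T : Mode →L[ℂ] Mode} (hT : ∀ ψ, T (conjMode ψ) = conjMode (T ψ)) :
    star (expect β T) = expect β T := by
  rw [RCLike.star_def, expect, ← inner_conjMode_conjMode, ← hT, conjMode_coherent_ofReal]

theorem star_lamOO (hf : Measurable f) (hf1 : ∀ x, |f x| ≤ 1) :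
    star (lamOO μ β f) = lamOO μ β f := by
  rw [lamOO, star_mul', star_expect (Moo_conjMode hf hf1), RCLike.star_def, Complex.conj_ofReal]

theorem star_lamEE (hf : Measurable f) (hf1 : ∀ x, |f x| ≤ 1) :
    star (lamEE μ β f) = lamEE μ β f := by
  rw [lamEE, star_mul', star_expect (Mee_conjMode hf hf1), RCLike.star_def, Complex.conj_ofReal]

theorem star_lamOE (hf : Measurable f) (hf1 : ∀ x, |f x| ≤ 1) (s : ℝ) :
    star (lamOE μ β f s) = lamOE μ β f s := by
  rw [lamOE, star_mul', star_expect (Moe_conjMode hf hf1 s), RCLike.star_def, Complex.conj_ofReal]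

theorem star_sigOE (hf : Measurable f) (hf1 : ∀ x, |f x| ≤ 1) (s : ℝ) :
    star (sigOE μ β f s) = sigOE μ β f s := by
  have h : star (expect β (Moo μ β f ∘L Moe μ β f s)) = expect β (Moo μ β f ∘L Moe μ β f s) :=
    star_expect fun ψ => by
      simp only [ContinuousLinearMap.comp_apply, Moe_conjMode hf hf1, Moo_conjMode hf hf1]
  rw [sigOE, star_mul', star_sub, star_mul', star_mul', h, star_lamOO hf hf1, star_lamOE hf hf1,
    RCLike.star_def, Complex.conj_ofReal, Complex.conj_ofReal]

theorem star_sigEE (hf : Measurable f) (hf1 : ∀ x, |f x| ≤ 1) (s : ℝ) :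
    star (sigEE μ β f s) = sigEE μ β f s := by
  have h : star (expect β (Moe μ β f s ∘L Mee μ β f)) = expect β (Moe μ β f s ∘L Mee μ β f) :=
    star_expect fun ψ => by
      simp only [ContinuousLinearMap.comp_apply, Moe_conjMode hf hf1, Mee_conjMode hf hf1]
  rw [sigEE, star_mul', star_sub, star_mul', star_mul', h, star_lamEE hf hf1, star_lamOE hf hf1,
    RCLike.star_def, Complex.conj_ofReal, Complex.conj_ofReal]

end Conj

/-! ### The weights -/

theorem inner_coherent_coherent_ofReal (a b : ℝ) :
    ⟪coherent a, coherent b⟫_ℂ = (Real.exp (-(a - b) ^ 2 / 2) : ℂ) := by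
  -- The product of the two Gaussians is centred at (a+b)/2. By symmetry x is put in the amplitude
  -- slot, so that `integral_realWave_sq_left` applies.
  have e : ∀ x, realWave a x * realWave b x
      = Real.exp (-(a - b) ^ 2 / 2) * realWave x ((a + b) / 2) ^ 2 := by
    intro x
    rw [realWave_sq, realWave, realWave, mul_mul_mul_comm, ← Real.rpow_add (by positivity),
      ← Real.exp_add, mul_left_comm, ← Real.exp_add, Real.sqrt_eq_rpow]
    congr 2
    · norm_num
    · ring
  have h : ∫ x, realWave a x * realWave b x = Real.exp (-(a - b) ^ 2 / 2) := by
    simp_rw [e]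
    rw [integral_const_mul, integral_realWave_sq_left, mul_one]
  rw [inner_coherent, ← h, ← integral_complex_ofReal]
  refine integral_congr_ae ?_
  filter_upwards [(memLp_coherentWave b).coeFn_toLp] with x hx
  rw [coherent, hx, coherentWave_ofReal, coherentWave_ofReal, RCLike.star_def,
    Complex.conj_ofReal, Complex.ofReal_mul]

theorem expect_odProj (β : ℝ) :
    expect β odProj = ((Real.exp (-β ^ 2) * Real.sinh (β ^ 2) : ℝ) : ℂ) := by
  have h : Real.exp (-β ^ 2) * Real.sinh (β ^ 2)
      = 2⁻¹ * (Real.exp (-(β - β) ^ 2 / 2) - Real.exp (-(β - -β) ^ 2 / 2)) := by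
    rw [Real.sinh_eq, mul_div_assoc', mul_sub, ← Real.exp_add, ← Real.exp_add]
    ring_nf
  rw [expect, odProj_apply, inner_smul_right, inner_sub_right, parity_coherent,
    ← Complex.ofReal_neg, inner_coherent_coherent_ofReal, inner_coherent_coherent_ofReal, h]
  push_cast
  rfl

theorem expect_evProj (β : ℝ) :
    expect β evProj = ((Real.exp (-β ^ 2) * Real.cosh (β ^ 2) : ℝ) : ℂ) := by
  have h : Real.exp (-β ^ 2) * Real.cosh (β ^ 2)
      = 2⁻¹ * (Real.exp (-(β - β) ^ 2 / 2) + Real.exp (-(β - -β) ^ 2 / 2)) := by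
    rw [Real.cosh_eq, mul_div_assoc', mul_add, ← Real.exp_add, ← Real.exp_add]
    ring_nf
  rw [expect, evProj_apply, inner_smul_right, inner_add_right, parity_coherent,
    ← Complex.ofReal_neg, inner_coherent_coherent_ofReal, inner_coherent_coherent_ofReal, h]
  push_cast
  rfl

theorem Co_eq (β : ℝ) : Co β = Real.exp (-β ^ 2) * Real.sinh (β ^ 2) := by
  rw [Co, expect_odProj, Complex.ofReal_re]

theorem Ce_eq (β : ℝ) : Ce β = Real.exp (-β ^ 2) * Real.cosh (β ^ 2) := by
  rw [Ce, expect_evProj, Complex.ofReal_re]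

theorem norm_sq_odProj_coherent (β : ℝ) : ‖odProj (coherent β)‖ ^ 2 = Co β := by
  have h : ⟪odProj (coherent β), odProj (coherent β)⟫_ℂ = (Co β : ℂ) := by
    rw [inner_odProj_left, odProj_odProj, Co_eq]
    exact expect_odProj β
  rw [inner_self_eq_norm_sq_to_K] at h
  refine Complex.ofReal_injective ?_
  rw [Complex.ofReal_pow]
  exact h

theorem norm_sq_evProj_coherent (β : ℝ) : ‖evProj (coherent β)‖ ^ 2 = Ce β := by
  have h : ⟪evProj (coherent β), evProj (coherent β)⟫_ℂ = (Ce β : ℂ) := by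
    rw [inner_evProj_left, evProj_evProj, Ce_eq]
    exact expect_evProj β
  rw [inner_self_eq_norm_sq_to_K] at h
  refine Complex.ofReal_injective ?_
  rw [Complex.ofReal_pow]
  exact h

/-! ### Identification of the parameters -/

theorem ofReal_re_of_star_eq {z : ℂ} (h : star z = z) : ((z.re : ℝ) : ℂ) = z :=
  Complex.conj_eq_iff_re.1 h

section Parameters

variable {μ β : ℝ} {f : ℝ → ℝ}

theorem Co_pos (hβ : β ≠ 0) : 0 < Co β := by
  rw [Co_eq]
  exact mul_pos (Real.exp_pos _) (Real.sinh_pos_iff.2 (by positivity))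

theorem Ce_pos (β : ℝ) : 0 < Ce β := by
  rw [Ce_eq]
  exact mul_pos (Real.exp_pos _) (Real.cosh_pos _)

theorem inner_odProj_Moo (hf : Measurable f) (hf1 : ∀ x, |f x| ≤ 1) (φ ψ : Mode) :
    ⟪odProj φ, Moo μ β f ψ⟫_ℂ = ⟪φ, Moo μ β f ψ⟫_ℂ :=
  (hasWeakIntegral_Moo hf hf1).1.inner_eq fun a => by simp only [ooForm, odProj_odProj]

theorem inner_evProj_Mee (hf : Measurable f) (hf1 : ∀ x, |f x| ≤ 1) (φ ψ : Mode) :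
    ⟪evProj φ, Mee μ β f ψ⟫_ℂ = ⟪φ, Mee μ β f ψ⟫_ℂ :=
  (hasWeakIntegral_Mee hf hf1).1.inner_eq fun a => by simp only [eeForm, evProj_evProj]

theorem inner_odProj_Moe (hf : Measurable f) (hf1 : ∀ x, |f x| ≤ 1) (s : ℝ) (φ ψ : Mode) :
    ⟪odProj φ, Moe μ β f s ψ⟫_ℂ = ⟪φ, Moe μ β f s ψ⟫_ℂ :=
  (hasWeakIntegral_Moe hf hf1 s).1.inner_eq fun a => by simp only [oeForm, odProj_odProj]

/-- The normalised odd part of the coherent state. -/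
def oddKet (β : ℝ) : Mode := (((Real.sqrt (Co β))⁻¹ : ℝ) : ℂ) • odProj (coherent β)

/-- The normalised even part of the coherent state. -/
def evenKet (β : ℝ) : Mode := (((Real.sqrt (Ce β))⁻¹ : ℝ) : ℂ) • evProj (coherent β)

theorem norm_oddKet (hβ : β ≠ 0) : ‖oddKet β‖ = 1 := by
  have h := Co_pos hβ
  rw [oddKet, norm_smul, Complex.norm_real, Real.norm_of_nonneg (by positivity),
    ← Real.sqrt_sq (norm_nonneg (odProj _)), norm_sq_odProj_coherent,
    inv_mul_cancel₀ (Real.sqrt_pos.2 h).ne']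

theorem norm_evenKet (β : ℝ) : ‖evenKet β‖ = 1 := by
  have h := Ce_pos β
  rw [evenKet, norm_smul, Complex.norm_real, Real.norm_of_nonneg (by positivity),
    ← Real.sqrt_sq (norm_nonneg (evProj _)), norm_sq_evProj_coherent,
    inv_mul_cancel₀ (Real.sqrt_pos.2 h).ne']

theorem sqrt_Co_mul_inner_oddKet (hβ : β ≠ 0) (φ : Mode) :
    (Real.sqrt (Co β) : ℂ) * ⟪oddKet β, φ⟫_ℂ = ⟪coherent β, odProj φ⟫_ℂ := by
  rw [oddKet, inner_smul_left, Complex.conj_ofReal, ← mul_assoc, ← Complex.ofReal_mul,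
    mul_inv_cancel₀ (Real.sqrt_pos.2 (Co_pos hβ)).ne', Complex.ofReal_one, one_mul,
    inner_odProj_left]

theorem sqrt_Ce_mul_inner_evenKet (φ : Mode) :
    (Real.sqrt (Ce β) : ℂ) * ⟪evenKet β, φ⟫_ℂ = ⟪coherent β, evProj φ⟫_ℂ := by
  rw [evenKet, inner_smul_left, Complex.conj_ofReal, ← mul_assoc, ← Complex.ofReal_mul,
    mul_inv_cancel₀ (Real.sqrt_pos.2 (Ce_pos β)).ne', Complex.ofReal_one, one_mul,
    inner_evProj_left]

theorem ofReal_inv_sqrt_mul_self {a : ℝ} (ha : 0 ≤ a) :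
    (((Real.sqrt a)⁻¹ : ℝ) : ℂ) * (((Real.sqrt a)⁻¹ : ℝ) : ℂ) = ((a⁻¹ : ℝ) : ℂ) := by
  rw [← Complex.ofReal_mul, ← mul_inv, Real.mul_self_sqrt ha]

theorem norm_sq_inv_sqrt_smul {a : ℝ} (ha : 0 ≤ a) (φ : Mode) :
    ‖(((Real.sqrt a)⁻¹ : ℝ) : ℂ) • φ‖ ^ 2 = a⁻¹ * ‖φ‖ ^ 2 := by
  rw [norm_smul, Complex.norm_real, Real.norm_of_nonneg (by positivity), mul_pow, inv_pow,
    Real.sq_sqrt ha]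

theorem ofReal_inv_sqrt_mul (hβ : β ≠ 0) :
    (((Real.sqrt (Co β))⁻¹ : ℝ) : ℂ) * (((Real.sqrt (Ce β))⁻¹ : ℝ) : ℂ) = (cInv β : ℂ) := by
  rw [← Complex.ofReal_mul, ← mul_inv, cInv, Real.sqrt_mul (Co_pos hβ).le]

theorem Moo_oddKet (hf : Measurable f) (hf1 : ∀ x, |f x| ≤ 1) :
    Moo μ β f (oddKet β) = (((Real.sqrt (Co β))⁻¹ : ℝ) : ℂ) • Moo μ β f (coherent β) := by
  rw [oddKet, map_smul, Moo_odProj hf hf1]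

theorem Mee_evenKet (hf : Measurable f) (hf1 : ∀ x, |f x| ≤ 1) :
    Mee μ β f (evenKet β) = (((Real.sqrt (Ce β))⁻¹ : ℝ) : ℂ) • Mee μ β f (coherent β) := by
  rw [evenKet, map_smul, Mee_evProj hf hf1]

theorem Moe_evenKet (hf : Measurable f) (hf1 : ∀ x, |f x| ≤ 1) (s : ℝ) :
    Moe μ β f s (evenKet β) = (((Real.sqrt (Ce β))⁻¹ : ℝ) : ℂ) • Moe μ β f s (coherent β) := by
  rw [evenKet, map_smul, Moe_evProj hf hf1]

theorem Meo_oddKet (hf : Measurable f) (hf1 : ∀ x, |f x| ≤ 1) (s : ℝ) :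
    Meo μ β f s (oddKet β) = (((Real.sqrt (Co β))⁻¹ : ℝ) : ℂ) • Meo μ β f s (coherent β) := by
  rw [oddKet, map_smul, Meo_odProj hf hf1]

theorem inner_oddKet_Moo (hf : Measurable f) (hf1 : ∀ x, |f x| ≤ 1) (hβ : β ≠ 0) :
    ⟪oddKet β, Moo μ β f (oddKet β)⟫_ℂ = lamOO μ β f := by
  rw [Moo_oddKet hf hf1, oddKet, inner_smul_left, inner_smul_right, Complex.conj_ofReal,
    inner_odProj_Moo hf hf1, ← mul_assoc, ofReal_inv_sqrt_mul_self (Co_pos hβ).le]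
  rfl

theorem inner_evenKet_Mee (hf : Measurable f) (hf1 : ∀ x, |f x| ≤ 1) :
    ⟪evenKet β, Mee μ β f (evenKet β)⟫_ℂ = lamEE μ β f := by
  rw [Mee_evenKet hf hf1, evenKet, inner_smul_left, inner_smul_right, Complex.conj_ofReal,
    inner_evProj_Mee hf hf1, ← mul_assoc, ofReal_inv_sqrt_mul_self (Ce_pos β).le]
  rfl

theorem inner_oddKet_Moe (hf : Measurable f) (hf1 : ∀ x, |f x| ≤ 1) (hβ : β ≠ 0) (s : ℝ) :
    ⟪oddKet β, Moe μ β f s (evenKet β)⟫_ℂ = lamOE μ β f s := by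
  rw [Moe_evenKet hf hf1, oddKet, inner_smul_left, inner_smul_right, Complex.conj_ofReal,
    inner_odProj_Moe hf hf1, ← mul_assoc, ofReal_inv_sqrt_mul hβ]
  rfl

theorem inner_Meo_oddKet (hf : Measurable f) (hf1 : ∀ x, |f x| ≤ 1) (hβ : β ≠ 0) (s : ℝ) :
    ⟪Meo μ β f s (oddKet β), evenKet β⟫_ℂ = lamOE μ β f s := by
  rw [Meo, ContinuousLinearMap.adjoint_inner_left, inner_oddKet_Moe hf hf1 hβ]

theorem inner_evenKet_Meo (hf : Measurable f) (hf1 : ∀ x, |f x| ≤ 1) (hβ : β ≠ 0) (s : ℝ) :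
    ⟪evenKet β, Meo μ β f s (oddKet β)⟫_ℂ = lamOE μ β f s := by
  rw [← inner_conj_symm, inner_Meo_oddKet hf hf1 hβ]
  exact star_lamOE hf hf1 s

/-- Pythagoras: removing the component of M_oo u along u subtracts |λ_oo|² from the squared norm.
The other σ and Δ parameters are residual norms in the same way. -/
theorem sigOO_eq (hf : Measurable f) (hf1 : ∀ x, |f x| ≤ 1) (hβ : β ≠ 0) :
    sigOO μ β f = ‖Moo μ β f (oddKet β) - lamOO μ β f • oddKet β‖ := by
  have h := (norm_sq_decomp (φ := Moo μ β f (oddKet β)) (norm_oddKet hβ)).2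
  rw [inner_oddKet_Moo hf hf1 hβ] at h
  rw [sigOO, ← norm_sq_inv_sqrt_smul (Co_pos hβ).le, ← Moo_oddKet hf hf1, h, add_sub_cancel_left,
    Real.sqrt_sq (norm_nonneg _)]

theorem sigEO_eq (hf : Measurable f) (hf1 : ∀ x, |f x| ≤ 1) (hβ : β ≠ 0) (s : ℝ) :
    sigEO μ β f s = ‖Meo μ β f s (oddKet β) - lamOE μ β f s • evenKet β‖ := by
  have h := (norm_sq_decomp (φ := Meo μ β f s (oddKet β)) (norm_evenKet β)).2
  rw [inner_evenKet_Meo hf hf1 hβ] at h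
  rw [sigEO, ← norm_sq_inv_sqrt_smul (Co_pos hβ).le, ← Meo_oddKet hf hf1, h, add_sub_cancel_left,
    Real.sqrt_sq (norm_nonneg _)]

/-- Expanding the inner product of residuals, all corrections collapse to a single -λ_oo λ_oe, and
self-adjointness of M_oo turns the leading term into ⟨β|M_oo M_oe|β⟩. -/
theorem sigOE_eq (hf : Measurable f) (hf1 : ∀ x, |f x| ≤ 1) (hβ : β ≠ 0) (s : ℝ) :
    sigOE μ β f s = ((sigOO μ β f)⁻¹ : ℝ) * ⟪Moo μ β f (oddKet β) - lamOO μ β f • oddKet β,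
      Moe μ β f s (evenKet β) - lamOE μ β f s • oddKet β⟫_ℂ := by
  have h1 : (starRingEnd ℂ) (lamOO μ β f) = lamOO μ β f := star_lamOO hf hf1
  have h2 : ⟪Moo μ β f (oddKet β), oddKet β⟫_ℂ = lamOO μ β f := by
    rw [← inner_conj_symm, inner_oddKet_Moo hf hf1 hβ, h1]
  have h3 : ⟪Moo μ β f (oddKet β), Moe μ β f s (evenKet β)⟫_ℂ
      = (cInv β : ℂ) * expect β (Moo μ β f ∘L Moe μ β f s) := by
    rw [← ContinuousLinearMap.adjoint_inner_right, (isSelfAdjoint_Moo hf hf1).adjoint_eq,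
      Moe_evenKet hf hf1, map_smul, oddKet, inner_smul_left, inner_smul_right,
      Complex.conj_ofReal, inner_odProj_Moo hf hf1, ← mul_assoc, ofReal_inv_sqrt_mul hβ]
    rfl
  rw [sigOE, inner_sub_left, inner_sub_right, inner_sub_right, inner_smul_left, inner_smul_right,
    inner_smul_left, inner_smul_right, h1, h2, h3, inner_oddKet_Moe hf hf1 hβ,
    inner_self_eq_norm_sq_to_K, norm_oddKet hβ]
  congr 1
  simp
  ring

theorem sigEE_eq (hf : Measurable f) (hf1 : ∀ x, |f x| ≤ 1) (hβ : β ≠ 0) (s : ℝ) :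
    sigEE μ β f s = ((sigEO μ β f s)⁻¹ : ℝ) * ⟪Meo μ β f s (oddKet β) - lamOE μ β f s • evenKet β,
      Mee μ β f (evenKet β) - lamEE μ β f • evenKet β⟫_ℂ := by
  have h1 : (starRingEnd ℂ) (lamOE μ β f s) = lamOE μ β f s := star_lamOE hf hf1 s
  have h3 : ⟪Meo μ β f s (oddKet β), Mee μ β f (evenKet β)⟫_ℂ
      = (cInv β : ℂ) * expect β (Moe μ β f s ∘L Mee μ β f) := by
    rw [Meo, ContinuousLinearMap.adjoint_inner_left, Mee_evenKet hf hf1, map_smul, oddKet,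
      inner_smul_left, inner_smul_right, Complex.conj_ofReal, inner_odProj_Moe hf hf1, ← mul_assoc,
      ofReal_inv_sqrt_mul hβ]
    rfl
  rw [sigEE, inner_sub_left, inner_sub_right, inner_sub_right, inner_smul_left, inner_smul_right,
    inner_smul_left, inner_smul_right, h1, inner_Meo_oddKet hf hf1 hβ, h3,
    inner_evenKet_Mee hf hf1, inner_self_eq_norm_sq_to_K, norm_evenKet]
  congr 1
  simp
  ring

theorem delOE_eq (hf : Measurable f) (hf1 : ∀ x, |f x| ≤ 1) (hβ : β ≠ 0) (s : ℝ) :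
    delOE μ β f s = Real.sqrt (‖Moe μ β f s (evenKet β) - lamOE μ β f s • oddKet β‖ ^ 2
      - ‖sigOE μ β f s‖ ^ 2) := by
  have h := (norm_sq_decomp (φ := Moe μ β f s (evenKet β)) (norm_oddKet hβ)).2
  rw [inner_oddKet_Moe hf hf1 hβ] at h
  rw [delOE, ← norm_sq_inv_sqrt_smul (Ce_pos β).le, ← Moe_evenKet hf hf1, h, add_sub_cancel_left]

theorem delEE_eq (hf : Measurable f) (hf1 : ∀ x, |f x| ≤ 1) (s : ℝ) :
    delEE μ β f s = Real.sqrt (‖Mee μ β f (evenKet β) - lamEE μ β f • evenKet β‖ ^ 2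
      - ‖sigEE μ β f s‖ ^ 2) := by
  have h := (norm_sq_decomp (φ := Mee μ β f (evenKet β)) (norm_evenKet β)).2
  rw [inner_evenKet_Mee hf hf1] at h
  rw [delEE, ← norm_sq_inv_sqrt_smul (Ce_pos β).le, ← Mee_evenKet hf hf1, h, add_sub_cancel_left]

theorem sixMatrix_eq_sixShape (hf : Measurable f) (hf1 : ∀ x, |f x| ≤ 1) (s κ go ge : ℝ) :
    sixMatrix μ β f s κ go ge = sixShape (1 - go) (κ * Co β + (lamOO μ β f).re - go)
      (κ * Ce β + (lamEE μ β f).re - ge) (1 - ge) (κ * Real.sqrt (Co β * Ce β) + (lamOE μ β f s).re)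
      (delOE μ β f s) (delEE μ β f s) (sigOO μ β f) (sigEO μ β f s) (sigOE μ β f s).re
      (sigEE μ β f s).re := by
  simp only [sixMatrix, sixShape, Complex.ofReal_sub, Complex.ofReal_add, Complex.ofReal_mul,
    Complex.ofReal_one, ofReal_re_of_star_eq (star_lamOO hf hf1),
    ofReal_re_of_star_eq (star_lamEE hf hf1), ofReal_re_of_star_eq (star_lamOE hf hf1 s),
    ofReal_re_of_star_eq (star_sigOE hf hf1 s), ofReal_re_of_star_eq (star_sigEE hf hf1 s)]

/-- The compression bound with u, v the normalised odd and even parts of |β⟩ and weights √C_o, √C_e,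
for which the κ term is the overlap of |β⟩ with the sector vector. -/
theorem sectorQuad_add_le (hf : Measurable f) (hf1 : ∀ x, |f x| ≤ 1)
    (hfs : ∀ x, f x + f (-x) ≤ 1) (hβ : β ≠ 0) {s : ℝ} (hs : s ^ 2 = 1) (κ go ge : ℝ)
    (φ ψ : Mode) :
    sectorQuad μ β f s φ ψ + κ * ‖⟪coherent β, odProj φ⟫_ℂ + ⟪coherent β, evProj ψ⟫_ℂ‖ ^ 2
        - go * ‖φ‖ ^ 2 - ge * ‖ψ‖ ^ 2
      ≤ sigmaSup (sixMatrix μ β f s κ go ge) * (‖φ‖ ^ 2 + ‖ψ‖ ^ 2) := by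
  have eOO := ofReal_re_of_star_eq (star_lamOO (μ := μ) (β := β) hf hf1)
  have eEE := ofReal_re_of_star_eq (star_lamEE (μ := μ) (β := β) hf hf1)
  have eOE := ofReal_re_of_star_eq (star_lamOE (μ := μ) (β := β) hf hf1 s)
  have esOE := ofReal_re_of_star_eq (star_sigOE (μ := μ) (β := β) hf hf1 s)
  have esEE := ofReal_re_of_star_eq (star_sigEE (μ := μ) (β := β) hf hf1 s)
  have h := block_quad_le_sigmaSup (B := Moe μ β f s) (isSelfAdjoint_Moo (μ := μ) (β := β) hf hf1)
    (isSelfAdjoint_Mee (μ := μ) (β := β) hf hf1) (sectorQuad_le hf hf1 hfs hs) (norm_oddKet hβ)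
    (norm_evenKet β) ((inner_oddKet_Moo hf hf1 hβ).trans eOO.symm)
    ((inner_evenKet_Mee hf hf1).trans eEE.symm) ((inner_oddKet_Moe hf hf1 hβ s).trans eOE.symm)
    (soe := (sigOE μ β f s).re) (see := (sigEE μ β f s).re)
    (by rw [esOE, eOO, eOE, ← sigOO_eq hf hf1 hβ, ← sigOE_eq hf hf1 hβ])
    (by rw [esEE, eOE, eEE, ← Meo, ← sigEO_eq hf hf1 hβ, ← sigEE_eq hf hf1 hβ])
    κ (Real.sqrt (Co β)) (Real.sqrt (Ce β)) go ge φ ψ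
  rw [esOE, esEE, eOO, eEE, eOE, ← Meo, ← sigOO_eq hf hf1 hβ, ← sigEO_eq hf hf1 hβ,
    ← delOE_eq hf hf1 hβ, ← delEE_eq hf hf1, Real.sq_sqrt (Co_pos hβ).le,
    Real.sq_sqrt (Ce_pos β).le, ← Real.sqrt_mul (Co_pos hβ).le,
    ← sixMatrix_eq_sixShape hf hf1, sqrt_Co_mul_inner_oddKet hβ, sqrt_Ce_mul_inner_evenKet] at h
  exact h

/-! ### Convexity of the bound -/

/-- For fixed z the quadratic form of the matrix is affine in (κ, go, ge), and `sigmaSup` is the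
maximum of these forms over unit vectors. -/
theorem convexOn_sigmaSup_sixMatrix (hf : Measurable f) (hf1 : ∀ x, |f x| ≤ 1) (s : ℝ) :
    ConvexOn ℝ Set.univ
      (fun q : ℝ × ℝ × ℝ => sigmaSup (sixMatrix μ β f s q.1 q.2.1 q.2.2)) := by
  refine ⟨convex_univ, fun p _ q _ a b ha hb hab => ?_⟩
  simp only [sixMatrix_eq_sixShape hf hf1]
  refine sigmaSup_le (isHermitian_sixShape ..) fun z => ?_
  have hp := mul_le_mul_of_nonneg_left (re_dotProduct_le_sigmaSup (isHermitian_sixShape (1 - p.2.1)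
    (p.1 * Co β + (lamOO μ β f).re - p.2.1) (p.1 * Ce β + (lamEE μ β f).re - p.2.2) (1 - p.2.2)
    (p.1 * Real.sqrt (Co β * Ce β) + (lamOE μ β f s).re) (delOE μ β f s) (delEE μ β f s)
    (sigOO μ β f) (sigEO μ β f s) (sigOE μ β f s).re (sigEE μ β f s).re) z) ha
  have hq := mul_le_mul_of_nonneg_left (re_dotProduct_le_sigmaSup (isHermitian_sixShape (1 - q.2.1)
    (q.1 * Co β + (lamOO μ β f).re - q.2.1) (q.1 * Ce β + (lamEE μ β f).re - q.2.2) (1 - q.2.2)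
    (q.1 * Real.sqrt (Co β * Ce β) + (lamOE μ β f s).re) (delOE μ β f s) (delEE μ β f s)
    (sigOO μ β f) (sigEO μ β f s) (sigOE μ β f s).re (sigEE μ β f s).re) z) hb
  rw [smul_eq_mul, smul_eq_mul, add_mul, mul_assoc, mul_assoc]
  refine le_trans (le_of_eq ?_) (add_le_add hp hq)
  -- The entries are affine rather than linear, so the constant parts match only because the weights
  -- sum to 1.
  obtain rfl : b = 1 - a := by linarith
  simp only [re_dotProduct_sixShape, sixQuad, Prod.fst_add, Prod.snd_add, Prod.smul_fst,
    Prod.smul_snd, smul_eq_mul]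
  ring

theorem convexOn_Bhet (hf : Measurable f) (hf1 : ∀ x, |f x| ≤ 1) :
    ConvexOn ℝ Set.univ (fun p : ℝ × ℝ => Bhet μ β f p.1 p.2) := by
  -- The two matrices arise from the linear substitutions (κ, 0, γ) and (κ, γ, 0), and a maximum of
  -- convex functions is convex.
  have h0 := (convexOn_sigmaSup_sixMatrix (μ := μ) (β := β) hf hf1 1).comp_linearMap
    ((LinearMap.fst ℝ ℝ ℝ).prod ((0 : ℝ × ℝ →ₗ[ℝ] ℝ).prod (LinearMap.snd ℝ ℝ ℝ)))
  have h1 := (convexOn_sigmaSup_sixMatrix (μ := μ) (β := β) hf hf1 (-1)).comp_linearMap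
    ((LinearMap.fst ℝ ℝ ℝ).prod ((LinearMap.snd ℝ ℝ ℝ).prod (0 : ℝ × ℝ →ₗ[ℝ] ℝ)))
  exact h0.sup h1

end Parameters

/-! ### The operator inequality -/

theorem inner_self_eq_re {H : Type*} [NormedAddCommGroup H] [InnerProductSpace ℂ H]
    [CompleteSpace H] {T : H →L[ℂ] H} (hT : IsSelfAdjoint T) (φ : H) :
    ⟪φ, T φ⟫_ℂ = ((⟪φ, T φ⟫_ℂ).re : ℂ) :=
  (hT.isSymmetric.coe_re_inner_self_apply φ).symm

theorem inner_sectorOp {μ β : ℝ} {f : ℝ → ℝ} (hf : Measurable f) (hf1 : ∀ x, |f x| ≤ 1)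
    (s : ℝ) (Ψ : WithA Mode) : ⟪Ψ, sectorOp μ β f s Ψ⟫_ℂ
      = (sectorQuad μ β f s (odProj (braA s Ψ)) (evProj (braA (-s) Ψ)) : ℂ) := by
  rw [sectorQuad, inner_Moo_odProj hf hf1, inner_Mee_evProj hf hf1, inner_Moe_proj hf hf1,
    sectorOp]
  simp only [add_apply, inner_add_right, ContinuousLinearMap.adjoint_inner_right,
    ContinuousLinearMap.comp_apply, Complex.ofReal_add]
  rw [ContinuousLinearMap.adjoint_inner_left,
    ← inner_conj_symm (Moe μ β f s (braA (-s) Ψ)) (braA s Ψ), Complex.add_conj,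
    ← inner_self_eq_re (isSelfAdjoint_Moo hf hf1), ← inner_self_eq_re (isSelfAdjoint_Mee hf hf1)]

theorem inner_fidProj (β : ℝ) (Ψ : WithA Mode) : ⟪Ψ, fidProj β Ψ⟫_ℂ
    = ((‖⟪coherent β, Ψ 0⟫_ℂ‖ ^ 2 + ‖⟪coherent β, parity (Ψ 1)⟫_ℂ‖ ^ 2 : ℝ) : ℂ) := by
  rw [← inner_parity_left, parity_coherent, PiLp.inner_apply, Fin.sum_univ_two]
  simp only [fidProj, add_apply, PiLp.add_apply, tens_apply, Fin.sum_univ_two, proj_apply, ket0,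
    ket1]
  simp only [InnerProductSpace.rankOne_apply, Matrix.cons_val_zero, Matrix.cons_val_one,
    Matrix.cons_val_fin_one, map_one, map_zero, mul_zero, mul_one, one_smul, zero_smul, add_zero,
    zero_add, inner_smul_right]
  rw [← inner_conj_symm (Ψ 0), ← inner_conj_symm (Ψ 1), RCLike.mul_conj, RCLike.mul_conj]
  push_cast
  rfl

theorem inner_trashProj (Ψ : WithA Mode) :
    ⟪Ψ, trashProj Ψ⟫_ℂ = ((‖braA (-1) Ψ‖ ^ 2 : ℝ) : ℂ) := by
  have h := inner_self_eq_norm_sq_to_K (𝕜 := ℂ) (braA (-1) Ψ)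
  rw [Complex.ofReal_pow]
  refine Eq.trans ?_ h
  rw [PiLp.inner_apply, Fin.sum_univ_two, braA_apply]
  simp only [trashProj, tens_apply, Fin.sum_univ_two, proj_apply, ketM, one_div]
  simp only [Matrix.cons_val_zero, Matrix.cons_val_one, Matrix.cons_val_fin_one,
    map_neg, map_inv₀, Complex.conj_ofReal, ContinuousLinearMap.id_apply, inner_add_left,
    inner_add_right, inner_smul_left, inner_smul_right, mul_neg, neg_mul, inv_sqrt_two_mul_self,
    Complex.ofReal_neg, Complex.ofReal_one, map_one, neg_neg]
  have e := inv_sqrt_two_mul_self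
  linear_combination (⟪Ψ 0, Ψ 0⟫_ℂ - ⟪Ψ 0, Ψ 1⟫_ℂ - ⟪Ψ 1, Ψ 0⟫_ℂ + ⟪Ψ 1, Ψ 1⟫_ℂ) * (-e)

theorem norm_sq_eq_braA (Ψ : WithA Mode) : ‖Ψ‖ ^ 2 = ‖braA 1 Ψ‖ ^ 2 + ‖braA (-1) Ψ‖ ^ 2 := by
  have h := parallelogram_law_with_norm ℂ (Ψ 0) (Ψ 1)
  have hn : ‖(Real.sqrt 2 : ℂ)⁻¹‖ ^ 2 = 2⁻¹ := by
    rw [norm_inv, Complex.norm_real, inv_pow, Real.norm_of_nonneg (by positivity),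
      Real.sq_sqrt (by norm_num)]
  rw [PiLp.norm_sq_eq_of_L2, Fin.sum_univ_two, braA_apply, braA_apply, norm_smul, norm_smul,
    mul_pow, mul_pow, hn]
  simp only [Complex.ofReal_one, Complex.ofReal_neg, one_smul, neg_smul, ← sub_eq_add_neg]
  linarith

/-- The difference and the sum of ⟨b|Ψ₀⟩ and ⟨b|P|Ψ₁⟩, divided by √2, are exactly the overlaps of b
with the two sectors; the parallelogram law then splits the fidelity term between them. -/
theorem norm_sq_fid_eq (b : Mode) (Ψ : WithA Mode) :
    ‖⟪b, Ψ 0⟫_ℂ‖ ^ 2 + ‖⟪b, parity (Ψ 1)⟫_ℂ‖ ^ 2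
      = ‖⟪b, odProj (braA 1 Ψ)⟫_ℂ + ⟪b, evProj (braA (-1) Ψ)⟫_ℂ‖ ^ 2
        + ‖⟪b, odProj (braA (-1) Ψ)⟫_ℂ + ⟪b, evProj (braA 1 Ψ)⟫_ℂ‖ ^ 2 := by
  have h := parallelogram_law_with_norm ℂ ⟪b, Ψ 0⟫_ℂ ⟪b, parity (Ψ 1)⟫_ℂ
  have hn : ‖(Real.sqrt 2 : ℂ)⁻¹‖ ^ 2 = 2⁻¹ := by
    rw [norm_inv, Complex.norm_real, inv_pow, Real.norm_of_nonneg (by positivity),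
      Real.sq_sqrt (by norm_num)]
  have e1 : ⟪b, odProj (braA 1 Ψ)⟫_ℂ + ⟪b, evProj (braA (-1) Ψ)⟫_ℂ
      = (Real.sqrt 2 : ℂ)⁻¹ * (⟪b, Ψ 0⟫_ℂ - ⟪b, parity (Ψ 1)⟫_ℂ) := by
    simp only [odProj_apply, evProj_apply, braA_apply, inner_smul_right, inner_add_right,
      inner_sub_right, map_smul, map_add, Complex.ofReal_one, Complex.ofReal_neg]
    ring
  have e2 : ⟪b, odProj (braA (-1) Ψ)⟫_ℂ + ⟪b, evProj (braA 1 Ψ)⟫_ℂ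
      = (Real.sqrt 2 : ℂ)⁻¹ * (⟪b, Ψ 0⟫_ℂ + ⟪b, parity (Ψ 1)⟫_ℂ) := by
    simp only [odProj_apply, evProj_apply, braA_apply, inner_smul_right, inner_add_right,
      inner_sub_right, map_smul, map_add, Complex.ofReal_one, Complex.ofReal_neg]
    ring
  rw [e1, e2, norm_mul, norm_mul, mul_pow, mul_pow, hn]
  linarith

/-- The quadratic form at Ψ is the sum of the two sector forms. The ⟨-|_A component has its even
part in the sector s = 1 and its odd part in s = -1, so γ is charged as (0, γ) and as (γ, 0)
respectively. -/
theorem Mhet_le {μ β : ℝ} {f : ℝ → ℝ} {up um : ℝ → Fin 2 → ℂ} (hf : Measurable f)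
    (hf1 : ∀ x, |f x| ≤ 1) (hfs : ∀ x, f x + f (-x) ≤ 1) (hβ : β ≠ 0)
    (hM : Mph β f up um = sectorOp μ β f 1 + sectorOp μ β f (-1)) (κ γ : ℝ) :
    Mhet β f up um κ γ ≤ (Bhet μ β f κ γ : ℂ) • (1 : WithA Mode →L[ℂ] WithA Mode) := by
  rw [ContinuousLinearMap.le_def, ContinuousLinearMap.isPositive_iff_complex]
  intro Ψ
  set φ₁ := odProj (braA 1 Ψ) with hφ₁
  set ψ₁ := evProj (braA (-1) Ψ) with hψ₁
  set φ₂ := odProj (braA (-1) Ψ) with hφ₂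
  set ψ₂ := evProj (braA 1 Ψ) with hψ₂
  set b := coherent (β : ℂ) with hb
  have hp := norm_sq_eq_odProj_add_evProj (braA 1 Ψ)
  have hm := norm_sq_eq_odProj_add_evProj (braA (-1) Ψ)
  rw [← hφ₁, ← hψ₂] at hp
  rw [← hφ₂, ← hψ₁] at hm
  have key : ⟪Ψ, ((Bhet μ β f κ γ : ℂ) • (1 : WithA Mode →L[ℂ] WithA Mode)
      - Mhet β f up um κ γ) Ψ⟫_ℂ
      = ((Bhet μ β f κ γ * (‖φ₁‖ ^ 2 + ‖ψ₂‖ ^ 2 + (‖φ₂‖ ^ 2 + ‖ψ₁‖ ^ 2))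
        - (sectorQuad μ β f 1 φ₁ ψ₁ + sectorQuad μ β f (-1) φ₂ ψ₂
          + κ * (‖⟪b, φ₁⟫_ℂ + ⟪b, ψ₁⟫_ℂ‖ ^ 2 + ‖⟪b, φ₂⟫_ℂ + ⟪b, ψ₂⟫_ℂ‖ ^ 2)
          - γ * (‖φ₂‖ ^ 2 + ‖ψ₁‖ ^ 2)) : ℝ) : ℂ) := by
    have hΨ := inner_self_eq_norm_sq_to_K (𝕜 := ℂ) Ψ
    have h1 := inner_sectorOp (μ := μ) (β := β) hf hf1 1 Ψ
    have h2 := inner_sectorOp (μ := μ) (β := β) hf hf1 (-1) Ψ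
    have h3 := inner_fidProj β Ψ
    have h4 := inner_trashProj Ψ
    rw [neg_neg] at h2
    rw [norm_sq_fid_eq] at h3
    rw [hm] at h4
    have h5 : ((‖Ψ‖ : ℂ)) ^ 2 = ((‖φ₁‖ ^ 2 + ‖ψ₂‖ ^ 2 + (‖φ₂‖ ^ 2 + ‖ψ₁‖ ^ 2) : ℝ) : ℂ) := by
      rw [← hp, ← hm, ← norm_sq_eq_braA, Complex.ofReal_pow]
    replace hΨ := hΨ.trans h5
    simp only [Mhet, hM, sub_apply, add_apply, smul_apply, inner_sub_right, inner_add_right,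
      inner_smul_right, h1, h2, h3, h4]
    rw [show ⟪Ψ, (1 : WithA Mode →L[ℂ] WithA Mode) Ψ⟫_ℂ = _ from hΨ]
    push_cast
    rfl
  -- The positivity criterion has the operator in the first slot of the inner product, while `key`
  -- has it in the second; the value is real, so conjugation is harmless.
  rw [← inner_conj_symm, key, Complex.conj_ofReal]
  refine ⟨rfl, ?_⟩
  have h1 := sectorQuad_add_le (μ := μ) hf hf1 hfs hβ (s := 1) (by norm_num) κ 0 γ φ₁ ψ₁
  have h2 := sectorQuad_add_le (μ := μ) hf hf1 hfs hβ (s := -1) (by norm_num) κ γ 0 φ₂ ψ₂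
  have e1 : odProj φ₁ = φ₁ := odProj_odProj _
  have e2 : odProj φ₂ = φ₂ := odProj_odProj _
  have e3 : evProj ψ₁ = ψ₁ := evProj_evProj _
  have e4 : evProj ψ₂ = ψ₂ := evProj_evProj _
  rw [e1, e3] at h1
  rw [e2, e4] at h2
  have g1 : sigmaSup (sixMatrix μ β f 1 κ 0 γ) ≤ Bhet μ β f κ γ := le_max_left _ _
  have g2 : sigmaSup (sixMatrix μ β f (-1) κ γ 0) ≤ Bhet μ β f κ γ := le_max_right _ _
  have k1 := mul_le_mul_of_nonneg_right g1 (show 0 ≤ ‖φ₁‖ ^ 2 + ‖ψ₁‖ ^ 2 by positivity)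
  have k2 := mul_le_mul_of_nonneg_right g2 (show 0 ≤ ‖φ₂‖ ^ 2 + ‖ψ₂‖ ^ 2 by positivity)
  simp only [RCLike.re_to_complex, Complex.ofReal_re]
  linarith

end HetQKD

end

/-! ### Assembly of the main theorem -/

open HetQKD in
theorem mainTheorem3 (μ β : ℝ) (hβ : 0 < β) (hβμ : β < Real.sqrt μ)
    (f : ℝ → ℝ) (hf_meas : Measurable f) (hf_nonneg : ∀ x, 0 ≤ f x)
    (hf_sum : ∀ x, f x + f (-x) ≤ 1)
    (up um : ℝ → Fin 2 → ℂ)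
    (hup : ∀ w, IsPosEigenvector (tau01 μ β w) (up w))
    (hum : ∀ w, IsNegEigenvector (tau01 μ β w) (um w)) :
    -- all operator integrals converge weakly to bounded operators
    (WeaklyIntegrable MeasureTheory.volume (phForm β f up um) ∧
      WeaklyIntegrable MeasureTheory.volume (ooForm μ β f) ∧
      WeaklyIntegrable MeasureTheory.volume (eeForm μ β f) ∧
      WeaklyIntegrable MeasureTheory.volume (oeForm μ β f 1) ∧
      WeaklyIntegrable MeasureTheory.volume (oeForm μ β f (-1))) ∧
    -- values of the weights, and reality of the parameters
    (Co β = Real.exp (-β ^ 2) * Real.sinh (β ^ 2) ∧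
      Ce β = Real.exp (-β ^ 2) * Real.cosh (β ^ 2)) ∧
    (star (lamOO μ β f) = lamOO μ β f ∧ star (lamEE μ β f) = lamEE μ β f ∧
      ∀ s : ℝ, s = 1 ∨ s = -1 →
        star (lamOE μ β f s) = lamOE μ β f s ∧ star (sigOE μ β f s) = sigOE μ β f s ∧
        star (sigEE μ β f s) = sigEE μ β f s) ∧
    -- convexity of the bound
    ConvexOn ℝ Set.univ (fun p : ℝ × ℝ => Bhet μ β f p.1 p.2) ∧
    -- the operator inequality
    ∀ κ γ : ℝ, 0 ≤ κ → 0 ≤ γ →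
      Mhet β f up um κ γ ≤ (Bhet μ β f κ γ : ℂ) • (1 : WithA Mode →L[ℂ] WithA Mode) := by
  -- The upper bound f ≤ 1 follows from f(x) + f(-x) ≤ 1 and f(-x) ≥ 0.
  have hf1 : ∀ x, |f x| ≤ 1 := fun x => by
    rw [abs_of_nonneg (hf_nonneg x)]
    linarith [hf_nonneg (-x), hf_sum x]
  have hph := hasWeakIntegral_phForm (β := β) hf_meas hf_nonneg hf1
    fun w => twistW_eq (hup w) (hum w)
  refine ⟨⟨⟨_, hph⟩, ⟨_, (hasWeakIntegral_Moo hf_meas hf1).1⟩,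
    ⟨_, (hasWeakIntegral_Mee hf_meas hf1).1⟩, ⟨_, (hasWeakIntegral_Moe hf_meas hf1 1).1⟩,
    ⟨_, (hasWeakIntegral_Moe hf_meas hf1 (-1)).1⟩⟩, ⟨Co_eq β, Ce_eq β⟩,
    ⟨star_lamOO hf_meas hf1, star_lamEE hf_meas hf1, fun s _ =>
      ⟨star_lamOE hf_meas hf1 s, star_sigOE hf_meas hf1 s, star_sigEE hf_meas hf1 s⟩⟩,
    convexOn_Bhet hf_meas hf1, fun κ γ _ _ => ?_⟩
  exact Mhet_le hf_meas hf1 hf_sum hβ.ne' hph.weakIntegral_eq κ γ
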